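/- Let $R$ be a commutative ring with identity, $C(R)$ the category of unbounded cochain complexes of $R$-modules and $K(R)$ its homotopy category. For $M,N\in C(R)$ let $M\otimes_R N$ be the total tensor product complex, and let $\mathrm{Hom}^\bullet_R(M,N)$ be the complex with $\mathrm{Hom}^i_R(M,N)=\prod_{j}\mathrm{Hom}_R(M^j,N^{i+j})$ and $d^i(f)=d_N\circ f-(-1)^i f\circ d_M$. A complex $M$ is pure acyclic if $N\otimes_R M$ is acyclic for every $R$-module $N$; a morphism in $C(R)$ is a pure quasi-isomorphism if its mapping cone is pure acyclic. Let $K_{pac}(R)\subseteq K(R)$ be the full subcategory of pure acyclic complexes, $D_{pur}(R)=K(R)/K_{pac}(R)$ the Verdier quotient, and $Q:C(R)\to D_{pur}(R)$ the canonical functor. A module $P$ (resp. $I$) is pure projective (resp. pure injective) if $\mathrm{Hom}^\bullet_R(P,-)$ (resp. $\mathrm{Hom}^\bullet_R(-,I)$) preserves pure acyclic complexes. A pure projective resolution of $M$ is a pure quasi-isomorphism $P_M\to M$, where $P_M$ is a complex of pure projective modules such that $\mathrm{Hom}^\bullet_R(P_M,-)$ preserves pure acyclic complexes; a pure injective resolution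 of $N$ is a pure quasi-isomorphism $N\to I_N$, where $I_N$ is a complex of pure injective modules such that $\mathrm{Hom}^\bullet_R(-,I_N)$ preserves pure acyclic complexes. Every complex in $C(R)$ has a pure projective resolution and a pure injective resolution. The tensor product of complexes descends to $D_{pur}(R)$: there is a symmetric monoidal structure on $D_{pur}(R)$ for which $Q$ is a strong symmetric monoidal functor, where $C(R)$ carries the total tensor product and the symmetry $a\otimes b\mapsto(-1)^{ij}\,b\otimes a$ on $A^i\otimes_R B^j$. Moreover, for every choice of pure projective resolutions $P_M\to M$ and pure injective resolutions $N\to I_N$ of all complexes, the assignment $$PHom^\bullet_R(M,N):=\mathrm{Hom}^\bullet_R(P_M,I_N)$$ defines a functor $D_{pur}(R)^{op}\times D_{pur}(R)\to D_{pur}(R)$, whose action on morphisms $f:M'\to M$ and $g:N\to N'$ of $D_{pur}(R)$ is $\mathrm{Hom}^\bullet_R(f',g')$ for any morphisms of complexes $f':P_{M'}\to P_M$ and $g':I_N\to I_{N'}$ representing $f$ and $g$; and there are isomorphisms, natural in $A,B,C\in D_{pur}(R)$, $$PHom^\bullet_R(A\otimes_R B,C)\cong PHom^\bullet_R(A,PHom^\bullet_R(B,C))\quad\text{in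 } D_{pur}(R),$$ $$\mathrm{Hom}_{D_{pur}(R)}(A\otimes_R B,C)\cong \mathrm{Hom}_{D_{pur}(R)}(A,PHom^\bullet_R(B,C))\quad\text{of } R\text{-modules}.$$ The first isomorphism is the one induced by the second: for all $X$, composition with it corresponds to the chain $\mathrm{Hom}(X\otimes(A\otimes B),C)\cong \mathrm{Hom}((X\otimes A)\otimes B,C)\cong \mathrm{Hom}(X\otimes A,PHom^\bullet_R(B,C))\cong \mathrm{Hom}(X,PHom^\bullet_R(A,PHom^\bullet_R(B,C)))$. Consequently $D_{pur}(R)$ is a closed symmetric monoidal category with internal Hom functor $PHom^\bullet_R$, the second isomorphism being its tensor-Hom adjunction. -/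

import Mathlib

open CategoryTheory MonoidalCategory Limits Opposite

universe u

noncomputable section

namespace PureDerived

variable (R : Type u) [CommRing R]

/-- The category of unbounded cochain complexes of `R`-modules. -/
abbrev Cpx : Type (u + 1) := CochainComplex (ModuleCat.{u} R) ℤ

variable {R}

/-- The internal Hom complex: in degree `n` it is the module `∏ j, Hom (M^j, N^(j+n))`, with
differential `f ↦ d_N ∘ f - (-1)^n f ∘ d_M`. -/
def homCpx (M N : Cpx R) : Cpx R where
  X n := ModuleCat.of R (CochainComplex.HomComplex.Cochain M N n)
  d i j := ModuleCat.ofHom (CochainComplex.HomComplex.δ_hom R M N i j)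
  shape i j hij := by
    ext z : 2
    exact CochainComplex.HomComplex.δ_shape i j hij z
  d_comp_d' i j k _ _ := by
    ext z : 2
    exact CochainComplex.HomComplex.δ_δ i j k z

/-- The linear map `z ↦ g ∘ z ∘ f` on homogeneous elements of degree `n` of Hom complexes. -/
def cochainMap {M M' N N' : Cpx R} (f : M' ⟶ M) (g : N ⟶ N') (n : ℤ) :
    CochainComplex.HomComplex.Cochain M N n →ₗ[R] CochainComplex.HomComplex.Cochain M' N' n where
  toFun z := CochainComplex.HomComplex.Cochain.mk (fun p q hpq => f.f p ≫ z.v p q hpq ≫ g.f q)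
  map_add' z w := by ext; simp
  map_smul' r z := by ext; simp

lemma δ_cochainMap {M M' N N' : Cpx R} (f : M' ⟶ M) (g : N ⟶ N') (i j : ℤ) (hij : i + 1 = j)
    (z : CochainComplex.HomComplex.Cochain M N i) :
    CochainComplex.HomComplex.δ i j (cochainMap f g i z) =
      cochainMap f g j (CochainComplex.HomComplex.δ i j z) := by
  refine CochainComplex.HomComplex.Cochain.ext _ _ fun p q hpq => ?_
  simp [cochainMap, CochainComplex.HomComplex.δ_v i j hij _ p q hpq _ _ rfl rfl]

/-- The map `z ↦ g ∘ z ∘ f` of internal Hom complexes. -/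
def homCpxMap {M M' N N' : Cpx R} (f : M' ⟶ M) (g : N ⟶ N') : homCpx M N ⟶ homCpx M' N' where
  f n := ModuleCat.ofHom (cochainMap f g n)
  comm' i j hij := by
    ext z : 2
    exact δ_cochainMap f g i j hij z

/-- The differential of the tensor product of complexes, on the summand `A^i ⊗ B^j`. -/
lemma ιTensorObj_d (A B : Cpx R) (i j n m : ℤ) (h : i + j = n) (hnm : n + 1 = m) :
    HomologicalComplex.ιTensorObj A B i j n h ≫ (A ⊗ B).d n m =
      A.d i (i + 1) ▷ B.X j ≫ HomologicalComplex.ιTensorObj A B (i + 1) j m (by lia) +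
      i.negOnePow • (A.X i ◁ B.d j (j + 1) ≫
        HomologicalComplex.ιTensorObj A B i (j + 1) m (by lia)) := by
  change _ ≫ (HomologicalComplex.tensorObj A B).d n m = _
  rw [HomologicalComplex.mapBifunctor.d_eq, Preadditive.comp_add,
    HomologicalComplex.mapBifunctor.ι_D₁, HomologicalComplex.mapBifunctor.ι_D₂,
    HomologicalComplex.mapBifunctor.d₁_eq A B _ _ (i₁' := i + 1) rfl j m (by dsimp; lia),
    HomologicalComplex.mapBifunctor.d₂_eq A B _ _ i (i₂' := j + 1) rfl m (by dsimp; lia)]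
  simp [ComplexShape.ε₁, ComplexShape.ε₂, TotalComplexShape.ε₁, TotalComplexShape.ε₂]

/-- The morphism `A ⊗ B ⟶ B ⊗ A` which is `a ⊗ b ↦ (-1)^(ij) b ⊗ a` on `A^i ⊗ B^j`. -/
def koszulBraiding (A B : Cpx R) : A ⊗ B ⟶ B ⊗ A where
  f n := HomologicalComplex.mapBifunctorDesc (fun i j h =>
    (i * j).negOnePow • ((β_ (A.X i) (B.X j)).hom ≫
      HomologicalComplex.ιTensorObj B A j i n ((add_comm j i).trans h)))
  comm' n m hnm := by
    refine HomologicalComplex.mapBifunctor.hom_ext fun i j h => ?_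
    replace h : i + j = n := h
    replace hnm : n + 1 = m := hnm
    rw [HomologicalComplex.ι_mapBifunctorDesc_assoc, Linear.units_smul_comp, Category.assoc,
      ιTensorObj_d B A j i n m ((add_comm j i).trans h) hnm, ← Category.assoc]
    refine Eq.trans ?_ (congrArg (· ≫ HomologicalComplex.mapBifunctorDesc _)
      (ιTensorObj_d A B i j n m h hnm)).symm
    simp only [Preadditive.add_comp, Linear.units_smul_comp, Category.assoc,
      HomologicalComplex.ι_mapBifunctorDesc, Linear.comp_units_smul, Preadditive.comp_add]
    rw [BraidedCategory.braiding_naturality_left_assoc,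
      BraidedCategory.braiding_naturality_right_assoc, add_comm, smul_add, smul_smul, smul_smul]
    congr 2
    · rw [← Int.negOnePow_add]
      exact congrArg _ (by ring)
    · rw [← Int.negOnePow_add, Int.negOnePow_eq_iff]
      exact ⟨-i, by ring⟩

/-- A complex `M` is pure acyclic if `N ⊗ M` is acyclic for every module `N`. -/
def IsPureAcyclic (M : Cpx R) : Prop :=
  ∀ N : ModuleCat.{u} R,
    (((tensorLeft N).mapHomologicalComplex (ComplexShape.up ℤ)).obj M).Acyclic

/-- A morphism is a pure quasi-isomorphism if its mapping cone is pure acyclic. -/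
def IsPureQuasiIso {M N : Cpx R} (f : M ⟶ N) : Prop :=
  IsPureAcyclic (CochainComplex.mappingCone f)

/-- `Hom(P, -)` preserves pure acyclic complexes. -/
def IsKPureProjective (P : Cpx R) : Prop :=
  ∀ M : Cpx R, IsPureAcyclic M → IsPureAcyclic (homCpx P M)

/-- `Hom(-, I)` preserves pure acyclic complexes. -/
def IsKPureInjective (I : Cpx R) : Prop :=
  ∀ M : Cpx R, IsPureAcyclic M → IsPureAcyclic (homCpx M I)

/-- A module `P` is pure projective if `Hom(P, -)` preserves pure acyclic complexes, where `P` is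
seen as a complex concentrated in degree `0`. -/
def IsPureProjective (P : ModuleCat.{u} R) : Prop :=
  IsKPureProjective ((CochainComplex.singleFunctor (ModuleCat.{u} R) 0).obj P)

/-- A module `I` is pure injective if `Hom(-, I)` preserves pure acyclic complexes, where `I` is
seen as a complex concentrated in degree `0`. -/
def IsPureInjective (I : ModuleCat.{u} R) : Prop :=
  IsKPureInjective ((CochainComplex.singleFunctor (ModuleCat.{u} R) 0).obj I)

/-- A pure projective resolution `P_M ⟶ M` of a complex. -/
structure PureProjectiveResolution (M : Cpx R) where
  /-- the resolving complex -/
  cpx : Cpx R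
  /-- the augmentation -/
  π : cpx ⟶ M
  isPureProjective : ∀ i : ℤ, IsPureProjective (cpx.X i)
  isPureQuasiIso : IsPureQuasiIso π
  isKPureProjective : IsKPureProjective cpx

/-- A pure injective resolution `N ⟶ I_N` of a complex. -/
structure PureInjectiveResolution (N : Cpx R) where
  /-- the resolving complex -/
  cpx : Cpx R
  /-- the coaugmentation -/
  ι : N ⟶ cpx
  isPureInjective : ∀ i : ℤ, IsPureInjective (cpx.X i)
  isPureQuasiIso : IsPureQuasiIso ι
  isKPureInjective : IsKPureInjective cpx

variable (R)

/-- The homotopy category `K(R)`. -/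
abbrev K : Type (u + 1) := HomotopyCategory (ModuleCat.{u} R) (ComplexShape.up ℤ)

/-- The full subcategory `K_pac(R)` of pure acyclic complexes in `K(R)`. -/
def Kpac : ObjectProperty (K R) := fun X => IsPureAcyclic X.as

lemma Kpac_iff (X : K R) :
    Kpac R X ↔ ∀ N : ModuleCat.{u} R, (HomotopyCategory.subcategoryAcyclic _).inverseImage
      ((tensorLeft N).mapHomotopyCategory (ComplexShape.up ℤ)) X :=
  forall_congr' fun _ =>
    (HomotopyCategory.quotient_obj_mem_subcategoryAcyclic_iff_acyclic _).symm

instance : (Kpac R).IsClosedUnderIsomorphisms where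
  of_iso e h := (Kpac_iff R _).2 fun N =>
    ObjectProperty.prop_of_iso _ e ((Kpac_iff R _).1 h N)

instance : (Kpac R).IsTriangulated where
  exists_zero := ⟨_, isZero_zero (K R), (Kpac_iff R _).2 fun _ => ObjectProperty.prop_zero _⟩
  isStableUnderShiftBy n :=
    { le_shift := fun _ h => (Kpac_iff R _).2 fun N =>
        ObjectProperty.le_shift _ n _ ((Kpac_iff R _).1 h N) }
  toIsTriangulatedClosed₂ := .mk' fun T hT h₁ h₃ => (Kpac_iff R _).2 fun N =>
    ObjectProperty.ext_of_isTriangulatedClosed₂ _ T hT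
      ((Kpac_iff R _).1 h₁ N) ((Kpac_iff R _).1 h₃ N)

/-- The pure derived category, the Verdier quotient `K(R) / K_pac(R)`: the localization of `K(R)`
at the morphisms whose cone lies in `K_pac(R)`. -/
def Dpur : Type (u + 1) := (Kpac R).trW.Localization

instance : Category (Dpur R) := inferInstanceAs (Category (Kpac R).trW.Localization)

/-- The localization functor `K(R) ⥤ D_pur(R)`. -/
def Qh : K R ⥤ Dpur R := (Kpac R).trW.Q

instance : (Qh R).IsLocalization (Kpac R).trW :=
  inferInstanceAs ((Kpac R).trW.Q.IsLocalization (Kpac R).trW)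

instance : Preadditive (Dpur R) := Localization.preadditive (Qh R) (Kpac R).trW

instance : (Qh R).Additive := Localization.functor_additive (Qh R) (Kpac R).trW

instance : Linear R (Dpur R) := Localization.linear R (Qh R) (Kpac R).trW

/-- The canonical functor `C(R) ⥤ K(R) ⥤ D_pur(R)`. -/
def Q : Cpx R ⥤ Dpur R := HomotopyCategory.quotient _ _ ⋙ Qh R

variable {R}

/-- The pure derived Hom functor `PHom : D_pur(R)ᵒᵖ × D_pur(R) ⥤ D_pur(R)` attached to a choice of
pure projective resolutions `P_M ⟶ M` and pure injective resolutions `N ⟶ I_N`. Its value at `(M, N)`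
is `Hom(P_M, I_N)`, and it sends a pair of morphisms `f : M' ⟶ M` and `g : N ⟶ N'` of `D_pur(R)` to
the map `Hom(f', g')` for every choice of morphisms of complexes `f' : P_M' ⟶ P_M` and
`g' : I_N ⟶ I_N'` which represent `f` and `g`. -/
structure PureDerivedHom (P : ∀ M : Cpx R, PureProjectiveResolution M)
    (I : ∀ N : Cpx R, PureInjectiveResolution N) where
  /-- the underlying bifunctor -/
  functor : (Dpur R)ᵒᵖ ⥤ Dpur R ⥤ Dpur R
  /-- the identification of its values -/
  iso (M N : Cpx R) : (functor.obj (op ((Q R).obj M))).obj ((Q R).obj N) ≅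
    (Q R).obj (homCpx (P M).cpx (I N).cpx)
  iso_naturality {M M' N N' : Cpx R} (f : (Q R).obj M' ⟶ (Q R).obj M)
    (g : (Q R).obj N ⟶ (Q R).obj N') (f' : (P M').cpx ⟶ (P M).cpx) (g' : (I N).cpx ⟶ (I N').cpx)
    (hf : (Q R).map f' ≫ (Q R).map (P M).π = (Q R).map (P M').π ≫ f)
    (hg : (Q R).map (I N).ι ≫ (Q R).map g' = g ≫ (Q R).map (I N').ι) :
    ((functor.map f.op).app ((Q R).obj N) ≫ (functor.obj (op ((Q R).obj M'))).map g) ≫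
      (iso M' N').hom = (iso M N).hom ≫ (Q R).map (homCpxMap f' g')

/-- `PHom(B, C)` for objects of `D_pur(R)`. -/
abbrev PureDerivedHom.obj {P : ∀ M : Cpx R, PureProjectiveResolution M}
    {I : ∀ N : Cpx R, PureInjectiveResolution N} (H : PureDerivedHom P I) (B C : Dpur R) : Dpur R :=
  (H.functor.obj (op B)).obj C

/-- `PHom(b, c)` for morphisms of `D_pur(R)`. -/
abbrev PureDerivedHom.map {P : ∀ M : Cpx R, PureProjectiveResolution M}
    {I : ∀ N : Cpx R, PureInjectiveResolution N} (H : PureDerivedHom P I) {B B' C C' : Dpur R}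
    (b : B' ⟶ B) (c : C ⟶ C') : H.obj B C ⟶ H.obj B' C' :=
  (H.functor.map b.op).app C ≫ (H.functor.obj (op B')).map c

end PureDerived

end

/-!
Dualizing into injective cogenerators, a complex `X` is pure acyclic iff its character complex is
contractible, iff every morphism from `A ⊗ X` to the complex of cogenerators is null-homotopic, for
all complexes `A`. Hence pure acyclic complexes form a tensor ideal, so that `⊗` descends to
`D_pur(R)`, and they are exactly the left orthogonal in `K(R)` of their right orthogonal, so that
morphisms into an object of the right orthogonal (a K-pure-injective complex) are computed in
`K(R)`.

Pure acyclicity can also be tested by morphisms from the shifts of the finitely presented modules,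
which are compact objects of `K(R)`. Projective resolutions are therefore homotopy colimits of
cellular approximations. The shifted character complexes of finitely presented modules need not
be cocompact, but a composite of three morphisms that they do not detect vanishes on finitely
presented modules, and this ghost lemma makes injective resolutions homotopy limits.

If `I` is K-pure-injective, then so is `Hom(B, I)`, and the tensor-Hom adjunction of complexes
passes to homotopy classes. So `Hom(P_B, I_C)` represents `A ↦ Hom(A ⊗ B, C)` in `D_pur(R)`, which
makes it an internal Hom; everything else is formal in a closed symmetric monoidal category.
-/

universe v w

noncomputable section

namespace PureDerived

/-! ### Approximation in triangulated categories -/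

section Approximation

open Pretriangulated

variable {C : Type*} [Category* C] [Preadditive C]

section Triangle

variable [HasZeroObject C] [HasShift C ℤ] [∀ n : ℤ, (shiftFunctor C n).Additive]
  [Pretriangulated C] {T : Triangle C}

lemma exists_comp_mor₂_of_shift_injective (hT : T ∈ distTriang C) {A : C}
    (hA : ∀ w : A⟦(-1 : ℤ)⟧ ⟶ T.obj₁, w ≫ T.mor₁ = 0 → w = 0) (x : A ⟶ T.obj₃) :
    ∃ y : A ⟶ T.obj₂, x = y ≫ T.mor₂ := by
  refine Triangle.coyoneda_exact₃ _ hT x ?_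
  obtain ⟨w, hw⟩ := (shiftFunctor C (1 : ℤ)).map_surjective ((shiftNegShift A 1).hom ≫ x ≫ T.mor₃)
  have hwT : w ≫ T.mor₁ = 0 := (shiftFunctor C (1 : ℤ)).map_injective (by
    rw [Functor.map_comp, hw, Category.assoc, Category.assoc, comp_distTriang_mor_zero₃₁ _ hT,
      comp_zero, comp_zero, Functor.map_zero])
  rw [← cancel_epi (shiftNegShift A (1 : ℤ)).hom, ← hw, hA w hwT, Functor.map_zero, comp_zero]

lemma eq_zero_of_comp_mor₁_of_shift_surjective (hT : T ∈ distTriang C) {A : C}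
    (hA : ∀ x : A⟦(1 : ℤ)⟧ ⟶ T.obj₃, ∃ y : A⟦(1 : ℤ)⟧ ⟶ T.obj₂, x = y ≫ T.mor₂)
    {w : A ⟶ T.obj₁} (hw : w ≫ T.mor₁ = 0) : w = 0 := by
  apply (shiftFunctor C (1 : ℤ)).map_injective
  obtain ⟨x, hx⟩ := Triangle.coyoneda_exact₁ _ hT (w⟦(1 : ℤ)⟧')
    (by rw [← Functor.map_comp, hw, Functor.map_zero])
  obtain ⟨y, rfl⟩ := hA x
  rw [hx, Category.assoc, comp_distTriang_mor_zero₂₃ _ hT, comp_zero, Functor.map_zero]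

lemma eq_zero_of_mor₂_comp_of_shift_surjective (hT : T ∈ distTriang C) {A : C}
    (hA : ∀ x : T.obj₁ ⟶ A⟦(-1 : ℤ)⟧, ∃ y : T.obj₂ ⟶ A⟦(-1 : ℤ)⟧, x = T.mor₁ ≫ y)
    {w : T.obj₃ ⟶ A} (hw : T.mor₂ ≫ w = 0) : w = 0 := by
  obtain ⟨z, rfl⟩ := Triangle.yoneda_exact₃ _ hT w hw
  obtain ⟨x, hx⟩ := (shiftFunctor C (1 : ℤ)).map_surjective (z ≫ (shiftNegShift A 1).inv)
  obtain ⟨y, rfl⟩ := hA x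
  rw [← cancel_mono (shiftNegShift A (1 : ℤ)).inv, Category.assoc, ← hx, Functor.map_comp,
    ← Category.assoc, comp_distTriang_mor_zero₃₁ _ hT, zero_comp, zero_comp]

variable (P : ObjectProperty C) [P.IsStableUnderShift ℤ]

lemma trW_rightOrthogonal : P.rightOrthogonal.trW = P.isColocal := by
  refine le_antisymm ((ObjectProperty.le_isColocal_iff _ _).2 ?_) fun X Y f hf => ?_
  · rw [ObjectProperty.isColocal_trW]
    exact fun X hX Y f hY => hY f hX
  · obtain ⟨Z, g, h, hT⟩ := distinguished_cocone_triangle f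
    refine ⟨Z, g, h, hT, fun A x hA => ?_⟩
    obtain ⟨y, rfl⟩ := exists_comp_mor₂_of_shift_injective hT
      (fun w hw => (hf _ (P.le_shift (-1) _ hA)).1 (hw.trans zero_comp.symm)) x
    obtain ⟨y, rfl⟩ := (hf A hA).2 y
    have hfg : f ≫ g = 0 := comp_distTriang_mor_zero₁₂ _ hT
    change (y ≫ f) ≫ g = 0
    rw [Category.assoc, hfg, comp_zero]

lemma trW_leftOrthogonal : P.leftOrthogonal.trW = P.isLocal := by
  refine le_antisymm ((ObjectProperty.le_isLocal_iff _ _).2 ?_) fun X Y f hf => ?_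
  · rw [ObjectProperty.isLocal_trW]
    exact fun X hX Y f hY => hY f hX
  · obtain ⟨Z, g, h, hT⟩ := distinguished_cocone_triangle f
    refine ⟨Z, g, h, hT, fun A x hA => eq_zero_of_mor₂_comp_of_shift_surjective hT (fun x => ?_)
      ((hf A hA).1 ?_)⟩
    · obtain ⟨y, hy⟩ := (hf _ (P.le_shift (-1) _ hA)).2 x
      exact ⟨y, hy.symm⟩
    · have hfg : f ≫ g = 0 := comp_distTriang_mor_zero₁₂ _ hT
      change f ≫ g ≫ x = f ≫ 0
      rw [comp_zero, ← Category.assoc, hfg, zero_comp]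

end Triangle

section Telescope

variable {X : ℕ → C} [HasCoproduct X] (s : ∀ k, X k ⟶ X (k + 1))

/-- The endomorphism `1 - s` of a countable coproduct; its cone is the homotopy colimit of the
sequence `s`. -/
def telescope : ∐ X ⟶ ∐ X :=
  Sigma.desc fun k => Sigma.ι X k - s k ≫ Sigma.ι X (k + 1)

lemma ι_telescope (k : ℕ) :
    Sigma.ι X k ≫ telescope s = Sigma.ι X k - s k ≫ Sigma.ι X (k + 1) :=
  Sigma.ι_desc _ _

lemma telescope_π_zero : telescope s ≫ Sigma.π X 0 = Sigma.π X 0 :=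
  Sigma.hom_ext _ _ fun k => by
    rw [← Category.assoc, ι_telescope, Preadditive.sub_comp, Category.assoc,
      Sigma.ι_π_of_ne X (Nat.succ_ne_zero k), comp_zero, sub_zero]

lemma telescope_π_succ (k : ℕ) :
    telescope s ≫ Sigma.π X (k + 1) = Sigma.π X (k + 1) - Sigma.π X k ≫ s k :=
  Sigma.hom_ext _ _ fun j => by
    rw [← Category.assoc, ι_telescope, Preadditive.sub_comp, Preadditive.comp_sub, Category.assoc,
      ← Category.assoc _ _ (s k)]
    by_cases h : j = k
    · subst h
      rw [Sigma.ι_π_eq_id, Sigma.ι_π_eq_id, Category.comp_id, Category.id_comp]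
    · rw [Sigma.ι_π_of_ne X h, Sigma.ι_π_of_ne X (by lia : j + 1 ≠ k + 1), comp_zero, zero_comp]

lemma comp_π_eq_zero_of_comp_telescope {T : C} {w : T ⟶ ∐ X} (hw : w ≫ telescope s = 0) (k : ℕ) :
    w ≫ Sigma.π X k = 0 := by
  induction k with
  | zero => rw [← telescope_π_zero s, ← Category.assoc, hw, zero_comp]
  | succ k ih =>
    have h : w ≫ telescope s ≫ Sigma.π X (k + 1) = 0 := by rw [← Category.assoc, hw, zero_comp]
    rwa [telescope_π_succ, Preadditive.comp_sub, ← Category.assoc w _ (s k), ih, zero_comp,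
      sub_zero] at h

lemma ι_comp_of_telescope_comp {P : C} {π : ∐ X ⟶ P} (hπ : telescope s ≫ π = 0) (k : ℕ) :
    Sigma.ι X k ≫ π = s k ≫ Sigma.ι X (k + 1) ≫ π := by
  rw [← sub_eq_zero, ← Category.assoc (s k), ← Preadditive.sub_comp, ← ι_telescope,
    Category.assoc, hπ, comp_zero]

end Telescope

/-- Compactness of an object `T` of an additive category: every map from `T` to a coproduct indexed
by a type in the universe `w` is a finite sum of maps to the summands. -/
def IsCompactObject (T : C) : Prop :=
  ∀ ⦃ι : Type w⦄ (X : ι → C) [HasCoproduct X] (f : T ⟶ ∐ X),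
    ∃ (s : Finset ι) (g : ∀ i, T ⟶ X i), f = ∑ i ∈ s, g i ≫ Sigma.ι X i

lemma IsCompactObject.exists_eq_sum_comp_inj {T : C} (hT : IsCompactObject.{w} T) {ι : Type w}
    {X : ι → C} {c : Cofan X} (hc : IsColimit c) (f : T ⟶ c.pt) :
    ∃ (s : Finset ι) (g : ∀ i, T ⟶ X i), f = ∑ i ∈ s, g i ≫ c.inj i := by
  have : HasCoproduct X := ⟨c, hc⟩
  let e : ∐ X ≅ c.pt := (coproductIsCoproduct X).coconePointUniqueUpToIso hc
  obtain ⟨s, g, hg⟩ := hT X (f ≫ e.inv)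
  have he (i) : Sigma.ι X i ≫ e.hom = c.inj i :=
    (coproductIsCoproduct X).comp_coconePointUniqueUpToIso_hom hc ⟨i⟩
  refine ⟨s, g, ?_⟩
  rw [← cancel_mono e.inv, hg, Preadditive.sum_comp]
  simp only [← he, Category.assoc, e.hom_inv_id, Category.comp_id]

lemma IsCompactObject.exists_eq_sum_comp_comp_inj {T : C} (hT : IsCompactObject.{w} T) {ι : Type w}
    {X : ι → C} {c : Cofan X} (hc : IsColimit c) {p : ∀ i, c.pt ⟶ X i}
    (hp : ∀ i, c.inj i ≫ p i = 𝟙 (X i)) (hp' : ∀ i j, i ≠ j → c.inj i ≫ p j = 0) (f : T ⟶ c.pt) :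
    ∃ s : Finset ι, f = ∑ i ∈ s, f ≫ p i ≫ c.inj i := by
  obtain ⟨s, g, rfl⟩ := hT.exists_eq_sum_comp_inj hc f
  refine ⟨s, Finset.sum_congr rfl fun i hi => ?_⟩
  rw [← Category.assoc, Preadditive.sum_comp, Finset.sum_eq_single_of_mem i hi,
    Category.assoc (g i), hp, Category.comp_id]
  intro j _ hj
  rw [Category.assoc, hp' j i hj, comp_zero]

lemma IsCompactObject.eq_zero_of_comp_π {T : C} (hT : IsCompactObject.{w} T) {ι : Type w}
    [DecidableEq ι] {X : ι → C} [HasCoproduct X] {f : T ⟶ ∐ X}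
    (hf : ∀ i, f ≫ Sigma.π X i = 0) : f = 0 := by
  obtain ⟨s, hs⟩ := hT.exists_eq_sum_comp_comp_inj (coproductIsCoproduct X)
    (p := Sigma.π X) (Sigma.ι_π_eq_id X) (fun _ _ => Sigma.ι_π_of_ne X) f
  rw [hs]
  exact Finset.sum_eq_zero fun i _ => by rw [← Category.assoc, hf, zero_comp]

lemma IsCompactObject.exists_comp_eq_of_telescope_comp {T : C} (hT : IsCompactObject.{0} T)
    {X : ℕ → C} [HasCoproduct X] {s : ∀ k, X k ⟶ X (k + 1)} {P : C} {π : ∐ X ⟶ P}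
    (hπ : telescope s ≫ π = 0) (f : T ⟶ ∐ X) :
    ∃ (n : ℕ) (y : T ⟶ X n), f ≫ π = y ≫ Sigma.ι X n ≫ π := by
  have hs := ι_comp_of_telescope_comp s hπ
  obtain ⟨t, g, rfl⟩ := hT X f
  suffices h : ∃ N, ∀ n, N ≤ n →
      ∃ y : T ⟶ X n, (∑ i ∈ t, g i ≫ Sigma.ι X i) ≫ π = y ≫ Sigma.ι X n ≫ π by
    obtain ⟨N, hN⟩ := h
    obtain ⟨y, hy⟩ := hN N le_rfl
    exact ⟨N, y, hy⟩
  refine Finset.sum_induction _ (fun f : T ⟶ ∐ X => ∃ N, ∀ n, N ≤ n →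
    ∃ y : T ⟶ X n, f ≫ π = y ≫ Sigma.ι X n ≫ π) ?_ ⟨0, fun n _ => ⟨0, by simp⟩⟩ ?_
  · rintro f f' ⟨N, hN⟩ ⟨N', hN'⟩
    refine ⟨max N N', fun n hn => ?_⟩
    obtain ⟨y, hy⟩ := hN n (le_of_max_le_left hn)
    obtain ⟨y', hy'⟩ := hN' n (le_of_max_le_right hn)
    exact ⟨y + y', by rw [Preadditive.add_comp, hy, hy', Preadditive.add_comp]⟩
  · refine fun i _ => ⟨i, fun n hn => ?_⟩
    induction n, hn using Nat.le_induction with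
    | base => exact ⟨g i, Category.assoc _ _ _⟩
    | succ n _ ih =>
      obtain ⟨y, hy⟩ := ih
      exact ⟨y ≫ s n, by rw [hy, hs, Category.assoc]⟩

section Cotelescope

variable {X : ℕ → C} [HasProduct X] (s : ∀ k, X (k + 1) ⟶ X k)

/-- The endomorphism `1 - s` of a countable product; its fibre is the homotopy limit of the
sequence `s`. -/
def cotelescope : ∏ᶜ X ⟶ ∏ᶜ X :=
  Pi.lift fun k => Pi.π X k - Pi.π X (k + 1) ≫ s k

lemma cotelescope_π (k : ℕ) :
    cotelescope s ≫ Pi.π X k = Pi.π X k - Pi.π X (k + 1) ≫ s k :=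
  Pi.lift_π _ _

lemma exists_comp_cotelescope {M T : C} {u : ∀ k, M ⟶ X k}
    (hu : ∀ k, u (k + 1) ≫ s k = u k)
    (hT : ∀ k (x : T ⟶ X (k + 1)), ∃ y : T ⟶ M, x ≫ s k = y ≫ u k) (t : T ⟶ ∏ᶜ X) :
    ∃ t' : T ⟶ ∏ᶜ X, t = t' ≫ cotelescope s := by
  choose m hm using fun k => hT k (t ≫ Pi.π X (k + 1))
  refine ⟨Pi.lift fun k => t ≫ Pi.π X k - (∑ j ∈ Finset.range k, m j) ≫ u k,
    Pi.hom_ext _ _ fun k => ?_⟩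
  rw [Category.assoc, cotelescope_π, Preadditive.comp_sub, ← Category.assoc, Pi.lift_π, Pi.lift_π,
    Preadditive.sub_comp, hm, Category.assoc, hu, Finset.sum_range_succ, Preadditive.add_comp]
  abel

lemma π_succ_comp_of_comp_cotelescope {I : C} {π : I ⟶ ∏ᶜ X} (hπ : π ≫ cotelescope s = 0) (k : ℕ) :
    π ≫ Pi.π X (k + 1) ≫ s k = π ≫ Pi.π X k := by
  have h : π ≫ cotelescope s ≫ Pi.π X k = 0 := by rw [← Category.assoc, hπ, zero_comp]
  rw [cotelescope_π, Preadditive.comp_sub, sub_eq_zero] at h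
  exact h.symm

-- The factorizations of `x ≫ π k` through `M` which the hypothesis provides stabilize at once,
-- because `M ⟶ X (k + 1)` is injective on maps from `T`.
lemma exists_comp_eq_comp_π {M T I : C} {u : ∀ k, M ⟶ X k} (hu : ∀ k, u (k + 1) ≫ s k = u k)
    (hT : ∀ k (x : T ⟶ X (k + 1)), ∃ y : T ⟶ M, x ≫ s k = y ≫ u k)
    (hinj : ∀ k (y : T ⟶ M), y ≫ u (k + 1) = 0 → y = 0)
    {π : I ⟶ ∏ᶜ X} (hπ : π ≫ cotelescope s = 0) (x : T ⟶ I) :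
    ∃ y : T ⟶ M, ∀ k, y ≫ u k = x ≫ π ≫ Pi.π X k := by
  have hπs := π_succ_comp_of_comp_cotelescope s hπ
  choose m hm using fun k => hT k (x ≫ π ≫ Pi.π X (k + 1))
  simp only [Category.assoc, hπs] at hm
  have hm_succ (k : ℕ) : m (k + 1) = m 1 := by
    induction k with
    | zero => rfl
    | succ k ih =>
      rw [← ih, ← sub_eq_zero]
      refine hinj k _ ?_
      rw [Preadditive.sub_comp, ← hm, sub_eq_zero, ← hu (k + 1), ← Category.assoc, ← hm,
        Category.assoc, Category.assoc, hπs]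
  refine ⟨m 1, fun k => ?_⟩
  rw [← hu k, ← Category.assoc, ← hm_succ k, ← hm, Category.assoc, Category.assoc, hπs]

end Cotelescope

section HomotopyColimit

variable [HasZeroObject C] [HasShift C ℤ] [∀ n : ℤ, (shiftFunctor C n).Additive]
  [Pretriangulated C]

lemma bijective_comp_of_telescope_triangle {X : ℕ → C} [HasCoproduct X]
    {s : ∀ k, X k ⟶ X (k + 1)} {P M : C} {π : ∐ X ⟶ P} {δ : P ⟶ (∐ X)⟦(1 : ℤ)⟧}
    (hP : Triangle.mk (telescope s) π δ ∈ distTriang C)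
    {u : ∀ k, X k ⟶ M} {v : P ⟶ M} (hv : ∀ k, Sigma.ι X k ≫ π ≫ v = u k) {T : C}
    (hT : IsCompactObject.{0} T) (hT' : IsCompactObject.{0} (T⟦(-1 : ℤ)⟧))
    (hu : ∀ x : T ⟶ M, ∃ y : T ⟶ X 0, y ≫ u 0 = x)
    (hs : ∀ k (y : T ⟶ X k), y ≫ u k = 0 → y ≫ s k = 0) :
    Function.Bijective fun y : T ⟶ P => y ≫ v := by
  have hπ : telescope s ≫ π = 0 := comp_distTriang_mor_zero₁₂ _ hP
  refine ⟨fun x x' hx => sub_eq_zero.1 ?_, fun x => ?_⟩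
  · have hxv : (x - x') ≫ v = 0 := by rw [Preadditive.sub_comp, sub_eq_zero]; exact hx
    obtain ⟨w, hw⟩ : ∃ w : T ⟶ ∐ X, x - x' = w ≫ π := exists_comp_mor₂_of_shift_injective hP
      (fun w hw => hT'.eq_zero_of_comp_π (comp_π_eq_zero_of_comp_telescope s hw)) (x - x')
    obtain ⟨n, y, hy⟩ := hT.exists_comp_eq_of_telescope_comp hπ w
    have hyu : y ≫ u n = 0 := by
      rw [← hv, ← Category.assoc (Sigma.ι X n), ← Category.assoc, ← hy, ← hw, hxv]
    rw [hw, hy, ι_comp_of_telescope_comp s hπ, ← Category.assoc, hs n y hyu, zero_comp]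
  · obtain ⟨y, rfl⟩ := hu x
    exact ⟨y ≫ Sigma.ι X 0 ≫ π, by simp only [Category.assoc, hv]⟩

end HomotopyColimit

end Approximation

section Approximation

open Pretriangulated

variable {C : Type*} [Category.{v} C]

lemma exists_seq_of_forall_exists {α : Type*} {p : α → Prop} {r : α → α → Prop}
    (hr : ∀ a, p a → ∃ b, p b ∧ r a b) (hp : ∃ a, p a) :
    ∃ x : ℕ → α, ∀ n, p (x n) ∧ r (x n) (x (n + 1)) := by
  choose f hf hrf using hr
  obtain ⟨a₀, ha₀⟩ := hp
  let x (n : ℕ) : { a // p a } := Nat.rec ⟨a₀, ha₀⟩ (fun _ a => ⟨f a.1 a.2, hf a.1 a.2⟩) n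
  exact ⟨fun n => (x n).1, fun n => ⟨(x n).2, hrf _ _⟩⟩

/-- The relative epimorphisms for `𝒯`: the morphisms along which every map from an object of `𝒯`
lifts. -/
def relEpi (𝒯 : ObjectProperty C) : MorphismProperty C :=
  fun P M v => ∀ ⦃T : C⦄, 𝒯 T → ∀ x : T ⟶ M, ∃ y : T ⟶ P, y ≫ v = x

/-- The relative monomorphisms for `ℰ`: the morphisms along which every map to an object of `ℰ`
extends. -/
def relMono (ℰ : ObjectProperty C) : MorphismProperty C :=
  fun M I v => ∀ ⦃E : C⦄, ℰ E → ∀ x : M ⟶ E, ∃ y : I ⟶ E, v ≫ y = x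

lemma relMono.of_comp_eq {ℰ : ObjectProperty C} {M I I' : C} {v : M ⟶ I} {v' : M ⟶ I'} {s : I' ⟶ I}
    (hv : relMono ℰ v) (hs : v' ≫ s = v) : relMono ℰ v' := fun E hE x => by
  obtain ⟨y, rfl⟩ := hv hE x
  exact ⟨s ≫ y, by rw [← Category.assoc, hs]⟩

lemma exists_family_of_essentiallySmall (𝒯 : ObjectProperty C)
    [ObjectProperty.EssentiallySmall.{w} 𝒯] :
    ∃ (J : Type w) (X : J → C), (∀ j, 𝒯 (X j)) ∧ ∀ T, 𝒯 T → ∃ j, Nonempty (T ≅ X j) := by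
  obtain ⟨Q, hQ, hQ𝒯, h𝒯Q⟩ := ObjectProperty.EssentiallySmall.exists_small_le.{w} 𝒯
  refine ⟨Shrink.{w} (Subtype Q), fun j => ((equivShrink _).symm j).1,
    fun j => hQ𝒯 _ ((equivShrink _).symm j).2, fun T hT => ?_⟩
  obtain ⟨Y, hY, ⟨e⟩⟩ := h𝒯Q T hT
  exact ⟨equivShrink _ ⟨Y, hY⟩, ⟨e ≪≫ eqToIso (by simp)⟩⟩

lemma exists_relEpi (𝒯 𝒜 : ObjectProperty C) [ObjectProperty.EssentiallySmall.{v} 𝒯]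
    [HasCoproducts.{v} C] [∀ J : Type v, 𝒜.IsClosedUnderColimitsOfShape (Discrete J)]
    (h : 𝒯 ≤ 𝒜) (M : C) : ∃ (P : C) (v : P ⟶ M), 𝒜 P ∧ relEpi 𝒯 v := by
  obtain ⟨J, X, hX, h𝒯⟩ := exists_family_of_essentiallySmall 𝒯
  let F (i : Σ j, (X j ⟶ M)) : C := X i.1
  refine ⟨∐ F, Sigma.desc fun i => i.2, 𝒜.prop_colimit _ fun i => h _ (hX _), fun T hT x => ?_⟩
  obtain ⟨j, ⟨e⟩⟩ := h𝒯 T hT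
  exact ⟨e.hom ≫ Sigma.ι F ⟨j, e.inv ≫ x⟩, by rw [Category.assoc, Sigma.ι_desc]; simp⟩

lemma exists_relMono (ℰ 𝒬 : ObjectProperty C) [ObjectProperty.EssentiallySmall.{v} ℰ]
    [HasProducts.{v} C] [∀ J : Type v, 𝒬.IsClosedUnderLimitsOfShape (Discrete J)]
    (h : ℰ ≤ 𝒬) (M : C) : ∃ (I : C) (v : M ⟶ I), 𝒬 I ∧ relMono ℰ v := by
  obtain ⟨J, X, hX, hℰ⟩ := exists_family_of_essentiallySmall ℰ
  let F (i : Σ j, (M ⟶ X j)) : C := X i.1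
  refine ⟨∏ᶜ F, Pi.lift fun i => i.2, 𝒬.prop_limit _ fun i => h _ (hX _), fun E hE x => ?_⟩
  obtain ⟨j, ⟨e⟩⟩ := hℰ E hE
  exact ⟨Pi.π F ⟨j, x ≫ e.hom⟩ ≫ e.inv, by rw [← Category.assoc, Pi.lift_π]; simp⟩

variable [Preadditive C] [HasZeroObject C] [HasShift C ℤ] [∀ n : ℤ, (shiftFunctor C n).Additive]
  [Pretriangulated C]

-- `P'` is the cone of a relative precover of the fibre of `v`.
lemma exists_comp_eq_zero_of_comp_eq_zero (𝒯 𝒜 : ObjectProperty C)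
    [ObjectProperty.EssentiallySmall.{v} 𝒯] [HasCoproducts.{v} C]
    [∀ J : Type v, 𝒜.IsClosedUnderColimitsOfShape (Discrete J)] [𝒜.IsTriangulatedClosed₃]
    (h : 𝒯 ≤ 𝒜) {P M : C} (v : P ⟶ M) (hP : 𝒜 P) :
    ∃ (P' : C) (s : P ⟶ P') (v' : P' ⟶ M), 𝒜 P' ∧ s ≫ v' = v ∧
      ∀ ⦃T : C⦄, 𝒯 T → ∀ y : T ⟶ P, y ≫ v = 0 → y ≫ s = 0 := by
  obtain ⟨F, i, δ, hF⟩ := distinguished_cocone_triangle₁ v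
  obtain ⟨G, p, hG, hp⟩ := exists_relEpi 𝒯 𝒜 h F
  obtain ⟨P', hP', s, t, hs⟩ := 𝒜.distinguished_cocone_triangle (p ≫ i) hG hP
  have hiv : i ≫ v = 0 := comp_distTriang_mor_zero₁₂ _ hF
  have hpis : (p ≫ i) ≫ s = 0 := comp_distTriang_mor_zero₁₂ _ hs
  obtain ⟨v', hv'⟩ : ∃ v' : P' ⟶ M, v = s ≫ v' :=
    Triangle.yoneda_exact₂ _ hs v (by change (p ≫ i) ≫ v = 0; rw [Category.assoc, hiv, comp_zero])
  refine ⟨P', s, v', hP', hv'.symm, fun T hT y hy => ?_⟩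
  obtain ⟨z, rfl⟩ : ∃ z : T ⟶ F, y = z ≫ i := Triangle.coyoneda_exact₂ _ hF y hy
  obtain ⟨z, rfl⟩ := hp hT z
  rw [Category.assoc z, Category.assoc, hpis, comp_zero]

lemma exists_eq_zero_comp_of_eq_zero_comp (ℰ 𝒬 : ObjectProperty C)
    [ObjectProperty.EssentiallySmall.{v} ℰ] [HasProducts.{v} C]
    [∀ J : Type v, 𝒬.IsClosedUnderLimitsOfShape (Discrete J)] [𝒬.IsTriangulatedClosed₁]
    (h : ℰ ≤ 𝒬) {M I : C} (v : M ⟶ I) (hI : 𝒬 I) :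
    ∃ (I' : C) (s : I' ⟶ I) (v' : M ⟶ I'), 𝒬 I' ∧ v' ≫ s = v ∧
      ∀ ⦃E : C⦄, ℰ E → ∀ y : I ⟶ E, v ≫ y = 0 → s ≫ y = 0 := by
  obtain ⟨F, i, δ, hF⟩ := distinguished_cocone_triangle v
  obtain ⟨G, p, hG, hp⟩ := exists_relMono ℰ 𝒬 h F
  obtain ⟨I', hI', s, t, hs⟩ := 𝒬.distinguished_cocone_triangle₁ (i ≫ p) hI hG
  have hvi : v ≫ i = 0 := comp_distTriang_mor_zero₁₂ _ hF
  have hsip : s ≫ i ≫ p = 0 := comp_distTriang_mor_zero₁₂ _ hs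
  obtain ⟨v', hv'⟩ : ∃ v' : M ⟶ I', v = v' ≫ s :=
    Triangle.coyoneda_exact₂ _ hs v (by change v ≫ i ≫ p = 0; rw [← Category.assoc, hvi, zero_comp])
  refine ⟨I', s, v', hI', hv'.symm, fun E hE y hy => ?_⟩
  obtain ⟨z, rfl⟩ : ∃ z : F ⟶ E, y = i ≫ z := Triangle.yoneda_exact₂ _ hF y hy
  obtain ⟨z, rfl⟩ := hp hE z
  rw [← Category.assoc i, ← Category.assoc, hsip, zero_comp]

end Approximation

section Approximation

open Pretriangulated

variable {C : Type*} [Category.{v} C] [Preadditive C] [HasZeroObject C] [HasShift C ℤ]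
  [∀ n : ℤ, (shiftFunctor C n).Additive] [Pretriangulated C]

theorem exists_isColocal_of_isCompactObject (𝒯 𝒜 : ObjectProperty C)
    [ObjectProperty.EssentiallySmall.{v} 𝒯] [𝒯.IsStableUnderShift ℤ] [HasCoproducts.{v} C]
    [∀ J : Type v, 𝒜.IsClosedUnderColimitsOfShape (Discrete J)] [𝒜.IsTriangulatedClosed₃]
    (h : 𝒯 ≤ 𝒜) (hc : ∀ T, 𝒯 T → IsCompactObject.{0} T) (M : C) :
    ∃ (P : C) (v : P ⟶ M), 𝒜 P ∧ 𝒯.isColocal v := by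
  have : HasCoproducts.{0} C := hasCoproducts_shrink.{0, v}
  have : 𝒜.IsClosedUnderColimitsOfShape (Discrete ℕ) :=
    .of_equivalence (Discrete.equivalence (Equiv.ulift.{v} (α := ℕ)))
  obtain ⟨X, hX⟩ := exists_seq_of_forall_exists
    (p := fun P : Over M => 𝒜 P.left ∧ relEpi 𝒯 P.hom)
    (r := fun P P' => ∃ s : P ⟶ P', ∀ ⦃T : C⦄, 𝒯 T → ∀ y : T ⟶ P.left, y ≫ P.hom = 0 →
      y ≫ s.left = 0)
    (fun P hP => by
      obtain ⟨P', s, v', hP', hs, hT⟩ := exists_comp_eq_zero_of_comp_eq_zero 𝒯 𝒜 h P.hom hP.1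
      refine ⟨Over.mk v', ⟨hP', fun T hT x => ?_⟩, Over.homMk s hs, hT⟩
      obtain ⟨y, rfl⟩ := hP.2 hT x
      exact ⟨y ≫ s, by rw [← hs, ← Category.assoc]; rfl⟩)
    (by
      obtain ⟨P, v, hP, hv⟩ := exists_relEpi 𝒯 𝒜 h M
      exact ⟨Over.mk v, hP, hv⟩)
  choose s hs using fun k => (hX k).2
  obtain ⟨P, hP, π, δ, hT⟩ := 𝒜.distinguished_cocone_triangle (telescope fun k => (s k).left)
    (𝒜.prop_colimit _ fun k => (hX k.as).1.1) (𝒜.prop_colimit _ fun k => (hX k.as).1.1)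
  have hdesc : telescope (fun k => (s k).left) ≫ Sigma.desc (fun k => (X k).hom) = 0 :=
    Sigma.hom_ext _ _ fun k => by
      rw [← Category.assoc, ι_telescope, Preadditive.sub_comp, Category.assoc, Sigma.ι_desc,
        Sigma.ι_desc, Over.w, sub_self, comp_zero]
  obtain ⟨v, hv⟩ : ∃ v : P ⟶ M, Sigma.desc (fun k => (X k).hom) = π ≫ v :=
    Triangle.yoneda_exact₂ _ hT _ hdesc
  exact ⟨P, v, hP, fun T h𝒯 => bijective_comp_of_telescope_triangle hT
    (fun k => by rw [← hv, Sigma.ι_desc]) (hc T h𝒯) (hc _ (𝒯.le_shift (-1) _ h𝒯))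
    ((hX 0).1.2 h𝒯) fun k => hs k h𝒯⟩

lemma bijective_comp_of_cotelescope_triangle {X : ℕ → C} [HasProduct X]
    {s : ∀ k, X (k + 1) ⟶ X k} {I M : C} {π : I ⟶ ∏ᶜ X} {δ : ∏ᶜ X ⟶ I⟦(1 : ℤ)⟧}
    (hI : Triangle.mk π (cotelescope s) δ ∈ distTriang C)
    {u : ∀ k, M ⟶ X k} {v : M ⟶ I} (hv : ∀ k, v ≫ π ≫ Pi.π X k = u k)
    (hu : ∀ k, u (k + 1) ≫ s k = u k) {T : C}
    (hT : ∀ k (x : T ⟶ X (k + 1)), ∃ y : T ⟶ M, x ≫ s k = y ≫ u k)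
    (hT' : ∀ k (x : T⟦(1 : ℤ)⟧ ⟶ X (k + 1)), ∃ y : T⟦(1 : ℤ)⟧ ⟶ M, x ≫ s k = y ≫ u k)
    (hinj : ∀ k (y : T ⟶ M), y ≫ u (k + 1) = 0 → y = 0) :
    Function.Bijective fun y : T ⟶ M => y ≫ v := by
  have hπ : π ≫ cotelescope s = 0 := comp_distTriang_mor_zero₁₂ _ hI
  have hπ_mono {w : T ⟶ I} (hw : w ≫ π = 0) : w = 0 :=
    eq_zero_of_comp_mor₁_of_shift_surjective hI (exists_comp_cotelescope s hu hT') hw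
  refine ⟨fun y y' hy => sub_eq_zero.1 (hinj 0 _ ?_), fun x => ?_⟩
  · have hyv : (y - y') ≫ v = 0 := by rw [Preadditive.sub_comp, sub_eq_zero]; exact hy
    rw [← hv, ← Category.assoc, hyv, zero_comp]
  · obtain ⟨y, hy⟩ := exists_comp_eq_comp_π s hu hT hinj hπ x
    refine ⟨y, sub_eq_zero.1 (hπ_mono (Pi.hom_ext _ _ fun k => ?_))⟩
    rw [zero_comp, Preadditive.sub_comp, Preadditive.sub_comp, sub_eq_zero]
    simp only [Category.assoc, hv, hy]

/-- The ghosts for `ℰ`: the morphisms which become zero after composition with any map to an object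
of `ℰ`. -/
def ghost (ℰ : ObjectProperty C) : MorphismProperty C :=
  fun _ Y f => ∀ ⦃E : C⦄, ℰ E → ∀ y : Y ⟶ E, f ≫ y = 0

/-- The composites of `n` ghosts. -/
def ghostPow (ℰ : ObjectProperty C) : ℕ → MorphismProperty C
  | 0 => ⊤
  | n + 1 => fun X Z f => ∃ (Y : C) (g : X ⟶ Y) (h : Y ⟶ Z),
      ghost ℰ g ∧ ghostPow ℰ n h ∧ g ≫ h = f

lemma exists_cone_map {M I I' F F' : C} {v : M ⟶ I} {v' : M ⟶ I'} {s : I' ⟶ I} (hs : v' ≫ s = v)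
    {f : I ⟶ F} {d : F ⟶ M⟦(1 : ℤ)⟧} (hT : Triangle.mk v f d ∈ distTriang C)
    {f' : I' ⟶ F'} {d' : F' ⟶ M⟦(1 : ℤ)⟧} (hT' : Triangle.mk v' f' d' ∈ distTriang C) :
    ∃ c : F' ⟶ F, f' ≫ c = s ≫ f ∧ c ≫ d = d' := by
  obtain ⟨c, hc, hc'⟩ := complete_distinguished_triangle_morphism _ _ hT' hT (𝟙 M) s
    (hs.trans (Category.id_comp v).symm)
  refine ⟨c, hc, ?_⟩
  have hid : (shiftFunctor C (1 : ℤ)).map (𝟙 M) = 𝟙 _ := CategoryTheory.Functor.map_id _ _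
  exact (hc'.symm.trans (congrArg (d' ≫ ·) hid)).trans (Category.comp_id d')

lemma ghost_of_cone_map {ℰ : ObjectProperty C} [ℰ.IsStableUnderShift ℤ] {M I I' F F' : C}
    {v : M ⟶ I} {v' : M ⟶ I'} {s : I' ⟶ I} (hv' : relMono ℰ v')
    (hs : ∀ ⦃E : C⦄, ℰ E → ∀ y : I ⟶ E, v ≫ y = 0 → s ≫ y = 0)
    {f : I ⟶ F} {d : F ⟶ M⟦(1 : ℤ)⟧} (hT : Triangle.mk v f d ∈ distTriang C)
    {f' : I' ⟶ F'} {d' : F' ⟶ M⟦(1 : ℤ)⟧} (hT' : Triangle.mk v' f' d' ∈ distTriang C)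
    {c : F' ⟶ F} (hc : f' ≫ c = s ≫ f) : ghost ℰ c := by
  intro E hE y
  have hvf : v ≫ f = 0 := comp_distTriang_mor_zero₁₂ _ hT
  refine eq_zero_of_mor₂_comp_of_shift_surjective hT' (fun x => ?_) ?_
  · obtain ⟨z, hz⟩ := hv' (ℰ.le_shift (-1) _ hE) x
    exact ⟨z, hz.symm⟩
  · change f' ≫ c ≫ y = 0
    rw [← Category.assoc, hc, Category.assoc]
    exact hs hE _ (by rw [← Category.assoc, hvf, zero_comp])

lemma exists_ghostPow_cone_map (ℰ 𝒬 : ObjectProperty C) [ObjectProperty.EssentiallySmall.{v} ℰ]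
    [ℰ.IsStableUnderShift ℤ] [HasProducts.{v} C]
    [∀ J : Type v, 𝒬.IsClosedUnderLimitsOfShape (Discrete J)] [𝒬.IsTriangulatedClosed₁]
    (h : ℰ ≤ 𝒬) {M I F : C} {v : M ⟶ I} (hI : 𝒬 I) (hv : relMono ℰ v) {f : I ⟶ F}
    {d : F ⟶ M⟦(1 : ℤ)⟧} (hT : Triangle.mk v f d ∈ distTriang C) (n : ℕ) :
    ∃ (I' F' : C) (v' : M ⟶ I') (f' : I' ⟶ F') (d' : F' ⟶ M⟦(1 : ℤ)⟧) (s : I' ⟶ I) (c : F' ⟶ F),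
      𝒬 I' ∧ Triangle.mk v' f' d' ∈ distTriang C ∧ v' ≫ s = v ∧ f' ≫ c = s ≫ f ∧ c ≫ d = d' ∧
        ghostPow ℰ n c := by
  induction n with
  | zero => exact ⟨I, F, v, f, d, 𝟙 I, 𝟙 F, hI, hT, by simp, by simp, by simp, trivial⟩
  | succ n ih =>
    obtain ⟨I', F', v', f', d', s, c, hI', hT', hs, hc, hd, hcn⟩ := ih
    obtain ⟨I'', s', v'', hI'', hs', hkill⟩ := exists_eq_zero_comp_of_eq_zero_comp ℰ 𝒬 h v' hI'
    obtain ⟨F'', f'', d'', hT''⟩ := distinguished_cocone_triangle v''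
    obtain ⟨c', hc', hd'⟩ := exists_cone_map hs' hT' hT''
    have hv'' := (hv.of_comp_eq hs).of_comp_eq hs'
    refine ⟨I'', F'', v'', f'', d'', s' ≫ s, c' ≫ c, hI'', hT'', by rw [← Category.assoc, hs', hs],
      ?_, by rw [Category.assoc, hd, hd'], F', c', c,
      ghost_of_cone_map hv'' hkill hT' hT'' hc', hcn, rfl⟩
    rw [← Category.assoc, hc', Category.assoc, hc, Category.assoc]

lemma exists_comp_eq_and_eq_zero_of_cone_map_eq_zero {M I I' F F' T : C} {v : M ⟶ I}
    {v' : M ⟶ I'} {s : I' ⟶ I} {f : I ⟶ F} {d : F ⟶ M⟦(1 : ℤ)⟧}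
    (hT : Triangle.mk v f d ∈ distTriang C) {f' : I' ⟶ F'} {d' : F' ⟶ M⟦(1 : ℤ)⟧}
    (hT' : Triangle.mk v' f' d' ∈ distTriang C) {c : F' ⟶ F} (hc : f' ≫ c = s ≫ f)
    (hd : c ≫ d = d') (h : ∀ x : T ⟶ F', x ≫ c = 0) (h' : ∀ x : T⟦(1 : ℤ)⟧ ⟶ F', x ≫ c = 0) :
    (∀ x : T ⟶ I', ∃ y : T ⟶ M, x ≫ s = y ≫ v) ∧ ∀ y : T ⟶ M, y ≫ v' = 0 → y = 0 := by
  refine ⟨fun x => Triangle.coyoneda_exact₂ _ hT (x ≫ s) ?_, fun y hy =>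
    (shiftFunctor C (1 : ℤ)).map_injective ?_⟩
  · change (x ≫ s) ≫ f = 0
    rw [Category.assoc, ← hc, ← Category.assoc, h]
  · obtain ⟨t, ht⟩ : ∃ t : T⟦(1 : ℤ)⟧ ⟶ F', y⟦(1 : ℤ)⟧' = t ≫ d' :=
      Triangle.coyoneda_exact₁ _ hT' _ (by
        change y⟦(1 : ℤ)⟧' ≫ v'⟦(1 : ℤ)⟧' = 0
        rw [← Functor.map_comp, hy, Functor.map_zero])
    rw [ht, ← hd, ← Category.assoc, h', zero_comp, Functor.map_zero]

theorem exists_isColocal_of_ghostPow (𝒯 ℰ 𝒬 : ObjectProperty C) [𝒯.IsStableUnderShift ℤ]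
    [ObjectProperty.EssentiallySmall.{v} ℰ] [ℰ.IsStableUnderShift ℤ] [HasProducts.{v} C]
    [∀ J : Type v, 𝒬.IsClosedUnderLimitsOfShape (Discrete J)] [𝒬.IsTriangulatedClosed₁]
    (h : ℰ ≤ 𝒬) {n : ℕ}
    (hn : ∀ ⦃X Y : C⦄ (c : X ⟶ Y), ghostPow ℰ n c → ∀ ⦃T : C⦄, 𝒯 T → ∀ x : T ⟶ X, x ≫ c = 0)
    (M : C) : ∃ (I : C) (v : M ⟶ I), 𝒬 I ∧ 𝒯.isColocal v := by
  have : HasProducts.{0} C := hasProducts_shrink.{0, v}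
  have : 𝒬.IsClosedUnderLimitsOfShape (Discrete ℕ) :=
    .of_equivalence (Discrete.equivalence (Equiv.ulift.{v} (α := ℕ)))
  obtain ⟨X, hX⟩ := exists_seq_of_forall_exists
    (p := fun I : Under M => 𝒬 I.right ∧ relMono ℰ I.hom)
    (r := fun I I' => ∃ s : I' ⟶ I, ∀ ⦃T : C⦄, 𝒯 T →
      (∀ x : T ⟶ I'.right, ∃ y : T ⟶ M, x ≫ s.right = y ≫ I.hom) ∧
        ∀ y : T ⟶ M, y ≫ I'.hom = 0 → y = 0)
    (fun I hI => by
      obtain ⟨F, f, d, hT⟩ := distinguished_cocone_triangle I.hom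
      obtain ⟨I', F', v', f', d', s, c, hI', hT', hs, hc, hd, hcn⟩ :=
        exists_ghostPow_cone_map ℰ 𝒬 h hI.1 hI.2 hT n
      exact ⟨Under.mk v', ⟨hI', hI.2.of_comp_eq hs⟩, Under.homMk s hs, fun T h𝒯 =>
        exists_comp_eq_and_eq_zero_of_cone_map_eq_zero hT hT' hc hd (hn c hcn h𝒯)
          (hn c hcn (𝒯.le_shift 1 _ h𝒯))⟩)
    (by
      obtain ⟨I, v, hI, hv⟩ := exists_relMono ℰ 𝒬 h M
      exact ⟨Under.mk v, hI, hv⟩)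
  choose s hs using fun k => (hX k).2
  obtain ⟨I, hI, π, δ, hT⟩ := 𝒬.distinguished_cocone_triangle₁
    (cotelescope (X := fun k => (X k).right) fun k => (s k).right)
    (𝒬.prop_limit _ fun k => (hX k.as).1.1) (𝒬.prop_limit _ fun k => (hX k.as).1.1)
  have hu (k : ℕ) : (X (k + 1)).hom ≫ (s k).right = (X k).hom := Under.w (s k)
  have hlift : Pi.lift (fun k => (X k).hom) ≫ cotelescope (X := fun k => (X k).right)
      (fun k => (s k).right) = 0 :=
    Pi.hom_ext _ _ fun k => by
      rw [Category.assoc, cotelescope_π, Preadditive.comp_sub, ← Category.assoc, Pi.lift_π,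
        Pi.lift_π, hu, sub_self, zero_comp]
  obtain ⟨v, hv⟩ : ∃ v : M ⟶ I, Pi.lift (fun k => (X k).hom) = v ≫ π :=
    Triangle.coyoneda_exact₂ _ hT _ hlift
  exact ⟨I, v, hI, fun T h𝒯 => bijective_comp_of_cotelescope_triangle hT
    (fun k => by rw [← Category.assoc, ← hv, Pi.lift_π]) hu
    (fun k => (hs k h𝒯).1) (fun k => (hs k (𝒯.le_shift 1 _ h𝒯)).1) (fun k => (hs k h𝒯).2)⟩

end Approximation

/-! ### Orthogonals and the homotopy category of complexes -/

section Orthogonal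

variable {C : Type w} [Category.{v} C] [HasZeroMorphisms C]

instance (P : ObjectProperty C) (J : Type*) [Category J] :
    P.leftOrthogonal.IsClosedUnderColimitsOfShape J where
  colimitsOfShape_le _ := fun ⟨p⟩ _ f hY =>
    p.isColimit.hom_ext fun j => (p.prop_diag_obj j (p.ι.app j ≫ f) hY).trans comp_zero.symm

instance (P : ObjectProperty C) (J : Type*) [Category J] :
    P.rightOrthogonal.IsClosedUnderLimitsOfShape J where
  limitsOfShape_le _ := fun ⟨p⟩ _ f hY =>
    p.isLimit.hom_ext fun j => (p.prop_diag_obj j (f ≫ p.π.app j) hY).trans zero_comp.symm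

end Orthogonal

section HomotopyCategory

open HomologicalComplex CochainComplex.HomComplex Pretriangulated

variable {V : Type w} [Category.{v} V] [Preadditive V]

variable (V) in
/-- The quotient functor from complexes to the homotopy category. -/
abbrev toK : CochainComplex V ℤ ⥤ HomotopyCategory V (ComplexShape.up ℤ) :=
  HomotopyCategory.quotient V (ComplexShape.up ℤ)

lemma quotient_map_eq_zero_iff_exists_δ {A B : CochainComplex V ℤ} (f : A ⟶ B) :
    (HomotopyCategory.quotient _ _).map f = 0 ↔
      ∃ z : Cochain A B (-1), δ (-1) 0 z = Cochain.ofHom f := by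
  rw [HomotopyCategory.quotient_map_eq_zero_iff]
  constructor
  · rintro ⟨h⟩
    obtain ⟨z, hz⟩ := Cochain.equivHomotopy _ _ h
    exact ⟨z, by simpa using hz.symm⟩
  · rintro ⟨z, hz⟩
    exact ⟨(Cochain.equivHomotopy _ _).symm ⟨z, by simpa using hz.symm⟩⟩

section

variable {ι : Type*} {Z : ι → CochainComplex V ℤ} {S Y : CochainComplex V ℤ}

lemma cochain_ext_of_isColimit {c : ∀ i, Z i ⟶ S}
    (hc : ∀ p, IsColimit (Cofan.mk (S.X p) fun i => (c i).f p)) {n : ℤ} {z w : Cochain S Y n}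
    (h : ∀ i, (Cochain.ofHom (c i)).comp z (zero_add n) =
      (Cochain.ofHom (c i)).comp w (zero_add n)) : z = w := by
  refine Cochain.ext _ _ fun p q hpq => Cofan.IsColimit.hom_ext (hc p) _ _ fun i => ?_
  simpa using congrArg (fun t => Cochain.v t p q hpq) (h i)

lemma cochain_ext_of_isLimit {c : ∀ i, S ⟶ Z i}
    (hc : ∀ p, IsLimit (Fan.mk (S.X p) fun i => (c i).f p)) {n : ℤ} {z w : Cochain Y S n}
    (h : ∀ i, z.comp (Cochain.ofHom (c i)) (add_zero n) =
      w.comp (Cochain.ofHom (c i)) (add_zero n)) : z = w := by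
  refine Cochain.ext _ _ fun p q hpq => Fan.IsLimit.hom_ext (hc q) _ _ fun i => ?_
  simpa using congrArg (fun t => Cochain.v t p q hpq) (h i)

lemma quotient_map_eq_zero_of_isColimit {c : ∀ i, Z i ⟶ S}
    (hc : ∀ p, IsColimit (Cofan.mk (S.X p) fun i => (c i).f p)) {f : S ⟶ Y}
    (hf : ∀ i, (toK V).map (c i ≫ f) = 0) : (toK V).map f = 0 := by
  simp only [quotient_map_eq_zero_iff_exists_δ] at hf
  choose z hz using hf
  let w : Cochain S Y (-1) := Cochain.mk fun p q hpq =>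
    Cofan.IsColimit.desc (hc p) fun i => (z i).v p q hpq
  have hw (i : ι) : (Cochain.ofHom (c i)).comp w (zero_add _) = z i := by
    refine Cochain.ext _ _ fun p q hpq => ?_
    rw [Cochain.zero_cochain_comp_v, Cochain.ofHom_v]
    exact Cofan.IsColimit.fac (hc p) _ i
  refine (quotient_map_eq_zero_iff_exists_δ f).2 ⟨w, cochain_ext_of_isColimit hc fun i => ?_⟩
  rw [← δ_ofHom_comp, hw, hz, Cochain.ofHom_comp]

lemma quotient_map_eq_zero_of_isLimit {c : ∀ i, S ⟶ Z i}
    (hc : ∀ p, IsLimit (Fan.mk (S.X p) fun i => (c i).f p)) {f : Y ⟶ S}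
    (hf : ∀ i, (toK V).map (f ≫ c i) = 0) : (toK V).map f = 0 := by
  simp only [quotient_map_eq_zero_iff_exists_δ] at hf
  choose z hz using hf
  let w : Cochain Y S (-1) := Cochain.mk fun p q hpq =>
    Fan.IsLimit.lift (hc q) fun i => (z i).v p q hpq
  have hw (i : ι) : w.comp (Cochain.ofHom (c i)) (add_zero _) = z i := by
    refine Cochain.ext _ _ fun p q hpq => ?_
    rw [Cochain.comp_zero_cochain_v, Cochain.ofHom_v]
    exact Fan.IsLimit.fac (hc q) _ i
  refine (quotient_map_eq_zero_iff_exists_δ f).2 ⟨w, cochain_ext_of_isLimit hc fun i => ?_⟩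
  rw [← δ_comp_ofHom, hw, hz, Cochain.ofHom_comp]

end

section

variable {ι : Type*}

def sigmaXIsColimit [HasCoproductsOfShape ι V] (Z : ι → CochainComplex V ℤ) (p : ℤ) :
    IsColimit (Cofan.mk ((∐ Z).X p) (fun i => (Sigma.ι Z i).f p)) :=
  isColimitCofanMkObjOfIsColimit (eval V (ComplexShape.up ℤ) p) Z _ (coproductIsCoproduct Z)

def piXIsLimit [HasProductsOfShape ι V] (Z : ι → CochainComplex V ℤ) (p : ℤ) :
    IsLimit (Fan.mk ((∏ᶜ Z).X p) (fun i => (Pi.π Z i).f p)) :=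
  isLimitFanMkObjOfIsLimit (eval V (ComplexShape.up ℤ) p) Z _ (productIsProduct Z)

def quotientSigmaIsColimit [HasCoproductsOfShape ι V] (Z : ι → CochainComplex V ℤ) :
    IsColimit (Cofan.mk ((toK V).obj (∐ Z)) fun i => (toK V).map (Sigma.ι Z i)) := by
  have hext {Y : HomotopyCategory V (ComplexShape.up ℤ)} {f : (toK V).obj (∐ Z) ⟶ Y}
      (hf : ∀ i, (toK V).map (Sigma.ι Z i) ≫ f = 0) : f = 0 := by
    obtain ⟨Y, rfl⟩ := HomotopyCategory.quotient_obj_surjective Y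
    obtain ⟨f, rfl⟩ := (toK V).map_surjective f
    exact quotient_map_eq_zero_of_isColimit (sigmaXIsColimit Z) fun i =>
      ((toK V).map_comp _ _).trans (hf i)
  have hdesc {Y : HomotopyCategory V (ComplexShape.up ℤ)} (f : ∀ i, (toK V).obj (Z i) ⟶ Y) :
      ∃ g : (toK V).obj (∐ Z) ⟶ Y, ∀ i, (toK V).map (Sigma.ι Z i) ≫ g = f i := by
    obtain ⟨Y, rfl⟩ := HomotopyCategory.quotient_obj_surjective Y
    choose f' hf' using fun i => (toK V).map_surjective (f i)
    exact ⟨(toK V).map (Sigma.desc f'), fun i => by rw [← Functor.map_comp, Sigma.ι_desc, hf']⟩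
  exact Cofan.IsColimit.mk _ (fun s => (hdesc s.inj).choose) (fun s => (hdesc s.inj).choose_spec)
    fun s m hm => sub_eq_zero.1 (hext fun i => by
      rw [Preadditive.comp_sub, (hdesc s.inj).choose_spec, sub_eq_zero]
      exact hm i)

def quotientPiIsLimit [HasProductsOfShape ι V] (Z : ι → CochainComplex V ℤ) :
    IsLimit (Fan.mk ((toK V).obj (∏ᶜ Z)) fun i => (toK V).map (Pi.π Z i)) := by
  have hext {Y : HomotopyCategory V (ComplexShape.up ℤ)} {f : Y ⟶ (toK V).obj (∏ᶜ Z)}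
      (hf : ∀ i, f ≫ (toK V).map (Pi.π Z i) = 0) : f = 0 := by
    obtain ⟨Y, rfl⟩ := HomotopyCategory.quotient_obj_surjective Y
    obtain ⟨f, rfl⟩ := (toK V).map_surjective f
    exact quotient_map_eq_zero_of_isLimit (piXIsLimit Z) fun i =>
      ((toK V).map_comp _ _).trans (hf i)
  have hlift {Y : HomotopyCategory V (ComplexShape.up ℤ)} (f : ∀ i, Y ⟶ (toK V).obj (Z i)) :
      ∃ g : Y ⟶ (toK V).obj (∏ᶜ Z), ∀ i, g ≫ (toK V).map (Pi.π Z i) = f i := by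
    obtain ⟨Y, rfl⟩ := HomotopyCategory.quotient_obj_surjective Y
    choose f' hf' using fun i => (toK V).map_surjective (f i)
    exact ⟨(toK V).map (Pi.lift f'), fun i => by rw [← Functor.map_comp, Pi.lift_π, hf']⟩
  exact Fan.IsLimit.mk _ (fun s => (hlift s.proj).choose) (fun s => (hlift s.proj).choose_spec)
    fun s m hm => sub_eq_zero.1 (hext fun i => by
      rw [Preadditive.sub_comp, (hlift s.proj).choose_spec, sub_eq_zero]
      exact hm i)

instance [HasCoproductsOfShape ι V] :
    PreservesColimitsOfShape (Discrete ι) (HomotopyCategory.quotient V (ComplexShape.up ℤ)) :=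
  have (Z : ι → CochainComplex V ℤ) := preservesColimit_of_preserves_colimit_cocone
    (coproductIsCoproduct Z)
    ((isColimitMapCoconeCofanMkEquiv (toK V) _ _).symm (quotientSigmaIsColimit Z))
  preservesColimitsOfShape_of_discrete _

instance [HasProductsOfShape ι V] :
    PreservesLimitsOfShape (Discrete ι) (HomotopyCategory.quotient V (ComplexShape.up ℤ)) :=
  have (Z : ι → CochainComplex V ℤ) := preservesLimit_of_preserves_limit_cone
    (productIsProduct Z) ((isLimitMapConeFanMkEquiv (toK V) _ _).symm (quotientPiIsLimit Z))
  preservesLimitsOfShape_of_discrete _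

lemma exists_iso_discrete_quotient
    (F : Discrete ι ⥤ HomotopyCategory V (ComplexShape.up ℤ)) :
    ∃ Z : ι → CochainComplex V ℤ, Nonempty (F ≅ Discrete.functor Z ⋙ (toK V)) := by
  choose Z hZ using fun i => HomotopyCategory.quotient_obj_surjective (F.obj ⟨i⟩)
  exact ⟨Z, ⟨Discrete.natIso fun i => eqToIso (hZ i.as).symm⟩⟩

instance [HasCoproductsOfShape ι V] :
    HasCoproductsOfShape ι (HomotopyCategory V (ComplexShape.up ℤ)) where
  has_colimit F := by
    obtain ⟨Z, ⟨e⟩⟩ := exists_iso_discrete_quotient F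
    exact hasColimit_of_iso e

instance [HasProductsOfShape ι V] :
    HasProductsOfShape ι (HomotopyCategory V (ComplexShape.up ℤ)) where
  has_limit F := by
    obtain ⟨Z, ⟨e⟩⟩ := exists_iso_discrete_quotient F
    exact hasLimit_of_iso e.symm

end

/-- The objects of the homotopy category which are represented by a complex all of whose terms
satisfy `A`. -/
def termwise (A : ObjectProperty V) :
    ObjectProperty (HomotopyCategory V (ComplexShape.up ℤ)) := fun X =>
  ∃ P : CochainComplex V ℤ, Nonempty (X ≅ (toK V).obj P) ∧ ∀ i, A (P.X i)

section

variable (A : ObjectProperty V)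

instance : (termwise A).IsClosedUnderIsomorphisms where
  of_iso e := fun ⟨P, ⟨f⟩, h⟩ => ⟨P, ⟨e.symm ≪≫ f⟩, h⟩

instance : (termwise A).IsStableUnderShift ℤ where
  isStableUnderShiftBy n :=
    { le_shift := fun _ ⟨P, ⟨e⟩, h⟩ => ⟨P⟦n⟧, ⟨(shiftFunctor _ n).mapIso e ≪≫
        ((HomotopyCategory.quotient V _).commShiftIso n).symm.app P⟩, fun i => h (i + n)⟩ }

instance {ι : Type*} [HasCoproductsOfShape ι V] [A.IsClosedUnderColimitsOfShape (Discrete ι)] :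
    (termwise A).IsClosedUnderColimitsOfShape (Discrete ι) where
  colimitsOfShape_le _ := fun ⟨p⟩ => by
    choose P e hP using p.prop_diag_obj
    let Z : ι → CochainComplex V ℤ := fun i => P ⟨i⟩
    exact ⟨∐ Z, ⟨p.isColimit.coconePointsIsoOfNatIso (quotientSigmaIsColimit Z)
      (Discrete.natIso fun i => (e i).some)⟩,
      fun n => A.prop_of_isColimit (sigmaXIsColimit Z n) fun i => hP i n⟩

instance {ι : Type*} [HasProductsOfShape ι V] [A.IsClosedUnderLimitsOfShape (Discrete ι)] :
    (termwise A).IsClosedUnderLimitsOfShape (Discrete ι) where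
  limitsOfShape_le _ := fun ⟨p⟩ => by
    choose P e hP using p.prop_diag_obj
    let Z : ι → CochainComplex V ℤ := fun i => P ⟨i⟩
    exact ⟨∏ᶜ Z, ⟨p.isLimit.conePointsIsoOfNatIso (quotientPiIsLimit Z)
      (Discrete.natIso fun i => (e i).some)⟩,
      fun n => A.prop_of_isLimit (piXIsLimit Z n) fun i => hP i n⟩

lemma isClosedUnderBinaryProducts_of_binaryCoproducts [HasBinaryBiproducts V]
    [A.IsClosedUnderIsomorphisms] [A.IsClosedUnderBinaryCoproducts] :
    A.IsClosedUnderBinaryProducts where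
  limitsOfShape_le _ := fun ⟨p⟩ =>
    A.prop_of_iso (p.isLimit.conePointsIsoOfNatIso (BinaryBiproduct.isLimit _ _)
        (diagramIsoPair p.diag)).symm
      (A.prop_of_isColimit_binaryCofan (BinaryBiproduct.isColimit _ _)
        (p.prop_diag_obj ⟨.left⟩) (p.prop_diag_obj ⟨.right⟩))

variable [HasZeroObject V]

lemma termwise_single [A.IsClosedUnderIsomorphisms] [A.ContainsZero] {P : V} (h : A P) (m : ℤ) :
    termwise A ((toK V).obj ((CochainComplex.singleFunctor V m).obj P)) := by
  refine ⟨_, ⟨Iso.refl _⟩, fun i => ?_⟩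
  by_cases hi : i = m
  · subst hi
    exact A.prop_of_iso (singleObjXSelf (ComplexShape.up ℤ) i P).symm h
  · exact A.prop_of_isZero (isZero_single_obj_X (ComplexShape.up ℤ) m P i hi)

variable [HasBinaryBiproducts V]

lemma exists_obj₃_iso_mappingCone {T : Triangle (HomotopyCategory V (ComplexShape.up ℤ))}
    (hT : T ∈ distTriang _) {K L : CochainComplex V ℤ}
    (a : T.obj₁ ≅ (toK V).obj K) (b : T.obj₂ ≅ (toK V).obj L) :
    ∃ f : K ⟶ L, Nonempty (T.obj₃ ≅ (toK V).obj (CochainComplex.mappingCone f)) := by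
  obtain ⟨f, hf⟩ := (toK V).map_surjective (a.inv ≫ T.mor₁ ≫ b.hom)
  refine ⟨f, ⟨Triangle.π₃.mapIso (isoTriangleOfIso₁₂ T _ hT
    (HomotopyCategory.mappingCone_triangleh_distinguished f) a b ?_)⟩⟩
  change T.mor₁ ≫ b.hom = a.hom ≫ (toK V).map f
  rw [hf, a.hom_inv_id_assoc]

instance [A.IsClosedUnderIsomorphisms] [A.IsClosedUnderBinaryProducts] :
    (termwise A).IsTriangulatedClosed₃ :=
  .mk' fun T hT ⟨K, ⟨a⟩, hK⟩ ⟨L, ⟨b⟩, hL⟩ => by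
    obtain ⟨f, ⟨e⟩⟩ := exists_obj₃_iso_mappingCone hT a b
    exact ⟨_, ⟨e⟩, fun i => A.prop_of_iso (homotopyCofiber.XIsoBiprod f i (i + 1) rfl).symm
      (A.prop_of_isLimit_binaryFan (BinaryBiproduct.isLimit _ _) (hK (i + 1)) (hL i))⟩

end

end HomotopyCategory

section Triangulated

open Pretriangulated

variable {C : Type w} [Category.{v} C] [HasZeroObject C] [HasShift C ℤ] [Preadditive C]
  [∀ n : ℤ, (shiftFunctor C n).Additive] [Pretriangulated C]

lemma isTriangulatedClosed₁_of_isStableUnderShift (P : ObjectProperty C)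
    [P.IsClosedUnderIsomorphisms] [P.IsStableUnderShift ℤ] [P.IsTriangulatedClosed₃] :
    P.IsTriangulatedClosed₁ :=
  .mk' fun T hT h₂ h₃ => P.prop_of_iso ((shiftEquiv C (1 : ℤ)).unitIso.symm.app T.obj₁)
    (P.le_shift (-1) _ (P.ext_of_isTriangulatedClosed₃ _ (rot_of_distTriang _ hT) h₂ h₃))

lemma isTriangulatedClosed₃_inf (P Q : ObjectProperty C) [P.IsClosedUnderIsomorphisms]
    [Q.IsClosedUnderIsomorphisms] [P.IsTriangulatedClosed₃] [Q.IsTriangulatedClosed₃] :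
    (P ⊓ Q).IsTriangulatedClosed₃ :=
  .mk' fun T hT h₁ h₂ => ⟨P.ext_of_isTriangulatedClosed₃ T hT h₁.1 h₂.1,
    Q.ext_of_isTriangulatedClosed₃ T hT h₁.2 h₂.2⟩

end Triangulated

/-! ### The tensor product and the internal Hom of complexes -/

section

variable {V : Type u} [Category.{v} V] [Preadditive V] [MonoidalCategory V] [MonoidalPreadditive V]

lemma units_smul_whiskerRight {A B : V} (f : A ⟶ B) (C : V) (r : ℤˣ) :
    (r • f) ▷ C = r • (f ▷ C) := by
  obtain rfl | rfl := Int.units_eq_one_or r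
  · rw [one_smul, one_smul]
  · rw [Units.neg_smul, Units.neg_smul, one_smul, one_smul]
    exact (tensorRight C).map_neg (f := f)

lemma whiskerLeft_units_smul (C : V) {A B : V} (f : A ⟶ B) (r : ℤˣ) :
    C ◁ (r • f) = r • (C ◁ f) := by
  obtain rfl | rfl := Int.units_eq_one_or r
  · rw [one_smul, one_smul]
  · rw [Units.neg_smul, Units.neg_smul, one_smul, one_smul]
    exact (tensorLeft C).map_neg (f := f)

end

section

variable {R : Type u} [CommRing R]

open HomologicalComplex

/-- The inclusion of the summand `A^i ⊗ B^j` in degree `n` of the tensor product of complexes. -/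
def tensorι (A B : Cpx R) (i j n : ℤ) (h : i + j = n) : A.X i ⊗ B.X j ⟶ (A ⊗ B).X n :=
  ιTensorObj A B i j n h

/-- The morphism out of a degree of the tensor product of complexes which is given on each
summand. -/
def tensorDesc {A B : Cpx R} {n : ℤ} {Y : ModuleCat.{u} R}
    (f : ∀ i j : ℤ, i + j = n → (A.X i ⊗ B.X j ⟶ Y)) : (A ⊗ B).X n ⟶ Y :=
  mapBifunctorDesc (K₁ := A) (K₂ := B) (F := curriedTensor (ModuleCat.{u} R))
    (c := ComplexShape.up ℤ) f

@[simp]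
lemma tensorι_desc {A B : Cpx R} {n : ℤ} {Y : ModuleCat.{u} R}
    (f : ∀ i j : ℤ, i + j = n → (A.X i ⊗ B.X j ⟶ Y)) (i j : ℤ) (h : i + j = n) :
    tensorι A B i j n h ≫ tensorDesc f = f i j h :=
  ι_mapBifunctorDesc (K₁ := A) (K₂ := B) (F := curriedTensor (ModuleCat.{u} R))
    (c := ComplexShape.up ℤ) f i j h

lemma tensor_hom_ext {A B : Cpx R} {n : ℤ} {Y : ModuleCat.{u} R} {f g : (A ⊗ B).X n ⟶ Y}
    (h : ∀ (i j : ℤ) (hij : i + j = n), tensorι A B i j n hij ≫ f = tensorι A B i j n hij ≫ g) :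
    f = g :=
  mapBifunctor.hom_ext h

lemma tensorι_d (A B : Cpx R) (i j n m : ℤ) (h : i + j = n) (hnm : n + 1 = m) :
    tensorι A B i j n h ≫ (A ⊗ B).d n m =
      A.d i (i + 1) ▷ B.X j ≫ tensorι A B (i + 1) j m (by lia) +
      i.negOnePow • (A.X i ◁ B.d j (j + 1) ≫ tensorι A B i (j + 1) m (by lia)) :=
  ιTensorObj_d A B i j n m h hnm

lemma tensorι_whiskerLeft (A : Cpx R) {B B' : Cpx R} (g : B ⟶ B') (i j n : ℤ) (h : i + j = n) :
    tensorι A B i j n h ≫ (A ◁ g).f n = A.X i ◁ g.f j ≫ tensorι A B' i j n h := by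
  refine (ι_mapBifunctorMap (𝟙 A) g (curriedTensor (ModuleCat.{u} R)) _ i j n h).trans ?_
  simp [tensorι]

lemma tensorι_whiskerRight {A A' : Cpx R} (f : A ⟶ A') (B : Cpx R) (i j n : ℤ) (h : i + j = n) :
    tensorι A B i j n h ≫ (f ▷ B).f n = f.f i ▷ B.X j ≫ tensorι A' B i j n h := by
  refine (ι_mapBifunctorMap f (𝟙 B) (curriedTensor (ModuleCat.{u} R)) _ i j n h).trans ?_
  simp [tensorι]

lemma tensorι_koszulBraiding (A B : Cpx R) (i j n : ℤ) (h : i + j = n) :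
    tensorι A B i j n h ≫ (koszulBraiding A B).f n =
      (i * j).negOnePow • ((β_ (A.X i) (B.X j)).hom ≫
        tensorι B A j i n ((add_comm j i).trans h)) :=
  tensorι_desc (fun i j h => (i * j).negOnePow • ((β_ (A.X i) (B.X j)).hom ≫
    tensorι B A j i n ((add_comm j i).trans h))) i j h

lemma tensorι_associator (A B C : Cpx R) (i j k n p m : ℤ) (h : i + j = n) (h' : n + k = m)
    (hp : j + k = p) (hm : i + p = m) :
    tensorι A B i j n h ▷ C.X k ≫ tensorι (A ⊗ B) C n k m h' ≫ (α_ A B C).hom.f m =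
      (α_ _ _ _).hom ≫ A.X i ◁ tensorι B C j k p hp ≫ tensorι A (B ⊗ C) i p m hm := by
  have h₁ := mapBifunctor₁₂.ι_eq (curriedTensor (ModuleCat.{u} R))
    (curriedTensor (ModuleCat.{u} R)) A B C (ComplexShape.up ℤ) (ComplexShape.up ℤ) i j k n m h h'
  have h₂ := mapBifunctor₂₃.ι_eq (curriedTensor (ModuleCat.{u} R))
    (curriedTensor (ModuleCat.{u} R)) A B C (ComplexShape.up ℤ) (ComplexShape.up ℤ)
    (ComplexShape.up ℤ) i j k p m hp hm
  have h₃ := ι_mapBifunctorAssociatorX_hom (curriedAssociatorNatIso (ModuleCat.{u} R)) A B C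
    (ComplexShape.up ℤ) (ComplexShape.up ℤ) (ComplexShape.up ℤ) i j k m
    (by change i + j + k = m; lia)
  refine (Category.assoc _ _ _).symm.trans
    ((congrArg (· ≫ (α_ A B C).hom.f m) h₁.symm).trans (h₃.trans ?_))
  exact congrArg ((α_ (A.X i) (B.X j) (C.X k)).hom ≫ ·) h₂

lemma tensor₁₂_hom_ext {A B C : Cpx R} {m : ℤ} {Y : ModuleCat.{u} R}
    {f g : ((A ⊗ B) ⊗ C).X m ⟶ Y}
    (h : ∀ (i j k n : ℤ) (hij : i + j = n) (hnk : n + k = m),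
      tensorι A B i j n hij ▷ C.X k ≫ tensorι (A ⊗ B) C n k m hnk ≫ f =
      tensorι A B i j n hij ▷ C.X k ≫ tensorι (A ⊗ B) C n k m hnk ≫ g) : f = g := by
  refine mapBifunctor₁₂.hom_ext (F₁₂ := curriedTensor (ModuleCat.{u} R))
    (G := curriedTensor (ModuleCat.{u} R)) fun i j k hm => ?_
  rw [mapBifunctor₁₂.ι_eq _ _ _ _ _ _ _ _ _ _ (i + j) _ rfl hm, Category.assoc, Category.assoc]
  exact h i j k _ rfl hm

lemma koszulBraiding_naturality_right (A : Cpx R) {B B' : Cpx R} (g : B ⟶ B') :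
    A ◁ g ≫ koszulBraiding A B' = koszulBraiding A B ≫ g ▷ A := by
  ext n : 1
  refine tensor_hom_ext fun i j h => ?_
  rw [comp_f, comp_f, reassoc_of% tensorι_whiskerLeft, tensorι_koszulBraiding,
    reassoc_of% tensorι_koszulBraiding, Linear.units_smul_comp, Linear.comp_units_smul,
    Category.assoc, tensorι_whiskerRight, BraidedCategory.braiding_naturality_right_assoc]

lemma koszulBraiding_naturality_left {A A' : Cpx R} (f : A ⟶ A') (B : Cpx R) :
    f ▷ B ≫ koszulBraiding A' B = koszulBraiding A B ≫ B ◁ f := by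
  ext n : 1
  refine tensor_hom_ext fun i j h => ?_
  rw [comp_f, comp_f, reassoc_of% tensorι_whiskerRight, tensorι_koszulBraiding,
    reassoc_of% tensorι_koszulBraiding, Linear.units_smul_comp, Linear.comp_units_smul,
    Category.assoc, tensorι_whiskerLeft, BraidedCategory.braiding_naturality_left_assoc]

@[simp]
lemma koszulBraiding_koszulBraiding (A B : Cpx R) :
    koszulBraiding A B ≫ koszulBraiding B A = 𝟙 _ := by
  ext n : 1
  refine tensor_hom_ext fun i j h => ?_
  rw [comp_f, reassoc_of% tensorι_koszulBraiding, Linear.units_smul_comp, Category.assoc,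
    tensorι_koszulBraiding, Linear.comp_units_smul, SymmetricCategory.symmetry_assoc, smul_smul,
    ← Int.negOnePow_add, id_f, show i * j + j * i = 2 * (i * j) by ring, Int.negOnePow_two_mul,
    one_smul, Category.comp_id]

lemma koszulBraiding_hexagon_forward (A B C : Cpx R) :
    (α_ A B C).hom ≫ koszulBraiding A (B ⊗ C) ≫ (α_ B C A).hom =
      koszulBraiding A B ▷ C ≫ (α_ B A C).hom ≫ B ◁ koszulBraiding A C := by
  ext m : 1
  refine tensor₁₂_hom_ext fun i j k n h h' => ?_
  rw [comp_f, comp_f, comp_f, comp_f,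
    reassoc_of% (tensorι_associator _ _ _ i j k n (j + k) m h h' rfl (by lia)),
    reassoc_of% tensorι_koszulBraiding, reassoc_of% tensorι_whiskerRight,
    ← comp_whiskerRight_assoc, tensorι_koszulBraiding, units_smul_whiskerRight,
    comp_whiskerRight, Linear.units_smul_comp, Category.assoc, Linear.units_smul_comp,
    Linear.comp_units_smul, Linear.comp_units_smul, Category.assoc,
    reassoc_of% (tensorι_associator B A C j i k n (i + k) m (by lia) h' rfl (by lia)),
    tensorι_whiskerLeft, ← whiskerLeft_comp_assoc, tensorι_koszulBraiding,
    BraidedCategory.braiding_naturality_right_assoc,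
    tensorι_associator _ _ _ j k i (j + k) (i + k) m rfl (by lia) (by lia) (by lia)]
  simp only [whiskerLeft_units_smul, Linear.units_smul_comp, Linear.comp_units_smul, smul_smul,
    whiskerLeft_comp, Category.assoc]
  rw [BraidedCategory.hexagon_forward_assoc, ← Int.negOnePow_add, mul_add]

/-- The symmetry of the tensor product of complexes. -/
def koszulBraidingIso (A B : Cpx R) : A ⊗ B ≅ B ⊗ A where
  hom := koszulBraiding A B
  inv := koszulBraiding B A

instance : SymmetricCategory (Cpx R) where
  braiding := koszulBraidingIso
  braiding_naturality_right A _ _ g := koszulBraiding_naturality_right A g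
  braiding_naturality_left f B := koszulBraiding_naturality_left f B
  hexagon_forward A B C := koszulBraiding_hexagon_forward A B C
  hexagon_reverse A B C := by
    have hexagon : α_ C A B ≪≫ koszulBraidingIso C (A ⊗ B) ≪≫ α_ A B C =
        whiskerRightIso (koszulBraidingIso C A) B ≪≫ α_ A C B ≪≫
          whiskerLeftIso A (koszulBraidingIso C B) :=
      Iso.ext (koszulBraiding_hexagon_forward C A B)
    simpa [koszulBraidingIso] using congrArg Iso.inv hexagon
  symmetry A B := koszulBraiding_koszulBraiding A B

end

section

variable {R : Type u} [CommRing R]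

open HomologicalComplex CochainComplex.HomComplex

/-- The component `B^j ⟶ C^k` of a cochain, as a linear map. -/
def cochainEval (B C : Cpx R) (q j k : ℤ) (h : j + q = k) :
    Cochain B C q →ₗ[R] B.X j →ₗ[R] C.X k where
  toFun z := (z.v j k h).hom
  map_add' _ _ := by rw [Cochain.add_v, ModuleCat.hom_add]
  map_smul' _ _ := by rw [Cochain.smul_v, ModuleCat.hom_smul, RingHom.id_apply]

/-- The evaluation `Hom^q(B, C) ⊗ B^j ⟶ C^k`. -/
def homEval (B C : Cpx R) (q j k : ℤ) (h : j + q = k) : (homCpx B C).X q ⊗ B.X j ⟶ C.X k :=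
  ModuleCat.ofHom (TensorProduct.lift (cochainEval B C q j k h))

/-- The morphism `X ⟶ Hom^q(B, C)` given by a family of morphisms `X ⊗ B^j ⟶ C^(j+q)`. -/
def homLift {B C : Cpx R} {q : ℤ} {X : ModuleCat.{u} R}
    (f : ∀ j k : ℤ, j + q = k → (X ⊗ B.X j ⟶ C.X k)) : X ⟶ (homCpx B C).X q :=
  ModuleCat.ofHom (Y := Cochain B C q)
    { toFun := fun x => Cochain.mk fun j k h =>
        ModuleCat.ofHom (TensorProduct.curry (f j k h).hom x)
      map_add' := fun _ _ => by ext; simp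
      map_smul' := fun _ _ => by ext; simp }

@[simp]
lemma homLift_homEval {B C : Cpx R} {q : ℤ} {X : ModuleCat.{u} R}
    (f : ∀ j k : ℤ, j + q = k → (X ⊗ B.X j ⟶ C.X k)) (j k : ℤ) (h : j + q = k) :
    homLift f ▷ B.X j ≫ homEval B C q j k h = f j k h :=
  ModuleCat.MonoidalCategory.tensor_ext fun _ _ => rfl

lemma hom_hom_ext {B C : Cpx R} {q : ℤ} {X : ModuleCat.{u} R} {f g : X ⟶ (homCpx B C).X q}
    (h : ∀ (j k : ℤ) (h : j + q = k),
      f ▷ B.X j ≫ homEval B C q j k h = g ▷ B.X j ≫ homEval B C q j k h) : f = g := by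
  ext x : 2
  refine Cochain.ext _ _ fun j k hjk => ?_
  ext b : 2
  exact congr($(h j k hjk) (x ⊗ₜ b))

lemma homCpx_d_homEval (B C : Cpx R) (q q' : ℤ) (hq : q + 1 = q') (j j' k k' : ℤ)
    (hj : j + 1 = j') (hk : k + 1 = k') (h : j + q = k) :
    (homCpx B C).d q q' ▷ B.X j ≫ homEval B C q' j k' (by lia) =
      homEval B C q j k h ≫ C.d k k' +
        q'.negOnePow • ((homCpx B C).X q ◁ B.d j j' ≫ homEval B C q j' k' (by lia)) := by
  refine ModuleCat.MonoidalCategory.tensor_ext fun z b => ?_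
  refine (congr($(δ_v q q' hq (z : Cochain B C q) j k' (by lia) k j' (by lia) (by lia)) b)).trans ?_
  obtain h | h := Int.units_eq_one_or q'.negOnePow
  · rw [h, one_smul, one_smul]
    rfl
  · rw [h, Units.neg_smul, Units.neg_smul, one_smul, one_smul]
    rfl

lemma homCpxMap_homEval {B B' C C' : Cpx R} (f : B' ⟶ B) (g : C ⟶ C') (q j k : ℤ)
    (h : j + q = k) :
    (homCpxMap f g).f q ▷ B'.X j ≫ homEval B' C' q j k h =
      (homCpx B C).X q ◁ f.f j ≫ homEval B C q j k h ≫ g.f k :=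
  ModuleCat.MonoidalCategory.tensor_ext fun _ _ => rfl

/-- Currying of cochains. -/
def cochainCurry {A B C : Cpx R} {n : ℤ} (z : Cochain (A ⊗ B) C n) : Cochain A (homCpx B C) n :=
  Cochain.mk fun p q hpq => homLift fun j k h =>
    tensorι A B p j (p + j) rfl ≫ z.v (p + j) k (by lia)

/-- Uncurrying of cochains. -/
def cochainUncurry {A B C : Cpx R} {n : ℤ} (w : Cochain A (homCpx B C) n) : Cochain (A ⊗ B) C n :=
  Cochain.mk fun m k hmk => tensorDesc fun i j h =>
    w.v i (i + n) rfl ▷ B.X j ≫ homEval B C (i + n) j k (by lia)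

lemma cochainCurry_v_homEval {A B C : Cpx R} {n : ℤ} (z : Cochain (A ⊗ B) C n) (p q j k m : ℤ)
    (hpq : p + n = q) (h : j + q = k) (hm : p + j = m) :
    (cochainCurry z).v p q hpq ▷ B.X j ≫ homEval B C q j k h =
      tensorι A B p j m hm ≫ z.v m k (by lia) := by
  subst hm
  exact homLift_homEval _ _ _ _

lemma tensorι_cochainUncurry_v {A B C : Cpx R} {n : ℤ} (w : Cochain A (homCpx B C) n)
    (i j m k q : ℤ) (h : i + j = m) (hmk : m + n = k) (hq : i + n = q) :
    tensorι A B i j m h ≫ (cochainUncurry w).v m k hmk =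
      w.v i q hq ▷ B.X j ≫ homEval B C q j k (by lia) := by
  subst hq
  exact tensorι_desc _ _ _ _

/-- The adjunction between tensor product and internal Hom, on cochains. -/
def cochainCurryEquiv (A B C : Cpx R) (n : ℤ) :
    Cochain (A ⊗ B) C n ≃+ Cochain A (homCpx B C) n where
  toFun := cochainCurry
  invFun := cochainUncurry
  left_inv z := Cochain.ext _ _ fun m k hmk => tensor_hom_ext fun i j h => by
    rw [tensorι_cochainUncurry_v _ i j m k _ h hmk rfl, cochainCurry_v_homEval _ _ _ _ _ _ _ _ h]
  right_inv w := Cochain.ext _ _ fun p q hpq => hom_hom_ext fun j k h => by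
    rw [cochainCurry_v_homEval _ _ _ _ _ _ _ _ rfl, tensorι_cochainUncurry_v]
  map_add' z w := Cochain.ext _ _ fun p q hpq => hom_hom_ext fun j k h => by
    rw [Cochain.add_v, MonoidalPreadditive.add_whiskerRight, Preadditive.add_comp,
      cochainCurry_v_homEval _ _ _ _ _ _ _ _ rfl, cochainCurry_v_homEval _ _ _ _ _ _ _ _ rfl,
      cochainCurry_v_homEval _ _ _ _ _ _ _ _ rfl, Cochain.add_v, Preadditive.comp_add]

lemma δ_cochainCurry {A B C : Cpx R} {n n' : ℤ} (z : Cochain (A ⊗ B) C n) (hn : n + 1 = n') :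
    δ n n' (cochainCurry z) = cochainCurry (δ n n' z) := by
  refine Cochain.ext _ _ fun p q hpq => hom_hom_ext fun j k h => ?_
  rw [cochainCurry_v_homEval _ _ _ _ _ _ _ _ rfl,
    δ_v n n' hn z (p + j) k (by lia) (k - 1) (p + j + 1) (by lia) (by lia),
    δ_v n n' hn (cochainCurry z) p q hpq (q - 1) (p + 1) (by lia) (by lia),
    MonoidalPreadditive.add_whiskerRight, Preadditive.add_comp, units_smul_whiskerRight,
    comp_whiskerRight, comp_whiskerRight, Category.assoc, Preadditive.comp_add,
    Linear.units_smul_comp, Linear.comp_units_smul, Category.assoc,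
    homCpx_d_homEval B C (q - 1) q (by lia) j (j + 1) (k - 1) k rfl (by lia) (by lia),
    Preadditive.comp_add, Linear.comp_units_smul,
    cochainCurry_v_homEval _ _ _ _ _ (p + j + 1) _ _ (by lia),
    reassoc_of% (cochainCurry_v_homEval z p (q - 1) j (k - 1) (p + j) (by lia) (by lia) rfl),
    ← whisker_exchange_assoc, cochainCurry_v_homEval _ _ _ _ _ (p + j + 1) _ _ (by lia),
    reassoc_of% (tensorι_d A B p j (p + j) (p + j + 1) rfl rfl), Preadditive.add_comp,
    Linear.units_smul_comp, Category.assoc, Category.assoc, smul_add, smul_smul, add_assoc,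
    ← Int.negOnePow_add, add_comm (n'.negOnePow • _), add_comm n' p, hpq]

lemma δ_cochainUncurry {A B C : Cpx R} {n n' : ℤ} (w : Cochain A (homCpx B C) n)
    (hn : n + 1 = n') : δ n n' (cochainUncurry w) = cochainUncurry (δ n n' w) := by
  obtain ⟨z, rfl⟩ := (cochainCurryEquiv A B C n).surjective w
  change δ n n' ((cochainCurryEquiv A B C n).symm _) =
    (cochainCurryEquiv A B C n').symm (δ n n' (cochainCurry z))
  rw [δ_cochainCurry z hn, AddEquiv.symm_apply_apply]
  exact ((cochainCurryEquiv A B C n').symm_apply_apply _).symm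

/-- Currying of morphisms of complexes. -/
def cpxCurry {A B C : Cpx R} (f : A ⊗ B ⟶ C) : A ⟶ homCpx B C :=
  Cocycle.homOf (Cocycle.mk (cochainCurry (Cochain.ofHom f)) 1 (zero_add 1) (by
    rw [δ_cochainCurry _ (zero_add 1), δ_ofHom]
    exact (cochainCurryEquiv A B C 1).map_zero))

/-- Uncurrying of morphisms of complexes. -/
def cpxUncurry {A B C : Cpx R} (g : A ⟶ homCpx B C) : A ⊗ B ⟶ C :=
  Cocycle.homOf (Cocycle.mk (cochainUncurry (Cochain.ofHom g)) 1 (zero_add 1) (by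
    rw [δ_cochainUncurry _ (zero_add 1), δ_ofHom]
    exact (cochainCurryEquiv A B C 1).symm.map_zero))

lemma ofHom_cpxCurry {A B C : Cpx R} (f : A ⊗ B ⟶ C) :
    Cochain.ofHom (cpxCurry f) = cochainCurry (Cochain.ofHom f) :=
  Cocycle.cochain_ofHom_homOf_eq_coe _

lemma ofHom_cpxUncurry {A B C : Cpx R} (g : A ⟶ homCpx B C) :
    Cochain.ofHom (cpxUncurry g) = cochainUncurry (Cochain.ofHom g) :=
  Cocycle.cochain_ofHom_homOf_eq_coe _

/-- The adjunction between the tensor product and the internal Hom of complexes. -/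
def tensorHomEquiv (A B C : Cpx R) : (A ⊗ B ⟶ C) ≃ (A ⟶ homCpx B C) where
  toFun := cpxCurry
  invFun := cpxUncurry
  left_inv f := by
    apply Cochain.ofHom_injective
    rw [ofHom_cpxUncurry, ofHom_cpxCurry]
    exact (cochainCurryEquiv A B C 0).symm_apply_apply _
  right_inv g := by
    apply Cochain.ofHom_injective
    rw [ofHom_cpxCurry, ofHom_cpxUncurry]
    exact (cochainCurryEquiv A B C 0).apply_symm_apply _

lemma ofHom_tensorHomEquiv {A B C : Cpx R} (f : A ⊗ B ⟶ C) :
    Cochain.ofHom (tensorHomEquiv A B C f) = cochainCurry (Cochain.ofHom f) :=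
  ofHom_cpxCurry f

lemma tensorHomEquiv_f_homEval {A B C : Cpx R} (f : A ⊗ B ⟶ C) (p j k : ℤ) (h : j + p = k) :
    (tensorHomEquiv A B C f).f p ▷ B.X j ≫ homEval B C p j k h =
      tensorι A B p j k ((add_comm p j).trans h) ≫ f.f k := by
  have curry_v := cochainCurry_v_homEval (Cochain.ofHom f) p p j k k (add_zero p) h (by lia)
  rwa [← ofHom_tensorHomEquiv, Cochain.ofHom_v, Cochain.ofHom_v] at curry_v

lemma tensorHomEquiv_naturality {A A' B B' C C' : Cpx R} (a : A' ⟶ A) (b : B' ⟶ B) (c : C ⟶ C')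
    (f : A ⊗ B ⟶ C) :
    tensorHomEquiv A' B' C' ((a ⊗ₘ b) ≫ f ≫ c) =
      a ≫ tensorHomEquiv A B C f ≫ homCpxMap b c := by
  ext p : 1
  refine hom_hom_ext fun j k h => ?_
  rw [tensorHomEquiv_f_homEval, MonoidalCategory.tensorHom_def]
  simp only [comp_f, comp_whiskerRight, Category.assoc, homCpxMap_homEval,
    reassoc_of% tensorι_whiskerRight, reassoc_of% tensorι_whiskerLeft]
  rw [← whisker_exchange_assoc, ← whisker_exchange_assoc, ← whisker_exchange_assoc,
    reassoc_of% tensorHomEquiv_f_homEval]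

lemma quotient_map_tensorHomEquiv_eq_zero_iff {A B C : Cpx R} (f : A ⊗ B ⟶ C) :
    (HomotopyCategory.quotient _ _).map (tensorHomEquiv A B C f) = 0 ↔
      (HomotopyCategory.quotient _ _).map f = 0 := by
  rw [quotient_map_eq_zero_iff_exists_δ, quotient_map_eq_zero_iff_exists_δ, ofHom_tensorHomEquiv]
  constructor
  · rintro ⟨w, hw⟩
    obtain ⟨z, rfl⟩ := (cochainCurryEquiv A B C _).surjective w
    exact ⟨z, (cochainCurryEquiv A B C _).injective
      ((δ_cochainCurry z (by lia)).symm.trans hw)⟩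
  · rintro ⟨z, hz⟩
    exact ⟨cochainCurry z, by rw [δ_cochainCurry z (by lia), hz]⟩

lemma tensorHomEquiv_sub {A B C : Cpx R} (f g : A ⊗ B ⟶ C) :
    tensorHomEquiv A B C (f - g) = tensorHomEquiv A B C f - tensorHomEquiv A B C g := by
  apply Cochain.ofHom_injective
  rw [Cochain.ofHom_sub]
  simp only [ofHom_tensorHomEquiv, Cochain.ofHom_sub]
  exact (cochainCurryEquiv A B C 0).map_sub _ _

lemma quotient_map_tensorHomEquiv_eq_iff {A B C : Cpx R} (f g : A ⊗ B ⟶ C) :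
    (HomotopyCategory.quotient _ _).map (tensorHomEquiv A B C f) =
      (HomotopyCategory.quotient _ _).map (tensorHomEquiv A B C g) ↔
      (HomotopyCategory.quotient _ _).map f = (HomotopyCategory.quotient _ _).map g := by
  rw [← sub_eq_zero, ← Functor.map_sub, ← tensorHomEquiv_sub,
    quotient_map_tensorHomEquiv_eq_zero_iff, Functor.map_sub, sub_eq_zero]

end

/-! ### Pure acyclicity and character complexes -/

section

open HomologicalComplex CochainComplex.HomComplex

variable {V : Type u} [Category.{v} V]

lemma exists_desc_of_acyclic [Abelian V] {Z : CochainComplex V ℤ} (hZ : Z.Acyclic) {J : V}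
    [Injective J] {i j k : ℤ} (hi : i + 1 = j) (hk : j + 1 = k) (g : Z.X j ⟶ J)
    (hg : Z.d i j ≫ g = 0) : ∃ h : Z.X k ⟶ J, Z.d j k ≫ h = g := by
  have exact_at_j := (Z.exactAt_iff' i j k (by simp [← hi]) (by simp [hk])).1 (hZ j)
  exact ⟨exact_at_j.descToInjective g hg, exact_at_j.comp_descToInjective g hg⟩

/-- The morphism of complexes `g` induces the zero map on the cohomology of `Hom(N, -)`. -/
def HomKills [HasZeroMorphisms V] (N : V) {X Y : CochainComplex V ℤ} (g : X ⟶ Y) : Prop :=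
  ∀ (i j k : ℤ), i + 1 = j → j + 1 = k → ∀ φ : N ⟶ X.X j, φ ≫ X.d j k = 0 →
    ∃ ψ : N ⟶ Y.X i, ψ ≫ Y.d i j = φ ≫ g.f j

lemma HomKills.of_iso [HasZeroMorphisms V] {N N' : V} (e : N ≅ N') {X Y : CochainComplex V ℤ}
    {g : X ⟶ Y} (h : HomKills N g) : HomKills N' g := by
  intro i j k hi hk φ hφ
  obtain ⟨ψ, hψ⟩ := h i j k hi hk (e.hom ≫ φ) (by rw [Category.assoc, hφ, comp_zero])
  exact ⟨e.inv ≫ ψ, by rw [Category.assoc, hψ, Category.assoc, e.inv_hom_id_assoc]⟩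

variable [Preadditive V]

lemma quotient_map_fromSingleMk_comp_eq_zero_iff [HasZeroObject V] {N : V}
    {X Y : CochainComplex V ℤ} (g : X ⟶ Y) (m : ℤ) (φ : N ⟶ X.X m)
    (hφ : φ ≫ X.d m (m + 1) = 0) :
    (HomotopyCategory.quotient _ _).map
      (Cocycle.homOf (Cocycle.fromSingleMk φ (add_zero m) (m + 1) rfl hφ) ≫ g) = 0 ↔
      ∃ ψ : N ⟶ Y.X (m - 1), ψ ≫ Y.d (m - 1) m = φ ≫ g.f m := by
  rw [← Cocycle.fromSingleMk_mem_coboundaries_iff (φ ≫ g.f m) (add_zero m) (m + 1) rfl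
    (by rw [Category.assoc, g.comm, reassoc_of% hφ, zero_comp]) _ (by lia),
    quotient_map_eq_zero_iff_exists_δ, mem_coboundaries_iff _ (-1) (by lia),
    Cocycle.fromSingleMk_postcomp, Cocycle.postcomp_coe, Cochain.ofHom_comp,
    Cocycle.cochain_ofHom_homOf_eq_coe]

lemma homKills_iff [HasZeroObject V] (N : V) {X Y : CochainComplex V ℤ} (g : X ⟶ Y) :
    HomKills N g ↔ ∀ (m : ℤ) (f : (HomotopyCategory.quotient _ _).obj
      ((CochainComplex.singleFunctor V m).obj N) ⟶ (HomotopyCategory.quotient _ _).obj X),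
      f ≫ (HomotopyCategory.quotient _ _).map g = 0 := by
  constructor
  · intro h m f
    obtain ⟨f, rfl⟩ := (HomotopyCategory.quotient _ _).map_surjective f
    obtain ⟨φ, hφ, hf⟩ := Cocycle.fromSingleMk_surjective (Cocycle.ofHom f) m (add_zero m) _ rfl
    rw [← Functor.map_comp, ← Cocycle.homOf_ofHom_eq_self f, ← hf,
      quotient_map_fromSingleMk_comp_eq_zero_iff]
    exact h _ _ _ (by lia) rfl φ hφ
  · rintro h i j k hi rfl φ hφ
    obtain rfl : i = j - 1 := by lia
    rw [← quotient_map_fromSingleMk_comp_eq_zero_iff g j φ hφ, Functor.map_comp]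
    exact h _ _

lemma HomKills.hom_single_eq_zero [HasZeroObject V] {N : V} {X : CochainComplex V ℤ}
    (h : HomKills N (𝟙 X)) (m : ℤ)
    (f : (HomotopyCategory.quotient _ _).obj ((CochainComplex.singleFunctor V m).obj N) ⟶
      (HomotopyCategory.quotient _ _).obj X) : f = 0 := by
  rw [← Category.comp_id f, ← CategoryTheory.Functor.map_id, (homKills_iff _ _).1 h m f]

lemma isZero_quotient_obj_of_sections [CategoryWithHomology V] {Y : CochainComplex V ℤ}
    (σ : ∀ m, Y.cycles (m + 1) ⟶ Y.X m) (hσ : ∀ m, σ m ≫ Y.d m (m + 1) = Y.iCycles (m + 1)) :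
    IsZero ((HomotopyCategory.quotient _ _).obj Y) := by
  let π (m : ℤ) : Y.X m ⟶ Y.cycles m :=
    Y.liftCycles (𝟙 _ - Y.toCycles m (m + 1) ≫ σ m) (m + 1) (by simp) (by simp [hσ])
  have hπ (m : ℤ) : π m ≫ Y.iCycles m = 𝟙 _ - Y.toCycles m (m + 1) ≫ σ m :=
    Y.liftCycles_i _ _ _ _
  have iCycles_π (m : ℤ) : Y.iCycles m ≫ π m = 𝟙 _ := by
    have iCycles_toCycles : Y.iCycles m ≫ Y.toCycles m (m + 1) = 0 := by
      rw [← cancel_mono (Y.iCycles _), Category.assoc, toCycles_i, iCycles_d, zero_comp]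
    rw [← cancel_mono (Y.iCycles m), Category.assoc, hπ, Preadditive.comp_sub,
      reassoc_of% iCycles_toCycles, zero_comp, sub_zero, Category.comp_id, Category.id_comp]
  let s (m : ℤ) : Y.X (m + 1) ⟶ Y.X m := π (m + 1) ≫ σ m
  have hs (m : ℤ) : s m ≫ Y.d m (m + 1) = 𝟙 _ - Y.toCycles (m + 1) (m + 1 + 1) ≫ σ (m + 1) := by
    rw [Category.assoc, hσ, hπ]
  have hds (m : ℤ) : Y.d m (m + 1) ≫ s m = Y.toCycles m (m + 1) ≫ σ m := by
    rw [← Y.toCycles_i, Category.assoc, reassoc_of% iCycles_π]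
  rw [IsZero.iff_id_eq_zero, ← CategoryTheory.Functor.map_id, quotient_map_eq_zero_iff_exists_δ]
  refine ⟨Cochain.mk fun p r hpr => (Y.XIsoOfEq (show p = r + 1 by lia)).hom ≫ s r,
    Cochain.ext _ _ fun p r hpr => ?_⟩
  obtain rfl : p = r := by lia
  obtain ⟨r, rfl⟩ : ∃ r, p = r + 1 := ⟨p - 1, by lia⟩
  rw [δ_v (-1) 0 (by lia) _ _ _ hpr r (r + 1 + 1) (by lia) (by lia)]
  simp [hs, hds]

lemma isZero_quotient_obj_of_homKills [CategoryWithHomology V] {Y : CochainComplex V ℤ}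
    (h : ∀ N : V, HomKills N (𝟙 Y)) : IsZero ((HomotopyCategory.quotient _ _).obj Y) := by
  have exists_section (m : ℤ) :
      ∃ σ : Y.cycles (m + 1) ⟶ Y.X m, σ ≫ Y.d m (m + 1) = Y.iCycles (m + 1) := by
    obtain ⟨σ, hσ⟩ := h (Y.cycles (m + 1)) m (m + 1) (m + 1 + 1) rfl rfl (Y.iCycles (m + 1))
      (Y.iCycles_d _ _)
    exact ⟨σ, hσ.trans (Category.comp_id _)⟩
  choose σ hσ using exists_section
  exact isZero_quotient_obj_of_sections σ hσ

end

lemma forall_hom_eq_zero_of_iso {C : Type*} [Category* C] [HasZeroMorphisms C] {X X' Y : C}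
    (e : X ≅ X') (h : ∀ f : X ⟶ Y, f = 0) (f : X' ⟶ Y) : f = 0 := by
  rw [← cancel_epi e.hom, h (e.hom ≫ f), comp_zero]

section

open HomologicalComplex CochainComplex.HomComplex

variable {R : Type u} [CommRing R]

variable (R) in
/-- The canonical injective cogenerator of the category of `R`-modules. -/
def cogen : ModuleCat.{u} R := ModuleCat.of R (CharacterModule R)

instance : Injective (cogen R) :=
  have : Module.Injective R (CharacterModule R) :=
    Module.Flat.iff_characterModule_injective.1 inferInstance
  Module.injective_object_of_injective_module R (CharacterModule R)

lemma exists_hom_cogen_ne_zero {M : ModuleCat.{u} R} {x : M} (hx : x ≠ 0) :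
    ∃ f : M ⟶ cogen R, f x ≠ 0 := by
  obtain ⟨c, hc⟩ := CharacterModule.exists_character_apply_ne_zero_of_ne_zero hx
  let f : M →ₗ[R] CharacterModule R :=
    CharacterModule.curry (c.comp (TensorProduct.rid R M).toLinearMap.toAddMonoidHom)
  refine ⟨ModuleCat.ofHom f, fun h => hc ?_⟩
  have hf : c (TensorProduct.rid R M (x ⊗ₜ 1)) = 0 :=
    congrArg (fun e : CharacterModule R => e 1) h
  rwa [TensorProduct.rid_tmul, one_smul] at hf

lemma acyclic_iff_forall_exists (Z : Cpx R) :
    Z.Acyclic ↔ ∀ (i j k : ℤ), i + 1 = j → j + 1 = k → ∀ x : Z.X j, Z.d j k x = 0 →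
      ∃ y : Z.X i, Z.d i j y = x := by
  constructor
  · rintro h i j k hi hk x hx
    have exact_at_j := (Z.exactAt_iff' i j k (by simp [← hi]) (by simp [hk])).1 (h j)
    exact (ShortComplex.moduleCat_exact_iff _).1 exact_at_j x hx
  · intro h j
    rw [Z.exactAt_iff' (j - 1) j (j + 1) (by simp) (by simp), ShortComplex.moduleCat_exact_iff]
    exact fun x hx => h (j - 1) j (j + 1) (by lia) rfl x hx

/-- The morphism of complexes `g` induces the zero map on the cohomology of `N ⊗ -`. -/
def TensorKills (N : ModuleCat.{u} R) {X Y : Cpx R} (g : X ⟶ Y) : Prop :=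
  ∀ (i j k : ℤ), i + 1 = j → j + 1 = k → ∀ x : (N ⊗ X.X j : ModuleCat.{u} R),
    (N ◁ X.d j k) x = 0 → ∃ y : (N ⊗ Y.X i : ModuleCat.{u} R), (N ◁ Y.d i j) y = (N ◁ g.f j) x

lemma isPureAcyclic_iff_tensorKills (X : Cpx R) :
    IsPureAcyclic X ↔ ∀ N : ModuleCat.{u} R, TensorKills N (𝟙 X) := by
  refine forall_congr' fun N => ?_
  rw [acyclic_iff_forall_exists]
  refine ⟨fun h i j k hi hk x hx => ?_, fun h i j k hi hk x hx => ?_⟩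
  · obtain ⟨y, hy⟩ := h i j k hi hk x hx
    exact ⟨y, hy.trans congr($(whiskerLeft_id N (X.X j)) x).symm⟩
  · obtain ⟨y, hy⟩ := h i j k hi hk x hx
    exact ⟨y, hy.trans congr($(whiskerLeft_id N (X.X j)) x)⟩

variable (R) in
/-- The cogenerator, as a complex concentrated in degree `0`. -/
abbrev cogenCpx : Cpx R := (single (ModuleCat.{u} R) (ComplexShape.up ℤ) 0).obj (cogen R)

/-- The character complex of a complex. -/
abbrev dualCpx (X : Cpx R) : Cpx R := homCpx X (cogenCpx R)

/-- The morphism `N ⊗ X^p ⟶ E` attached to a morphism from `N` to degree `-p` of the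
character complex of `X`. -/
def dualEval {N : ModuleCat.{u} R} {X : Cpx R} {m : ℤ} (φ : N ⟶ (dualCpx X).X m) (p : ℤ)
    (h : p + m = 0) : N ⊗ X.X p ⟶ cogen R :=
  φ ▷ X.X p ≫ homEval X (cogenCpx R) m p 0 h ≫
    (singleObjXSelf (ComplexShape.up ℤ) 0 (cogen R)).hom

lemma dualEval_injective {N : ModuleCat.{u} R} {X : Cpx R} {m : ℤ} (p : ℤ) (h : p + m = 0)
    {φ φ' : N ⟶ (dualCpx X).X m} (hφ : dualEval φ p h = dualEval φ' p h) : φ = φ' := by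
  refine hom_hom_ext fun j k hk => ?_
  by_cases h0 : k = 0
  · subst h0
    obtain rfl : p = j := by lia
    rw [← cancel_mono (singleObjXSelf (ComplexShape.up ℤ) 0 (cogen R)).hom]
    simpa [dualEval] using hφ
  · exact (isZero_single_obj_X (ComplexShape.up ℤ) 0 (cogen R) k h0).eq_of_tgt _ _

lemma dualEval_surjective {N : ModuleCat.{u} R} {X : Cpx R} {m : ℤ} (p : ℤ) (h : p + m = 0)
    (g : N ⊗ X.X p ⟶ cogen R) : ∃ φ : N ⟶ (dualCpx X).X m, dualEval φ p h = g := by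
  refine ⟨homLift fun j k hk => if hj : j = p then N ◁ (X.XIsoOfEq hj).hom ≫ g ≫
    (singleObjXIsoOfEq (ComplexShape.up ℤ) 0 (cogen R) k (by lia)).inv else 0, ?_⟩
  rw [dualEval, reassoc_of% homLift_homEval, dif_pos rfl]
  simp [singleObjXIsoOfEq, singleObjXSelf]

lemma dualEval_d {N : ModuleCat.{u} R} {X : Cpx R} {m m' : ℤ} (hm : m + 1 = m')
    (φ : N ⟶ (dualCpx X).X m) (p p' : ℤ) (hp : p + 1 = p') (h : p' + m = 0) :
    dualEval (φ ≫ (dualCpx X).d m m') p (by lia) =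
      m'.negOnePow • (N ◁ X.d p p' ≫ dualEval φ p' h) := by
  rw [dualEval, comp_whiskerRight, Category.assoc, ← Category.assoc ((dualCpx X).d m m' ▷ _),
    homCpx_d_homEval X (cogenCpx R) m m' hm p p' (-1) 0 hp (by lia) (by lia), single_obj_d,
    comp_zero, zero_add, Linear.units_smul_comp, Linear.comp_units_smul, Category.assoc,
    ← whisker_exchange_assoc]
  rfl

lemma dualEval_map {N : ModuleCat.{u} R} {X Y : Cpx R} (g : X ⟶ Y) {m : ℤ}
    (φ : N ⟶ (dualCpx Y).X m) (p : ℤ) (h : p + m = 0) :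
    dualEval (φ ≫ (homCpxMap g (𝟙 (cogenCpx R))).f m) p h = N ◁ g.f p ≫ dualEval φ p h := by
  rw [dualEval, comp_whiskerRight, Category.assoc, reassoc_of% homCpxMap_homEval, id_f,
    Category.id_comp, ← whisker_exchange_assoc]
  rfl

lemma homKills_dualCpx_of_acyclic {N : ModuleCat.{u} R} {X : Cpx R}
    (h : (((tensorLeft N).mapHomologicalComplex (ComplexShape.up ℤ)).obj X).Acyclic) :
    HomKills N (𝟙 (dualCpx X)) := by
  rintro i j k hi hk φ hφ
  have hd : dualEval (φ ≫ (dualCpx X).d j k) (-k) (by lia) = 0 := by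
    rw [hφ, dualEval, MonoidalPreadditive.zero_whiskerRight, zero_comp]
  rw [dualEval_d hk φ (-k) (-j) (by lia) (by lia), smul_eq_zero_iff_eq] at hd
  obtain ⟨g, hg⟩ : ∃ g : N ⊗ X.X (-i) ⟶ cogen R, N ◁ X.d (-j) (-i) ≫ g =
      dualEval φ (-j) (by lia) :=
    exists_desc_of_acyclic h (show -k + 1 = -j by lia) (show -j + 1 = -i by lia)
      (dualEval φ (-j) (by lia)) hd
  obtain ⟨ψ, hψ⟩ := dualEval_surjective (m := i) (-i) (by lia) (j.negOnePow • g)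
  refine ⟨ψ, dualEval_injective (-j) (by lia) ?_⟩
  rw [dualEval_d hi ψ (-j) (-i) (by lia) (by lia), hψ, Linear.comp_units_smul, smul_smul,
    Int.units_mul_self, one_smul, id_f, Category.comp_id]
  exact hg

lemma tensorKills_of_homKills {N : ModuleCat.{u} R} {X Y : Cpx R} {g : X ⟶ Y}
    (h : HomKills N (homCpxMap g (𝟙 (cogenCpx R)))) : TensorKills N g := by
  rintro i j k hi hk x hx
  by_contra hy
  let S := LinearMap.range (N ◁ Y.d i j).hom
  have hx' : S.mkQ ((N ◁ g.f j) x) ≠ 0 := by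
    rw [Submodule.mkQ_apply, ne_eq, Submodule.Quotient.mk_eq_zero]
    exact hy
  obtain ⟨χ, hχ⟩ := exists_hom_cogen_ne_zero (M := ModuleCat.of R (_ ⧸ S)) hx'
  have hχd : N ◁ Y.d i j ≫ ModuleCat.ofHom S.mkQ ≫ χ = 0 := by
    have d_mkQ : N ◁ Y.d i j ≫ ModuleCat.ofHom S.mkQ = 0 := by
      ext z : 2
      exact (Submodule.Quotient.mk_eq_zero _).2 ⟨z, rfl⟩
    rw [reassoc_of% d_mkQ, zero_comp]
  obtain ⟨φ, hφ⟩ := dualEval_surjective (m := -j) j (by lia) (ModuleCat.ofHom S.mkQ ≫ χ)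
  obtain ⟨ψ, hψ⟩ := h (-k) (-j) (-i) (by lia) (by lia) φ (dualEval_injective i (by lia) (by
    rw [dualEval_d (by lia) φ i j hi (by lia), hφ, hχd, smul_zero, dualEval,
      MonoidalPreadditive.zero_whiskerRight, zero_comp]))
  have χ_factors : N ◁ X.d j k ≫ ((-j).negOnePow • dualEval ψ k (by lia)) =
      N ◁ g.f j ≫ ModuleCat.ofHom S.mkQ ≫ χ := by
    rw [Linear.comp_units_smul, ← dualEval_d (by lia) ψ j k hk (by lia), hψ, dualEval_map, hφ]
  refine hχ (Eq.trans congr($χ_factors x).symm ?_)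
  rw [ModuleCat.comp_apply, hx, map_zero]

variable (R) in
/-- The quotient functor from complexes of `R`-modules to `K(R)`. -/
abbrev qK : Cpx R ⥤ K R := toK (ModuleCat.{u} R)

lemma Kpac_qK_iff (X : Cpx R) : Kpac R ((qK R).obj X) ↔ IsPureAcyclic X := Iff.rfl

lemma isZero_dualCpx_of_isPureAcyclic {X : Cpx R} (hX : IsPureAcyclic X) :
    IsZero ((qK R).obj (dualCpx X)) :=
  isZero_quotient_obj_of_homKills fun N => homKills_dualCpx_of_acyclic (hX N)

lemma forall_hom_tensor_eq_zero_iff (A B C : Cpx R) :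
    (∀ f : (qK R).obj (A ⊗ B) ⟶ (qK R).obj C, f = 0) ↔
      ∀ f : (qK R).obj A ⟶ (qK R).obj (homCpx B C), f = 0 := by
  constructor
  · intro h f
    obtain ⟨f, rfl⟩ := (qK R).map_surjective f
    obtain ⟨f, rfl⟩ := (tensorHomEquiv A B C).surjective f
    exact (quotient_map_tensorHomEquiv_eq_zero_iff f).2 (h _)
  · intro h f
    obtain ⟨f, rfl⟩ := (qK R).map_surjective f
    exact (quotient_map_tensorHomEquiv_eq_zero_iff f).1 (h _)

lemma isPureAcyclic_iff_forall_tensor (X : Cpx R) :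
    IsPureAcyclic X ↔
      ∀ (A : Cpx R) (f : (qK R).obj (A ⊗ X) ⟶ (qK R).obj (cogenCpx R)), f = 0 := by
  constructor
  · intro h A
    rw [forall_hom_tensor_eq_zero_iff]
    exact fun f => (isZero_dualCpx_of_isPureAcyclic h).eq_of_tgt _ _
  · intro h
    rw [isPureAcyclic_iff_tensorKills]
    refine fun N => tensorKills_of_homKills ((homKills_iff _ _).2 fun m f => ?_)
    rw [(forall_hom_tensor_eq_zero_iff _ _ _).1 (h _) f, zero_comp]

lemma IsPureAcyclic.tensor_right {X : Cpx R} (hX : IsPureAcyclic X) (B : Cpx R) :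
    IsPureAcyclic (X ⊗ B) := by
  rw [isPureAcyclic_iff_forall_tensor] at hX ⊢
  exact fun A => forall_hom_eq_zero_of_iso
    ((qK R).mapIso (α_ A B X ≪≫ whiskerLeftIso A (β_ B X))) (hX (A ⊗ B))

lemma IsPureAcyclic.tensor_left {X : Cpx R} (hX : IsPureAcyclic X) (B : Cpx R) :
    IsPureAcyclic (B ⊗ X) := by
  rw [isPureAcyclic_iff_forall_tensor] at hX ⊢
  exact fun A => forall_hom_eq_zero_of_iso ((qK R).mapIso (α_ A B X)) (hX (A ⊗ B))

lemma rightOrthogonal_homCpx (A : Cpx R) {I : Cpx R}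
    (hI : (Kpac R).rightOrthogonal ((qK R).obj I)) :
    (Kpac R).rightOrthogonal ((qK R).obj (homCpx A I)) := by
  intro X f hX
  obtain ⟨X, rfl⟩ := HomotopyCategory.quotient_obj_surjective X
  exact (forall_hom_tensor_eq_zero_iff _ _ _).1
    (fun g => hI g ((Kpac_qK_iff _).2 (((Kpac_qK_iff _).1 hX).tensor_right A))) f

variable (R) in
lemma rightOrthogonal_cogenCpx : (Kpac R).rightOrthogonal ((qK R).obj (cogenCpx R)) := by
  intro X f hX
  obtain ⟨X, rfl⟩ := HomotopyCategory.quotient_obj_surjective X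
  exact forall_hom_eq_zero_of_iso ((qK R).mapIso (λ_ X))
    ((isPureAcyclic_iff_forall_tensor X).1 hX _) f

variable (R) in
lemma leftOrthogonal_rightOrthogonal_Kpac :
    (Kpac R).rightOrthogonal.leftOrthogonal = Kpac R := by
  ext X
  refine ⟨fun h => ?_, fun h Y f hY => hY f h⟩
  obtain ⟨X, rfl⟩ := HomotopyCategory.quotient_obj_surjective X
  rw [Kpac_qK_iff, isPureAcyclic_iff_forall_tensor]
  exact fun A => forall_hom_eq_zero_of_iso ((qK R).mapIso (β_ X A))
    ((forall_hom_tensor_eq_zero_iff _ _ _).2 fun f =>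
      h f (rightOrthogonal_homCpx A (rightOrthogonal_cogenCpx R)))

variable (R) in
lemma trW_Kpac : (Kpac R).trW = (Kpac R).rightOrthogonal.isLocal := by
  rw [← trW_leftOrthogonal, leftOrthogonal_rightOrthogonal_Kpac]

end

/-! ### Finitely presented modules -/

section

open HomologicalComplex TensorProduct

variable {R : Type u} [CommRing R]

lemma exists_eq_sum_tmul_of_span {ι : Type*} [Fintype ι] {M N : Type*} [AddCommGroup M]
    [Module R M] [AddCommGroup N] [Module R N] {m : ι → M} (hm : Submodule.span R (Set.range m) = ⊤)
    (z : M ⊗[R] N) : ∃ n : ι → N, z = ∑ i, m i ⊗ₜ[R] n i := by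
  induction z with
  | zero => exact ⟨0, by simp⟩
  | add x y hx hy =>
    obtain ⟨a, rfl⟩ := hx
    obtain ⟨b, rfl⟩ := hy
    exact ⟨a + b, by simp [TensorProduct.tmul_add, Finset.sum_add_distrib]⟩
  | tmul x y =>
    obtain ⟨c, rfl⟩ := (Submodule.mem_span_range_iff_exists_fun R).1
      (hm ▸ Submodule.mem_top : x ∈ Submodule.span R (Set.range m))
    exact ⟨fun i => c i • y, by simp [TensorProduct.sum_tmul, TensorProduct.smul_tmul]⟩

/-- The finitely presented module with generators indexed by the columns of a matrix and relations
given by its rows. -/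
def fpMod {k n : ℕ} (a : Fin k → Fin n → R) : ModuleCat.{u} R :=
  ModuleCat.of R ((Fin n → R) ⧸ Submodule.span R (Set.range a))

/-- The generators of the module presented by a matrix. -/
def fpMod.gen {k n : ℕ} (a : Fin k → Fin n → R) (j : Fin n) : fpMod a :=
  (Submodule.span R (Set.range a)).mkQ (Pi.single j 1)

lemma fpMod.mkQ_eq_sum {k n : ℕ} (a : Fin k → Fin n → R) (c : Fin n → R) :
    ((Submodule.span R (Set.range a)).mkQ c : fpMod a) = ∑ j, c j • gen a j := by
  have h : c = ∑ j, c j • (Pi.single j 1 : Fin n → R) := by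
    ext i
    simp [Pi.single_apply]
  refine (congrArg _ h).trans ((map_sum (Submodule.span R (Set.range a)).mkQ _ _).trans ?_)
  exact Finset.sum_congr rfl fun j _ => map_smul _ _ _

lemma fpMod.sum_smul_gen {k n : ℕ} (a : Fin k → Fin n → R) (i : Fin k) :
    ∑ j, a i j • gen a j = 0 := by
  rw [← mkQ_eq_sum a (a i)]
  exact (Submodule.Quotient.mk_eq_zero _).2 (Submodule.subset_span ⟨i, rfl⟩)

lemma fpMod.span_gen {k n : ℕ} (a : Fin k → Fin n → R) :
    Submodule.span R (Set.range (gen a)) = ⊤ := by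
  rw [eq_top_iff]
  intro x _
  obtain ⟨c, rfl⟩ := Submodule.mkQ_surjective _ x
  exact (Submodule.mem_span_range_iff_exists_fun R).2 ⟨c, (mkQ_eq_sum a c).symm⟩

lemma fpMod.exists_hom {k n : ℕ} (a : Fin k → Fin n → R) {M : ModuleCat.{u} R}
    (x : Fin n → M) (hx : ∀ i, ∑ j, a i j • x j = 0) :
    ∃ f : fpMod a ⟶ M, ∀ j, f (gen a j) = x j := by
  let g : (Fin n → R) →ₗ[R] M := Fintype.linearCombination R x
  refine ⟨ModuleCat.ofHom ((Submodule.span R (Set.range a)).liftQ g ?_), fun j => ?_⟩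
  · rw [Submodule.span_le]
    rintro _ ⟨i, rfl⟩
    exact hx i
  · change g (Pi.single j 1) = x j
    simp [g, Fintype.linearCombination_apply_single]

lemma fpMod.hom_ext {k n : ℕ} {a : Fin k → Fin n → R} {M : ModuleCat.{u} R}
    {f g : fpMod a ⟶ M} (h : ∀ j, f (gen a j) = g (gen a j)) : f = g := by
  ext x : 2
  obtain ⟨c, rfl⟩ := Submodule.mkQ_surjective _ x
  rw [mkQ_eq_sum, map_sum, map_sum]
  exact Finset.sum_congr rfl fun j _ => by rw [map_smul, map_smul]; exact congrArg _ (h j)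

lemma sum_tmul_smul_eq_zero {ι : Type*} [Fintype ι] {M N : Type*} [AddCommGroup M] [Module R M]
    [AddCommGroup N] [Module R N] {v : ι → M} {c : ι → R} (h : ∑ i, c i • v i = 0) (w : N) :
    ∑ i, v i ⊗ₜ[R] (c i • w) = 0 := by
  simp only [← TensorProduct.smul_tmul, ← TensorProduct.sum_tmul, h, TensorProduct.zero_tmul]

lemma fpMod.exists_of_sum_gen_tmul_eq_zero {k n : ℕ} (a : Fin k → Fin n → R)
    {M : ModuleCat.{u} R} (u : Fin n → M) (h : ∑ i, gen a i ⊗ₜ[R] u i = 0) :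
    ∃ s : Fin k → M, ∀ i, u i = ∑ j, a j i • s j := by
  obtain ⟨l, c, y, hu, hc⟩ := vanishesTrivially_of_sum_tmul_eq_zero R (span_gen a) h
  have exists_coeff (t : Fin l) : ∃ r : Fin k → R, ∑ j, r j • a j = fun i => c i t := by
    rw [← Submodule.mem_span_range_iff_exists_fun, ← Submodule.Quotient.mk_eq_zero]
    exact (mkQ_eq_sum a _).trans (hc t)
  choose r hr using exists_coeff
  refine ⟨fun j => ∑ t, r t j • y t, fun i => ?_⟩
  rw [hu i]
  simp only [Finset.smul_sum]
  rw [Finset.sum_comm]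
  refine Finset.sum_congr rfl fun t _ => ?_
  rw [← congrFun (hr t) i]
  simp [Finset.sum_smul, smul_smul, mul_comm]

lemma TensorKills.exists_d_eq {X Y : Cpx R} {g : X ⟶ Y}
    (h : TensorKills (fpMod (0 : Fin 0 → Fin 1 → R)) g) {i j k : ℤ} (hi : i + 1 = j)
    (hk : j + 1 = k) (x : X.X j) (hx : X.d j k x = 0) : ∃ y : Y.X i, Y.d i j y = g.f j x := by
  let a : Fin 0 → Fin 1 → R := 0
  obtain ⟨ρ, hρ⟩ := fpMod.exists_hom a
    (M := MonoidalCategoryStruct.tensorUnit (ModuleCat.{u} R)) (fun _ => (1 : R)) (fun i => i.elim0)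
  obtain ⟨y, hy⟩ := h i j k hi hk (fpMod.gen a 0 ⊗ₜ[R] x) (by
    refine (ModuleCat.MonoidalCategory.whiskerLeft_apply _ _ _ _).trans ?_
    rw [hx, TensorProduct.tmul_zero])
  let l (i : ℤ) : fpMod a ⊗ Y.X i ⟶ Y.X i := ρ ▷ Y.X i ≫ (λ_ (Y.X i)).hom
  have hl : l i ≫ Y.d i j = (fpMod a ◁ Y.d i j) ≫ l j := by
    rw [whisker_exchange_assoc, leftUnitor_naturality, Category.assoc]
  have hl' (y : Y.X j) : l j (fpMod.gen a 0 ⊗ₜ[R] y) = y :=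
    (congrArg (fun r : R => r • y) (hρ 0)).trans (one_smul R y)
  exact ⟨l i y, (congr($hl y)).trans ((congrArg (l j) hy).trans (hl' _))⟩

lemma whiskerLeft_sum_tmul {ι : Type*} [Fintype ι] (N : ModuleCat.{u} R) {M M' : ModuleCat.{u} R}
    (f : M ⟶ M') (v : ι → N) (w : ι → M) :
    (N ◁ f) (∑ i, v i ⊗ₜ[R] w i) = ∑ i, v i ⊗ₜ[R] f (w i) :=
  (map_sum (N ◁ f).hom _ _).trans (Finset.sum_congr rfl fun _ _ => rfl)

lemma hom_sum_smul {ι : Type*} [Fintype ι] {M M' : ModuleCat.{u} R} (f : M ⟶ M') (c : ι → R)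
    (w : ι → M) : f (∑ i, c i • w i) = ∑ i, c i • f (w i) :=
  (map_sum f.hom _ _).trans (Finset.sum_congr rfl fun _ _ => map_smul f.hom _ _)

lemma d_apply_d_apply (X : Cpx R) (i j k : ℤ) (x : X.X i) : X.d j k (X.d i j x) = 0 :=
  congr($(X.d_comp_d i j k) x)

lemma d_apply_f_apply {X Y : Cpx R} (g : X ⟶ Y) (i j : ℤ) (x : X.X i) :
    Y.d i j (g.f i x) = g.f j (X.d i j x) :=
  congr($(g.comm i j) x)

lemma TensorKills.exists_sum_smul_d_eq {X Y : Cpx R} {g : X ⟶ Y} {k n : ℕ}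
    {a : Fin k → Fin n → R} (h : TensorKills (fpMod fun j i => a i j) g) {i j l : ℤ}
    (hj : i + 1 = j) (hl : j + 1 = l) (t : Fin k → X.X j) (w : Fin n → X.X l)
    (ht : ∀ r, X.d j l (t r) = ∑ c, a r c • w c) :
    ∃ s : Fin n → Y.X j, ∀ r, ∑ c, a r c • Y.d j l (s c) = ∑ c, a r c • g.f l (w c) := by
  let b : Fin n → Fin k → R := fun c r => a r c
  have cycle : (fpMod b ◁ X.d j l) (∑ r, fpMod.gen b r ⊗ₜ[R] t r) = 0 := by
    rw [whiskerLeft_sum_tmul]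
    simp only [ht, TensorProduct.tmul_sum]
    rw [Finset.sum_comm]
    exact Finset.sum_eq_zero fun c _ => sum_tmul_smul_eq_zero (fpMod.sum_smul_gen b c) (w c)
  obtain ⟨y, hy⟩ := h i j l hj hl _ cycle
  obtain ⟨s', rfl⟩ := exists_eq_sum_tmul_of_span (fpMod.span_gen b) y
  rw [whiskerLeft_sum_tmul, whiskerLeft_sum_tmul] at hy
  obtain ⟨s, hs⟩ := fpMod.exists_of_sum_gen_tmul_eq_zero b
    (fun r => g.f j (t r) - Y.d i j (s' r)) (by
      simp only [TensorProduct.tmul_sub, Finset.sum_sub_distrib]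
      exact sub_eq_zero.2 hy.symm)
  refine ⟨s, fun r => ?_⟩
  rw [← hom_sum_smul, ← hs r, map_sub, d_apply_d_apply, sub_zero, d_apply_f_apply, ht,
    hom_sum_smul]

-- Lift the images of the generators of `fpMod a` along `g₃`; the relations then only hold up to
-- cycles, which bound after `g₂`; after `g₁`, the lifts can be corrected to respect the relations.
lemma homKills_fpMod_of_tensorKills {X₃ X₂ X₁ X₀ : Cpx R} {g₃ : X₃ ⟶ X₂} {g₂ : X₂ ⟶ X₁}
    {g₁ : X₁ ⟶ X₀} (h₃ : ∀ {k n} (a : Fin k → Fin n → R), TensorKills (fpMod a) g₃)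
    (h₂ : ∀ {k n} (a : Fin k → Fin n → R), TensorKills (fpMod a) g₂)
    (h₁ : ∀ {k n} (a : Fin k → Fin n → R), TensorKills (fpMod a) g₁)
    {k n : ℕ} (a : Fin k → Fin n → R) : HomKills (fpMod a) (g₃ ≫ g₂ ≫ g₁) := by
  intro p q r hp hr φ hφ
  have hx (j : Fin n) : X₃.d q r (φ (fpMod.gen a j)) = 0 := congr($hφ (fpMod.gen a j))
  choose w hw using fun j => (h₃ 0).exists_d_eq hp hr (φ (fpMod.gen a j)) (hx j)
  have hv (i : Fin k) : X₂.d p q (∑ j, a i j • w j) = 0 := by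
    rw [hom_sum_smul]
    simp only [hw]
    rw [← hom_sum_smul (g₃.f q), ← hom_sum_smul φ, fpMod.sum_smul_gen, map_zero, map_zero]
  choose t ht using fun i => (h₂ 0).exists_d_eq (show p - 1 + 1 = p by lia) hp _ (hv i)
  obtain ⟨s, hs⟩ := (h₁ _).exists_sum_smul_d_eq (show p - 2 + 1 = p - 1 by lia)
    (show p - 1 + 1 = p by lia) t (fun j => g₂.f p (w j))
    fun i => (ht i).trans (hom_sum_smul _ _ _)
  obtain ⟨ψ, hψ⟩ := fpMod.exists_hom a (M := X₀.X p)
    (fun j => g₁.f p (g₂.f p (w j)) - X₀.d (p - 1) p (s j)) (fun i => by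
      simp only [smul_sub, Finset.sum_sub_distrib]
      exact sub_eq_zero.2 (hs i).symm)
  refine ⟨ψ, fpMod.hom_ext fun j => ?_⟩
  calc X₀.d p q (ψ (fpMod.gen a j))
      = g₁.f q (g₂.f q (X₂.d p q (w j))) := by
        rw [hψ, map_sub, d_apply_d_apply, sub_zero, d_apply_f_apply, d_apply_f_apply]
    _ = g₁.f q (g₂.f q (g₃.f q (φ (fpMod.gen a j)))) := by rw [hw]

lemma HomKills.exists_d_eq {X Y : Cpx R} {g : X ⟶ Y}
    (h : HomKills (fpMod (0 : Fin 0 → Fin 1 → R)) g) {i j k : ℤ} (hi : i + 1 = j)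
    (hk : j + 1 = k) (x : X.X j) (hx : X.d j k x = 0) : ∃ y : Y.X i, Y.d i j y = g.f j x := by
  let a : Fin 0 → Fin 1 → R := 0
  obtain ⟨φ, hφ⟩ := fpMod.exists_hom a (M := X.X j) (fun _ => x) (fun i => i.elim0)
  obtain ⟨ψ, hψ⟩ := h i j k hi hk φ (fpMod.hom_ext fun c =>
    (congrArg (X.d j k) (hφ c)).trans hx)
  exact ⟨ψ (fpMod.gen a 0), (congr($hψ (fpMod.gen a 0))).trans (congrArg (g.f j) (hφ 0))⟩

lemma exists_sum_tmul_of_lTensor_eq_zero {N M M' : Type*} [AddCommGroup M] [Module R M]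
    [AddCommGroup N] [Module R N] [AddCommGroup M'] [Module R M'] (f : M →ₗ[R] M')
    (z : N ⊗[R] M) (hz : f.lTensor N z = 0) :
    ∃ (l k : ℕ) (v : Fin l → N) (x : Fin l → M) (a : Fin l → Fin k → R) (y : Fin k → M'),
      z = ∑ i, v i ⊗ₜ[R] x i ∧ (∀ i, f (x i) = ∑ j, a i j • y j) ∧
        ∀ j, ∑ i, a i j • v i = 0 := by
  obtain ⟨J, hJ, t, rfl⟩ := Submodule.exists_fg_le_eq_rTensor_subtype z
  have hJM' : (J.subtype.rTensor M') (f.lTensor J t) = 0 := by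
    rw [← hz, ← LinearMap.comp_apply, ← LinearMap.comp_apply, LinearMap.rTensor_comp_lTensor,
      LinearMap.lTensor_comp_rTensor]
  obtain ⟨J', hJJ', hJ', hJ'M'⟩ := TensorProduct.eq_zero_of_fg_of_subtype_eq_zero hJ hJM'
  have := Module.Finite.iff_fg.2 hJ'
  obtain ⟨l, v, hv⟩ := Module.Finite.exists_fin (R := R) (M := J')
  obtain ⟨x, hx⟩ := exists_eq_sum_tmul_of_span hv ((Submodule.inclusion hJJ').rTensor M t)
  have sum_eq_zero : ∑ i, v i ⊗ₜ[R] f (x i) = 0 := by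
    rw [← hJ'M', ← LinearMap.comp_apply, LinearMap.rTensor_comp_lTensor,
      ← LinearMap.lTensor_comp_rTensor, LinearMap.comp_apply, hx, map_sum]
    rfl
  obtain ⟨k, a, y, hy, ha⟩ := vanishesTrivially_of_sum_tmul_eq_zero R hv sum_eq_zero
  refine ⟨l, k, fun i => v i, x, a, y, ?_, hy, fun j => ?_⟩
  · rw [show J.subtype = J'.subtype ∘ₗ Submodule.inclusion hJJ' from rfl,
      LinearMap.rTensor_comp_apply, hx, map_sum]
    rfl
  · simpa using congrArg J'.subtype (ha j)

lemma tensorKills_of_homKills_fpMod {X : Cpx R}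
    (h : ∀ {k n : ℕ} (a : Fin k → Fin n → R), HomKills (fpMod a) (𝟙 X)) (N : ModuleCat.{u} R) :
    TensorKills N (𝟙 X) := by
  intro p q r hp hr z hz
  obtain ⟨l, k, v, x, a, y, rfl, hy, hv⟩ := exists_sum_tmul_of_lTensor_eq_zero (X.d q r).hom z hz
  change ∀ i, X.d q r (x i) = ∑ j, a i j • y j at hy
  obtain ⟨φ, hφ⟩ := fpMod.exists_hom a (fun j => X.d r (r + 1) (y j)) (fun i => by
    rw [← hom_sum_smul, ← hy, d_apply_d_apply])
  obtain ⟨ψ, hψ⟩ := h a r (r + 1) (r + 2) rfl (by lia) φ (fpMod.hom_ext fun j =>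
    (congrArg (X.d (r + 1) (r + 2)) (hφ j)).trans (d_apply_d_apply _ _ _ _ _))
  have hψ' (j : Fin k) : X.d r (r + 1) (ψ (fpMod.gen a j)) = X.d r (r + 1) (y j) :=
    (congr($hψ (fpMod.gen a j))).trans (hφ j)
  choose w hw using fun j => (h 0).exists_d_eq hr rfl (y j - ψ (fpMod.gen a j)) (by
    rw [map_sub, hψ', sub_self])
  have cycle (i : Fin l) : X.d q r (x i - ∑ j, a i j • w j) = 0 := by
    rw [map_sub, hy, hom_sum_smul]
    simp only [hw, id_f, ModuleCat.id_apply, smul_sub, Finset.sum_sub_distrib]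
    rw [← hom_sum_smul ψ, fpMod.sum_smul_gen, map_zero, sub_zero, sub_self]
  choose t ht using fun i => (h 0).exists_d_eq hp hr _ (cycle i)
  refine ⟨∑ i, v i ⊗ₜ[R] t i, (whiskerLeft_sum_tmul _ _ _ _).trans ?_⟩
  simp only [ht, id_f, ModuleCat.id_apply, tmul_sub, Finset.sum_sub_distrib, tmul_sum,
    MonoidalCategory.whiskerLeft_id]
  rw [Finset.sum_comm, sub_eq_self]
  exact Finset.sum_eq_zero fun j _ => sum_tmul_smul_eq_zero (hv j) (w j)

lemma isPureAcyclic_iff_homKills_fpMod (X : Cpx R) :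
    IsPureAcyclic X ↔ ∀ {k n : ℕ} (a : Fin k → Fin n → R), HomKills (fpMod a) (𝟙 X) := by
  rw [isPureAcyclic_iff_tensorKills]
  refine ⟨fun h k n a => ?_, tensorKills_of_homKills_fpMod⟩
  simpa only [Category.comp_id] using homKills_fpMod_of_tensorKills (fun b => h (fpMod b))
    (fun b => h (fpMod b)) (fun b => h (fpMod b)) a

lemma exists_iso_fpMod (N : ModuleCat.{u} R) [Module.FinitePresentation R N] :
    ∃ (k n : ℕ) (a : Fin k → Fin n → R), Nonempty (fpMod a ≅ N) := by
  obtain ⟨n, S, e, hS⟩ := Module.FinitePresentation.exists_fin R N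
  obtain ⟨k, a, rfl⟩ := Submodule.fg_iff_exists_fin_generating_family.1 hS
  exact ⟨k, n, a, ⟨e.symm.toModuleIso⟩⟩

instance {k n : ℕ} (a : Fin k → Fin n → R) : Module.FinitePresentation R (fpMod a) := by
  have h_quotient :
      Module.FinitePresentation R ((Fin n → R) ⧸ Submodule.span R (Set.range a)) :=
    Module.finitePresentation_of_surjective (Submodule.span R (Set.range a)).mkQ
      (Submodule.mkQ_surjective _) (by
        rw [Submodule.ker_mkQ]
        exact Submodule.fg_span (Set.finite_range a))
  exact h_quotient

instance (N : ModuleCat.{u} R) [Module.FinitePresentation R N] {k n : ℕ} (a : Fin k → Fin n → R) :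
    Module.FinitePresentation R (N ⊗ fpMod a : ModuleCat.{u} R) := by
  have h_free : Module.FinitePresentation R (N ⊗[R] (Fin n → R)) :=
    .of_equiv (TensorProduct.piScalarRight R R N (Fin n)).symm
  have h_relations : Module.Finite R (Submodule.span R (Set.range a)) :=
    Module.Finite.iff_fg.2 (Submodule.fg_span (Set.finite_range a))
  have h_quotient : Module.FinitePresentation R
      (N ⊗[R] ((Fin n → R) ⧸ Submodule.span R (Set.range a))) := by
    refine Module.finitePresentation_of_surjective
      ((Submodule.span R (Set.range a)).mkQ.lTensor N)
      (LinearMap.lTensor_surjective _ (Submodule.mkQ_surjective _)) ?_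
    rw [(lTensor_exact N (f := (Submodule.span R (Set.range a)).subtype)
      (LinearMap.exact_subtype_mkQ _) (Submodule.mkQ_surjective _)).linearMap_ker_eq,
      LinearMap.range_eq_map]
    exact Submodule.FG.map _ Module.Finite.fg_top
  exact h_quotient

lemma IsPureAcyclic.homKills {X : Cpx R} (hX : IsPureAcyclic X) (N : ModuleCat.{u} R)
    [Module.FinitePresentation R N] : HomKills N (𝟙 X) := by
  obtain ⟨k, n, a, ⟨e⟩⟩ := exists_iso_fpMod N
  exact ((isPureAcyclic_iff_homKills_fpMod X).1 hX a).of_iso e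

instance : Module.FinitePresentation R
    (MonoidalCategoryStruct.tensorUnit (ModuleCat.{u} R) : ModuleCat.{u} R) :=
  inferInstanceAs (Module.FinitePresentation R R)

end

/-! ### K-pure-projective and K-pure-injective complexes -/

section

open HomologicalComplex CochainComplex.HomComplex

variable {R : Type u} [CommRing R]

/-- The nonzero degree of a complex concentrated in degree `m`. -/
def singleXIso (m : ℤ) (F : ModuleCat.{u} R) :
    ((CochainComplex.singleFunctor (ModuleCat.{u} R) m).obj F).X m ≅ F :=
  singleObjXSelf (ComplexShape.up ℤ) m F

/-- The morphism `N ⊗ F ⟶ M^k` attached to a morphism from `N` to the complex `Hom(F, M)`, where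
`F` is seen as a complex concentrated in degree `m`. -/
def singleEval {N F : ModuleCat.{u} R} {M : Cpx R} {m q : ℤ}
    (φ : N ⟶ (homCpx ((CochainComplex.singleFunctor (ModuleCat.{u} R) m).obj F) M).X q) (k : ℤ)
    (h : m + q = k) : N ⊗ F ⟶ M.X k :=
  N ◁ (singleXIso m F).inv ≫
    φ ▷ ((CochainComplex.singleFunctor (ModuleCat.{u} R) m).obj F).X m ≫ homEval _ M q m k h

lemma singleEval_injective {N F : ModuleCat.{u} R} {M : Cpx R} {m q : ℤ} (k : ℤ) (h : m + q = k)
    {φ φ' : N ⟶ (homCpx ((CochainComplex.singleFunctor (ModuleCat.{u} R) m).obj F) M).X q}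
    (hφ : singleEval φ k h = singleEval φ' k h) : φ = φ' := by
  refine hom_hom_ext fun j l hl => ?_
  by_cases h0 : j = m
  · subst h0
    obtain rfl : k = l := by lia
    rw [← cancel_epi (N ◁ (singleXIso j F).inv)]
    exact hφ
  · exact ((tensorLeft N).map_isZero
      (isZero_single_obj_X (ComplexShape.up ℤ) m F j h0)).eq_of_src _ _

lemma singleEval_surjective {N F : ModuleCat.{u} R} {M : Cpx R} {m q : ℤ} (k : ℤ) (h : m + q = k)
    (g : N ⊗ F ⟶ M.X k) :
    ∃ φ : N ⟶ (homCpx ((CochainComplex.singleFunctor (ModuleCat.{u} R) m).obj F) M).X q,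
      singleEval φ k h = g := by
  subst h
  refine ⟨homLift fun j l hl => if hj : j = m then
    eqToHom (by rw [hj]) ≫ N ◁ (singleXIso m F).hom ≫ g ≫
      eqToHom (by rw [← hl, hj]) else 0, ?_⟩
  rw [singleEval, homLift_homEval, dif_pos rfl]
  simp [← whiskerLeft_comp_assoc]

lemma singleEval_d {N F : ModuleCat.{u} R} {M : Cpx R} {m q q' : ℤ} (hq : q + 1 = q')
    (φ : N ⟶ (homCpx ((CochainComplex.singleFunctor (ModuleCat.{u} R) m).obj F) M).X q)
    (k k' : ℤ) (h : m + q = k) (hk : k + 1 = k') :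
    singleEval (φ ≫ (homCpx _ M).d q q') k' (by lia) = singleEval φ k h ≫ M.d k k' := by
  have hd : ((CochainComplex.singleFunctor (ModuleCat.{u} R) m).obj F).d m (m + 1) = 0 :=
    (isZero_single_obj_X (ComplexShape.up ℤ) m F (m + 1) (by lia)).eq_of_tgt _ _
  rw [singleEval, comp_whiskerRight, Category.assoc, homCpx_d_homEval _ _ _ _ hq _ _ _ _ rfl hk h,
    hd, MonoidalPreadditive.whiskerLeft_zero, zero_comp, smul_zero, add_zero]
  simp [singleEval]

lemma HomKills.homCpx_single {N F : ModuleCat.{u} R} {M : Cpx R} (h : HomKills (N ⊗ F) (𝟙 M))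
    (m : ℤ) :
    HomKills N (𝟙 (homCpx ((CochainComplex.singleFunctor (ModuleCat.{u} R) m).obj F) M)) := by
  intro i j k hi hk φ hφ
  obtain ⟨ψ, hψ⟩ := h (m + i) (m + j) (m + k) (by lia) (by lia) (singleEval φ _ rfl) (by
    rw [← singleEval_d hk φ _ _ rfl (by lia), hφ, singleEval,
      MonoidalPreadditive.zero_whiskerRight, zero_comp, comp_zero])
  obtain ⟨ψ, rfl⟩ := singleEval_surjective (m + i) rfl ψ
  refine ⟨ψ, singleEval_injective _ rfl ?_⟩
  rw [singleEval_d hi ψ _ _ rfl (by lia), hψ]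
  simp

lemma IsPureAcyclic.homCpx_single {M : Cpx R} (hM : IsPureAcyclic M) (m : ℤ) {k n : ℕ}
    (a : Fin k → Fin n → R) :
    IsPureAcyclic
      (homCpx ((CochainComplex.singleFunctor (ModuleCat.{u} R) m).obj (fpMod a)) M) :=
  (isPureAcyclic_iff_homKills_fpMod _).2 fun _ => (hM.homKills _).homCpx_single m

lemma isPureAcyclic_iff_forall_single (X : Cpx R) :
    IsPureAcyclic X ↔ ∀ {k n : ℕ} (a : Fin k → Fin n → R) (m : ℤ)
      (f : (qK R).obj ((CochainComplex.singleFunctor (ModuleCat.{u} R) m).obj (fpMod a)) ⟶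
        (qK R).obj X), f = 0 := by
  rw [isPureAcyclic_iff_homKills_fpMod]
  simp only [homKills_iff, CategoryTheory.Functor.map_id, Category.comp_id]

lemma IsPureAcyclic.hom_unit_eq_zero {X : Cpx R} (hX : IsPureAcyclic X)
    (f : (qK R).obj (MonoidalCategoryStruct.tensorUnit (Cpx R)) ⟶ (qK R).obj X) : f = 0 :=
  (hX.homKills (MonoidalCategoryStruct.tensorUnit (ModuleCat.{u} R))).hom_single_eq_zero 0 f

lemma isKPureInjective_iff (I : Cpx R) :
    IsKPureInjective I ↔ (Kpac R).rightOrthogonal ((qK R).obj I) := by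
  constructor
  · intro h X f hX
    obtain ⟨X, rfl⟩ := HomotopyCategory.quotient_obj_surjective X
    refine forall_hom_eq_zero_of_iso ((qK R).mapIso (λ_ X))
      ((forall_hom_tensor_eq_zero_iff _ _ _).2 fun g => ?_) f
    exact (h X hX).hom_unit_eq_zero g
  · intro h X hX
    refine (isPureAcyclic_iff_forall_single _).2 fun a m => ?_
    exact (forall_hom_tensor_eq_zero_iff _ _ _).1 fun f => h f (hX.tensor_left _)

lemma isKPureProjective_iff (P : Cpx R) :
    IsKPureProjective P ↔ (Kpac R).leftOrthogonal ((qK R).obj P) := by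
  constructor
  · intro h X f hX
    obtain ⟨X, rfl⟩ := HomotopyCategory.quotient_obj_surjective X
    refine forall_hom_eq_zero_of_iso ((qK R).mapIso (λ_ P))
      ((forall_hom_tensor_eq_zero_iff _ _ _).2 fun g => ?_) f
    exact (h X hX).hom_unit_eq_zero g
  · intro h X hX
    refine (isPureAcyclic_iff_forall_single _).2 fun a m => ?_
    refine (forall_hom_tensor_eq_zero_iff _ _ _).1 (forall_hom_eq_zero_of_iso
      ((qK R).mapIso (β_ _ _)) ((forall_hom_tensor_eq_zero_iff _ _ _).2 fun f => ?_))
    exact h f (hX.homCpx_single m a)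

variable (R) in
/-- The modules `P` such that `Hom(P, -)` makes every pure acyclic complex acyclic. -/
def LiftsPure : ObjectProperty (ModuleCat.{u} R) :=
  fun P => ∀ M : Cpx R, IsPureAcyclic M → HomKills P (𝟙 M)

instance : (LiftsPure R).IsClosedUnderIsomorphisms where
  of_iso e h M hM := (h M hM).of_iso e

instance {ι : Type*} : (LiftsPure R).IsClosedUnderColimitsOfShape (Discrete ι) where
  colimitsOfShape_le _ := fun ⟨p⟩ M hM i j k hi hk φ hφ => by
    choose ψ hψ using fun t => p.prop_diag_obj t M hM i j k hi hk (p.ι.app t ≫ φ)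
      (by rw [Category.assoc, hφ, comp_zero])
    refine ⟨p.isColimit.desc (Cocone.mk _ (Discrete.natTrans ψ)), p.isColimit.hom_ext fun t => ?_⟩
    rw [p.isColimit.fac_assoc, ← Category.assoc]
    exact hψ t

instance : (LiftsPure R).ContainsZero where
  exists_zero := ⟨_, isZero_zero _, fun _ _ _ _ _ _ _ _ _ => ⟨0, (isZero_zero _).eq_of_src _ _⟩⟩

instance : (LiftsPure R).IsClosedUnderBinaryProducts :=
  isClosedUnderBinaryProducts_of_binaryCoproducts _

lemma LiftsPure.leftOrthogonal_single {P : ModuleCat.{u} R} (h : LiftsPure R P) (m : ℤ) :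
    (Kpac R).leftOrthogonal
      ((qK R).obj ((CochainComplex.singleFunctor (ModuleCat.{u} R) m).obj P)) := by
  intro X f hX
  obtain ⟨X, rfl⟩ := HomotopyCategory.quotient_obj_surjective X
  exact (h X hX).hom_single_eq_zero m f

lemma LiftsPure.isPureProjective {P : ModuleCat.{u} R} (h : LiftsPure R P) : IsPureProjective P :=
  (isKPureProjective_iff _).2 (h.leftOrthogonal_single 0)

lemma liftsPure_of_finitePresentation (N : ModuleCat.{u} R) [Module.FinitePresentation R N] :
    LiftsPure R N :=
  fun _ hM => hM.homKills N

variable (R) in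
/-- The modules `J` such that `Hom(-, J)` makes every pure acyclic complex acyclic. -/
def ExtendsPure : ObjectProperty (ModuleCat.{u} R) :=
  fun J => ∀ X : Cpx R, IsPureAcyclic X → ∀ i j k : ℤ, i + 1 = j → j + 1 = k →
    ∀ g : X.X j ⟶ J, X.d i j ≫ g = 0 → ∃ h : X.X k ⟶ J, X.d j k ≫ h = g

instance : (ExtendsPure R).IsClosedUnderIsomorphisms where
  of_iso e h X hX i j k hi hk g hg := by
    obtain ⟨t, ht⟩ := h X hX i j k hi hk (g ≫ e.inv) (by rw [reassoc_of% hg, zero_comp])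
    exact ⟨t ≫ e.hom, by rw [reassoc_of% ht, e.inv_hom_id, Category.comp_id]⟩

instance {ι : Type*} : (ExtendsPure R).IsClosedUnderLimitsOfShape (Discrete ι) where
  limitsOfShape_le _ := fun ⟨p⟩ X hX i j k hi hk g hg => by
    choose t ht using fun s => p.prop_diag_obj s X hX i j k hi hk (g ≫ p.π.app s)
      (by rw [reassoc_of% hg, zero_comp])
    refine ⟨p.isLimit.lift (Cone.mk _ (Discrete.natTrans t)), p.isLimit.hom_ext fun s => ?_⟩
    rw [Category.assoc, p.isLimit.fac]
    exact ht s

lemma ExtendsPure.isPureInjective {J : ModuleCat.{u} R} (h : ExtendsPure R J) :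
    IsPureInjective J := by
  refine (isKPureInjective_iff _).2 fun X f hX => ?_
  obtain ⟨X, rfl⟩ := HomotopyCategory.quotient_obj_surjective X
  obtain ⟨f, rfl⟩ := (qK R).map_surjective f
  obtain ⟨g, hg⟩ := Cochain.toSingleMk_surjective (Cochain.ofHom f) 0 (add_zero 0)
  have hg' : X.d (-1) 0 ≫ g = 0 := by
    have h_cocycle := δ_ofHom (p := 1) f
    rw [← hg, Cochain.δ_toSingleMk _ _ 1 (-1) (by lia)] at h_cocycle
    simpa using congrArg (Cochain.toSingleEquiv (show (-1 : ℤ) + 1 = 0 by lia)) h_cocycle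
  obtain ⟨k, hk⟩ := h X hX (-1) 0 1 rfl rfl g hg'
  refine (quotient_map_eq_zero_iff_exists_δ f).2
    ⟨Cochain.toSingleMk k (show (1 : ℤ) + -1 = 0 by lia), ?_⟩
  rw [Cochain.δ_toSingleMk _ _ 0 0 (by lia), ← hg, hk]
  simp

lemma IsPureAcyclic.exists_desc {X : Cpx R} (hX : IsPureAcyclic X) (N : ModuleCat.{u} R)
    {i j k : ℤ} (hi : i + 1 = j) (hk : j + 1 = k) (g : N ⊗ X.X j ⟶ cogen R)
    (hg : N ◁ X.d i j ≫ g = 0) : ∃ h : N ⊗ X.X k ⟶ cogen R, N ◁ X.d j k ≫ h = g :=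
  exists_desc_of_acyclic (hX N) hi hk g hg

lemma extendsPure_dualCpx (A : Cpx R) (m : ℤ) : ExtendsPure R ((dualCpx A).X m) := by
  intro X hX i j k hi hk g hg
  have hp : -m + m = 0 := by lia
  have hw {Y Y' : ModuleCat.{u} R} (f : Y ⟶ Y') (φ : Y' ⟶ (dualCpx A).X m) :
      dualEval (f ≫ φ) (-m) hp = f ▷ A.X (-m) ≫ dualEval φ (-m) hp := by
    rw [dualEval, comp_whiskerRight, Category.assoc, dualEval]
  obtain ⟨t, ht⟩ := hX.exists_desc (A.X (-m)) hi hk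
    ((β_ (A.X (-m)) (X.X j)).hom ≫ dualEval g (-m) hp) (by
      rw [BraidedCategory.braiding_naturality_right_assoc, ← hw, hg, dualEval,
        MonoidalPreadditive.zero_whiskerRight, zero_comp, comp_zero])
  obtain ⟨h, hh⟩ := dualEval_surjective (-m) hp ((β_ (X.X k) (A.X (-m))).hom ≫ t)
  refine ⟨h, dualEval_injective (-m) hp ?_⟩
  rw [hw, hh, BraidedCategory.braiding_naturality_left_assoc,
    ← cancel_epi (β_ (A.X (-m)) (X.X j)).hom]
  refine Eq.trans ?_ ht
  exact SymmetricCategory.symmetry_assoc _ _ _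

end

/-! ### Pure projective and pure injective resolutions -/

section

variable {C : Type w} [Category.{v} C]

instance (P : ObjectProperty C) [HasShift C ℤ] [ObjectProperty.EssentiallySmall.{u} P] :
    ObjectProperty.EssentiallySmall.{u} (P.shiftClosure ℤ) :=
  .of_le (Q := ⨆ n : ℤ, P.map (shiftFunctor C n)) fun _ ⟨_, n, e, hY⟩ =>
    (ObjectProperty.prop_iSup_iff _ _).2
      ⟨n, ObjectProperty.prop_of_iso _ e.symm (P.prop_map_obj (shiftFunctor C n) hY)⟩

variable [Preadditive C] {T : C}

lemma IsCompactObject.of_iso {T' : C} (e : T ≅ T') (hT : IsCompactObject.{u} T) :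
    IsCompactObject.{u} T' := by
  intro ι X _ f
  obtain ⟨s, g, hg⟩ := hT X (e.hom ≫ f)
  refine ⟨s, fun i => e.inv ≫ g i, ?_⟩
  rw [← cancel_epi e.hom, hg, Preadditive.comp_sum]
  simp only [Category.assoc, e.hom_inv_id_assoc]

end

lemma isCompactObject_of_finite {S : Type*} [Ring S] (N : ModuleCat.{v} S) [Module.Finite S N] :
    IsCompactObject.{w} N := by
  classical
  intro ι X _ f
  let F (i : ι) : Submodule S (∐ X : ModuleCat.{v} S) := LinearMap.range (Sigma.ι X i).hom
  have hF : ModuleCat.ofHom (⨆ i, F i).mkQ = 0 := Sigma.hom_ext _ _ fun i => by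
    ext y
    exact (Submodule.Quotient.mk_eq_zero _).2 (Submodule.mem_iSup_of_mem i ⟨y, rfl⟩)
  obtain ⟨s, hs⟩ : ∃ s : Finset ι, LinearMap.range f.hom ≤ ⨆ i ∈ s, F i := by
    refine CompleteLattice.IsCompactElement.exists_finset_of_le_iSup _
      ((Submodule.fg_iff_compact _).1 (Module.Finite.iff_fg.1 (Module.Finite.range f.hom))) F
      fun x _ => (Submodule.Quotient.mk_eq_zero _).1 congr($hF x)
  let r : ∐ X ⟶ ∐ X := ∑ i ∈ s, Sigma.π X i ≫ Sigma.ι X i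
  have hr : ⨆ i ∈ s, F i ≤ LinearMap.eqLocus r.hom LinearMap.id := by
    refine iSup₂_le fun i hi => ?_
    rintro _ ⟨y, rfl⟩
    have hi' : Sigma.ι X i ≫ r = Sigma.ι X i := by
      rw [Preadditive.comp_sum, Finset.sum_eq_single_of_mem i hi, Sigma.ι_π_eq_id_assoc]
      intro j _ hj
      rw [Sigma.ι_π_of_ne_assoc X hj.symm, zero_comp]
    exact congr($hi' y)
  refine ⟨s, fun i => f ≫ Sigma.π X i, ?_⟩
  simp only [Category.assoc, ← Preadditive.comp_sum]
  ext x
  exact (hr (hs ⟨x, rfl⟩)).symm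

section

open CochainComplex

variable {V : Type w} [Category.{v} V] [Preadditive V] [HasZeroObject V] [HasCoproducts.{u} V]

lemma IsCompactObject.single {N : V} (hN : IsCompactObject.{u} N) (m : ℤ) :
    IsCompactObject.{u} ((toK V).obj ((singleFunctor V m).obj N)) := by
  classical
  intro ι X _ f
  obtain ⟨Z, rfl⟩ : ∃ Z : ι → CochainComplex V ℤ, X = fun i => (toK V).obj (Z i) :=
    ⟨fun i => (X i).as, rfl⟩
  let e : ∐ (fun i => (toK V).obj (Z i)) ≅ (toK V).obj (∐ Z) :=
    (coproductIsCoproduct _).coconePointUniqueUpToIso (quotientSigmaIsColimit Z)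
  have he (i) : (toK V).map (Sigma.ι Z i) ≫ e.inv = Sigma.ι (fun i => (toK V).obj (Z i)) i :=
    (coproductIsCoproduct _).comp_coconePointUniqueUpToIso_inv (quotientSigmaIsColimit Z) ⟨i⟩
  obtain ⟨v, hv⟩ : ∃ v, (toK V).map v = f ≫ e.hom := (toK V).map_surjective _
  have hN' : IsCompactObject.{u} (((singleFunctor V m).obj N).X m) :=
    hN.of_iso (HomologicalComplex.singleObjXSelf (ComplexShape.up ℤ) m N).symm
  obtain ⟨s, hs⟩ := hN'.exists_eq_sum_comp_comp_inj (sigmaXIsColimit Z m)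
    (p := fun i => (Sigma.π Z i).f m)
    (fun i => congr(HomologicalComplex.Hom.f $(Sigma.ι_π_eq_id Z i) m))
    (fun i j hij => congr(HomologicalComplex.Hom.f $(Sigma.ι_π_of_ne Z hij) m)) (v.f m)
  have hv' : v = ∑ i ∈ s, v ≫ Sigma.π Z i ≫ Sigma.ι Z i :=
    HomologicalComplex.from_single_hom_ext (hs.trans
      ((HomologicalComplex.eval V (ComplexShape.up ℤ) m).map_sum
        (fun i => v ≫ Sigma.π Z i ≫ Sigma.ι Z i) s).symm)
  refine ⟨s, fun i => (toK V).map (v ≫ Sigma.π Z i), ?_⟩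
  rw [← cancel_mono e.hom, ← hv, Preadditive.sum_comp]
  conv_lhs => rw [hv', Functor.map_sum]
  refine Finset.sum_congr rfl fun i _ => ?_
  rw [← he, Category.assoc, Category.assoc, e.inv_hom_id, Category.comp_id, ← Functor.map_comp,
    Category.assoc]

end

section

variable {C : Type w} [Category.{v} C] (P Q : ObjectProperty C) (J : Type*) [Category* J]

instance [P.IsClosedUnderColimitsOfShape J] [Q.IsClosedUnderColimitsOfShape J] :
    (P ⊓ Q).IsClosedUnderColimitsOfShape J where
  colimitsOfShape_le := fun _ ⟨p⟩ =>
    ⟨P.prop_of_isColimit p.isColimit fun j => (p.prop_diag_obj j).1,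
      Q.prop_of_isColimit p.isColimit fun j => (p.prop_diag_obj j).2⟩

instance [P.IsClosedUnderLimitsOfShape J] [Q.IsClosedUnderLimitsOfShape J] :
    (P ⊓ Q).IsClosedUnderLimitsOfShape J where
  limitsOfShape_le := fun _ ⟨p⟩ =>
    ⟨P.prop_of_isLimit p.isLimit fun j => (p.prop_diag_obj j).1,
      Q.prop_of_isLimit p.isLimit fun j => (p.prop_diag_obj j).2⟩

end

section

open CochainComplex

variable (R : Type u) [CommRing R]

/-- The shifts in `K(R)` of the finitely presented modules. -/
def finPresSingle : ObjectProperty (K R) := fun T =>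
  ∃ (k n : ℕ) (a : Fin k → Fin n → R) (m : ℤ),
    Nonempty (T ≅ (qK R).obj ((singleFunctor (ModuleCat.{u} R) m).obj (fpMod a)))

instance : ObjectProperty.EssentiallySmall.{u} (finPresSingle R) :=
  .of_le (Q := (ObjectProperty.ofObj fun i : (Σ k n : ℕ, Fin k → Fin n → R) × ℤ =>
    (qK R).obj ((singleFunctor (ModuleCat.{u} R) i.2).obj (fpMod i.1.2.2))).isoClosure)
    fun _ ⟨k, n, a, m, ⟨e⟩⟩ => ⟨_, ObjectProperty.ofObj_apply _ (⟨k, n, a⟩, m), ⟨e⟩⟩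

instance : (finPresSingle R).IsStableUnderShift ℤ where
  isStableUnderShiftBy j := ⟨fun _ ⟨k, n, a, m, ⟨e⟩⟩ => ⟨k, n, a, m - j,
    ⟨(CategoryTheory.shiftFunctor (K R) j).mapIso e ≪≫ ((qK R).commShiftIso j).symm.app _ ≪≫
      (qK R).mapIso (((singleFunctors (ModuleCat.{u} R)).shiftIso j (m - j) m (by lia)).app _)⟩⟩⟩

variable {R}

lemma isCompactObject_of_finPresSingle {T : K R} (hT : finPresSingle R T) :
    IsCompactObject.{0} T := by
  obtain ⟨k, n, a, m, ⟨e⟩⟩ := hT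
  have : HasCoproducts.{0} (ModuleCat.{u} R) := hasCoproducts_shrink.{0, u}
  exact ((isCompactObject_of_finite (fpMod a)).single m).of_iso e.symm

variable (R)

lemma rightOrthogonal_finPresSingle : (finPresSingle R).rightOrthogonal = Kpac R := by
  ext X
  obtain ⟨X, rfl⟩ := HomotopyCategory.quotient_obj_surjective X
  rw [Kpac_qK_iff, isPureAcyclic_iff_forall_single]
  refine ⟨fun h k n a m f => h f ⟨k, n, a, m, ⟨Iso.refl _⟩⟩, ?_⟩
  rintro h T f ⟨k, n, a, m, ⟨e⟩⟩
  rw [← cancel_epi e.inv, comp_zero]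
  exact h a m _

/-- The objects of `K(R)` represented by a K-pure-projective complex of pure projective modules. -/
abbrev Kproj : ObjectProperty (K R) :=
  termwise (LiftsPure R) ⊓ (Kpac R).leftOrthogonal

/-- The objects of `K(R)` represented by a K-pure-injective complex of pure injective modules. -/
abbrev Kinj : ObjectProperty (K R) :=
  termwise (ExtendsPure R) ⊓ (Kpac R).rightOrthogonal

instance : (Kproj R).IsTriangulatedClosed₃ := isTriangulatedClosed₃_inf _ _

instance : (Kinj R).IsTriangulatedClosed₁ :=
  have : (Kinj R).IsTriangulatedClosed₃ := isTriangulatedClosed₃_inf _ _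
  isTriangulatedClosed₁_of_isStableUnderShift _

lemma finPresSingle_le_Kproj : finPresSingle R ≤ Kproj R := by
  rintro T ⟨k, n, a, m, ⟨e⟩⟩
  have h : LiftsPure R (fpMod a) := liftsPure_of_finitePresentation _
  exact ObjectProperty.prop_of_iso _ e.symm ⟨termwise_single _ h m, h.leftOrthogonal_single m⟩

/-- The shifts in `K(R)` of the character complexes of the finitely presented modules. -/
def finPresDual : ObjectProperty (K R) :=
  (ObjectProperty.ofObj fun i : (Σ k n : ℕ, Fin k → Fin n → R) × ℤ =>
    (qK R).obj (dualCpx ((singleFunctor (ModuleCat.{u} R) i.2).obj (fpMod i.1.2.2)))).shiftClosure ℤ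

instance : ObjectProperty.EssentiallySmall.{u} (finPresDual R) := by
  unfold finPresDual
  infer_instance

instance : (finPresDual R).IsStableUnderShift ℤ := by
  unfold finPresDual
  infer_instance

lemma finPresDual_le_Kinj : finPresDual R ≤ Kinj R := by
  rw [finPresDual, ObjectProperty.shiftClosure_le_iff, ObjectProperty.ofObj_le_iff]
  exact fun i => ⟨⟨_, ⟨Iso.refl _⟩, fun _ => extendsPure_dualCpx _ _⟩,
    rightOrthogonal_homCpx _ (rightOrthogonal_cogenCpx R)⟩

variable {R}

lemma homCpxMap_id_id (B C : Cpx R) : homCpxMap (𝟙 B) (𝟙 C) = 𝟙 _ := by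
  ext n : 1
  refine hom_hom_ext fun j k h => ?_
  rw [homCpxMap_homEval]
  simp

lemma tensorKills_of_ghost {X Y : Cpx R} {g : X ⟶ Y} (hg : ghost (finPresDual R) ((qK R).map g))
    {k n : ℕ} (a : Fin k → Fin n → R) : TensorKills (fpMod a) g := by
  refine tensorKills_of_homKills ((homKills_iff _ _).2 fun m f => ?_)
  obtain ⟨f, rfl⟩ := (qK R).map_surjective f
  obtain ⟨h, rfl⟩ := (tensorHomEquiv _ _ _).surjective f
  let F : Cpx R := (singleFunctor (ModuleCat.{u} R) m).obj (fpMod a)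
  have hF : finPresDual R ((qK R).obj (dualCpx F)) :=
    ObjectProperty.le_shiftClosure _ _
      (ObjectProperty.ofObj_apply _ ((⟨k, n, a⟩, m) : (Σ k n : ℕ, Fin k → Fin n → R) × ℤ))
  have h_swap : (qK R).map ((g ⊗ₘ 𝟙 F) ≫ ((β_ Y F).hom ≫ h) ≫ 𝟙 _) = 0 := by
    rw [← quotient_map_tensorHomEquiv_eq_zero_iff, tensorHomEquiv_naturality, homCpxMap_id_id,
      Category.comp_id, Functor.map_comp]
    exact hg hF _
  have h_zero : (qK R).map ((𝟙 F ⊗ₘ g) ≫ h ≫ 𝟙 _) = 0 := by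
    rw [← cancel_epi ((qK R).map (β_ X F).hom), comp_zero, ← h_swap, ← Functor.map_comp]
    simp
  rw [← quotient_map_tensorHomEquiv_eq_zero_iff, tensorHomEquiv_naturality,
    Category.id_comp] at h_zero
  rw [← Functor.map_comp]
  exact h_zero

lemma comp_ghostPow_eq_zero {X Y : K R} {c : X ⟶ Y} (hc : ghostPow (finPresDual R) 3 c) {T : K R}
    (hT : finPresSingle R T) (x : T ⟶ X) : x ≫ c = 0 := by
  obtain ⟨X₂, f₃, _, h₃, ⟨X₁, f₂, _, h₂, ⟨X₀, f₁, f₀, h₁, -, rfl⟩, rfl⟩, rfl⟩ := hc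
  obtain ⟨X, rfl⟩ := HomotopyCategory.quotient_obj_surjective X
  obtain ⟨X₂, rfl⟩ := HomotopyCategory.quotient_obj_surjective X₂
  obtain ⟨X₁, rfl⟩ := HomotopyCategory.quotient_obj_surjective X₁
  obtain ⟨X₀, rfl⟩ := HomotopyCategory.quotient_obj_surjective X₀
  obtain ⟨f₃, rfl⟩ := (qK R).map_surjective f₃
  obtain ⟨f₂, rfl⟩ := (qK R).map_surjective f₂
  obtain ⟨f₁, rfl⟩ := (qK R).map_surjective f₁
  obtain ⟨k, n, a, m, ⟨e⟩⟩ := hT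
  have h := (homKills_iff _ _).1 (homKills_fpMod_of_tensorKills (tensorKills_of_ghost h₃)
    (tensorKills_of_ghost h₂) (tensorKills_of_ghost h₁) a) m (e.inv ≫ x)
  simp only [Functor.map_comp, Category.assoc] at h
  rw [← cancel_epi e.inv, comp_zero]
  simp only [reassoc_of% h, zero_comp]

lemma trW_quotient_map_iff {X Y : Cpx R} (f : X ⟶ Y) :
    (Kpac R).trW ((qK R).map f) ↔ IsPureQuasiIso f :=
  ObjectProperty.trW_iff_of_distinguished _ _
    (HomotopyCategory.mappingCone_triangleh_distinguished f)

lemma trW_of_isColocal_finPresSingle {X Y : K R} {v : X ⟶ Y} (hv : (finPresSingle R).isColocal v) :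
    (Kpac R).trW v := by
  rwa [← rightOrthogonal_finPresSingle, trW_rightOrthogonal]

theorem nonempty_pureProjectiveResolution (M : Cpx R) : Nonempty (PureProjectiveResolution M) := by
  obtain ⟨X, v, ⟨⟨P, ⟨e⟩, hP⟩, hP'⟩, hv⟩ := exists_isColocal_of_isCompactObject (finPresSingle R)
    (Kproj R) (finPresSingle_le_Kproj R) (fun _ => isCompactObject_of_finPresSingle) ((qK R).obj M)
  obtain ⟨f, hf⟩ := (qK R).map_surjective (e.inv ≫ v)
  refine ⟨⟨P, f, fun i => (hP i).isPureProjective, (trW_quotient_map_iff f).1 ?_,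
    (isKPureProjective_iff P).2 (ObjectProperty.prop_of_iso _ e hP')⟩⟩
  rw [hf]
  exact MorphismProperty.RespectsIso.precomp _ _ _ (trW_of_isColocal_finPresSingle hv)

theorem nonempty_pureInjectiveResolution (N : Cpx R) : Nonempty (PureInjectiveResolution N) := by
  obtain ⟨X, v, ⟨⟨I, ⟨e⟩, hI⟩, hI'⟩, hv⟩ := exists_isColocal_of_ghostPow (finPresSingle R)
    (finPresDual R) (Kinj R) (finPresDual_le_Kinj R)
    (fun _ _ _ hc _ hT => comp_ghostPow_eq_zero hc hT) ((qK R).obj N)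
  obtain ⟨f, hf⟩ := (qK R).map_surjective (v ≫ e.hom)
  refine ⟨⟨I, f, fun i => (hI i).isPureInjective, (trW_quotient_map_iff f).1 ?_,
    (isKPureInjective_iff I).2 (ObjectProperty.prop_of_iso _ e hI')⟩⟩
  rw [hf]
  exact MorphismProperty.RespectsIso.postcomp _ _ _ (trW_of_isColocal_finPresSingle hv)

end

/-! ### The symmetric monoidal structure of the pure derived category -/

section

variable {R : Type u} [CommRing R]

/-- The tensor-Hom adjunction in the homotopy category, induced by the one for complexes. -/
def quotientTensorHomEquiv (A B C : Cpx R) :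
    ((qK R).obj (A ⊗ B) ⟶ (qK R).obj C) ≃ ((qK R).obj A ⟶ (qK R).obj (homCpx B C)) where
  toFun f := (qK R).map (tensorHomEquiv A B C ((qK R).preimage f))
  invFun g := (qK R).map ((tensorHomEquiv A B C).symm ((qK R).preimage g))
  left_inv f := by
    rw [← (qK R).map_preimage f, ← quotient_map_tensorHomEquiv_eq_iff]
    simp only [Equiv.apply_symm_apply, Functor.map_preimage]
  right_inv g := by
    conv_rhs => rw [← (qK R).map_preimage g, ← (tensorHomEquiv A B C).apply_symm_apply
      ((qK R).preimage g)]
    rw [quotient_map_tensorHomEquiv_eq_iff, Functor.map_preimage]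

lemma quotientTensorHomEquiv_map {A B C : Cpx R} (f : A ⊗ B ⟶ C) :
    quotientTensorHomEquiv A B C ((qK R).map f) = (qK R).map (tensorHomEquiv A B C f) :=
  (quotient_map_tensorHomEquiv_eq_iff _ _).2 ((qK R).map_preimage _)

lemma tensorHomEquiv_whiskerRight {A A' B C : Cpx R} (a : A' ⟶ A) (f : A ⊗ B ⟶ C) :
    tensorHomEquiv A' B C (a ▷ B ≫ f) = a ≫ tensorHomEquiv A B C f := by
  have h := tensorHomEquiv_naturality a (𝟙 B) (𝟙 C) f
  rwa [homCpxMap_id_id, Category.comp_id, Category.comp_id, MonoidalCategory.tensorHom_id] at h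

lemma quotientTensorHomEquiv_whiskerRight {A A' B C : Cpx R} (a : A' ⟶ A)
    (f : (qK R).obj (A ⊗ B) ⟶ (qK R).obj C) :
    quotientTensorHomEquiv A' B C ((qK R).map (a ▷ B) ≫ f) =
      (qK R).map a ≫ quotientTensorHomEquiv A B C f := by
  obtain ⟨f, rfl⟩ := (qK R).map_surjective f
  rw [← Functor.map_comp, quotientTensorHomEquiv_map, quotientTensorHomEquiv_map,
    tensorHomEquiv_whiskerRight, Functor.map_comp]

variable (R) in
/-- The pure quasi-isomorphisms, as the class of morphisms of complexes that `D_pur(R)` inverts. -/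
def pureQuasiIso : MorphismProperty (Cpx R) := (Kpac R).trW.inverseImage (qK R)

lemma pureQuasiIso_iff {X Y : Cpx R} (f : X ⟶ Y) : pureQuasiIso R f ↔ IsPureQuasiIso f :=
  trW_quotient_map_iff f

instance : (pureQuasiIso R).IsMultiplicative :=
  inferInstanceAs ((Kpac R).trW.inverseImage (qK R)).IsMultiplicative

instance : (pureQuasiIso R).RespectsIso :=
  inferInstanceAs ((Kpac R).trW.inverseImage (qK R)).RespectsIso

instance : (Q R).IsLocalization (pureQuasiIso R) := by
  refine Functor.IsLocalization.comp (qK R) (Qh R)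
    (HomologicalComplex.homotopyEquivalences _ _) (Kpac R).trW (pureQuasiIso R) ?_ ?_ ?_
  · intro X Y f hf
    exact Localization.inverts (Qh R) (Kpac R).trW _ hf
  · intro X Y f hf
    have : IsIso ((qK R).map f) :=
      Localization.inverts (qK R) (HomologicalComplex.homotopyEquivalences _ _) f hf
    exact ObjectProperty.trW_of_isIso _ _
  · intro X Y f hf
    obtain ⟨X, rfl⟩ := HomotopyCategory.quotient_obj_surjective X
    obtain ⟨Y, rfl⟩ := HomotopyCategory.quotient_obj_surjective Y
    obtain ⟨f, rfl⟩ := (qK R).map_surjective f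
    exact MorphismProperty.map_mem_map _ _ _ hf

lemma isIso_Q_map {X Y : Cpx R} {f : X ⟶ Y} (hf : IsPureQuasiIso f) : IsIso ((Q R).map f) :=
  Localization.inverts (Q R) (pureQuasiIso R) f ((pureQuasiIso_iff f).2 hf)

lemma Q_obj_surjective : Function.Surjective (Q R).obj := fun X => by
  obtain ⟨Y, rfl⟩ := (Localization.Construction.objEquiv (Kpac R).trW).surjective X
  obtain ⟨Y, rfl⟩ := HomotopyCategory.quotient_obj_surjective Y
  exact ⟨Y, rfl⟩

lemma pureQuasiIso.whiskerRight {X₁ X₂ : Cpx R} {f : X₁ ⟶ X₂} (hf : pureQuasiIso R f)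
    (Y : Cpx R) : pureQuasiIso R (f ▷ Y) := by
  have hf' : (Kpac R).rightOrthogonal.isLocal ((qK R).map f) := by rwa [← trW_Kpac]
  change (Kpac R).trW _
  rw [trW_Kpac]
  intro I hI
  obtain ⟨I, rfl⟩ := HomotopyCategory.quotient_obj_surjective I
  have h_comp := (hf' _ (rightOrthogonal_homCpx Y hI)).comp
    (quotientTensorHomEquiv X₂ Y I).bijective
  rw [← (quotientTensorHomEquiv X₁ Y I).comp_bijective]
  convert h_comp using 1
  exact funext (quotientTensorHomEquiv_whiskerRight f)

instance : (pureQuasiIso R).IsMonoidal where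
  whiskerRight _ hf Y := hf.whiskerRight Y
  whiskerLeft X Y₁ Y₂ g hg := by
    refine ((pureQuasiIso R).arrow_mk_iso_iff ?_).1 (hg.whiskerRight X)
    exact Arrow.isoMk (β_ _ _) (β_ _ _) (BraidedCategory.braiding_naturality_left g X).symm

variable (R) in
/-- The pure derived category, with the tensor product inherited from the category of complexes. -/
abbrev LocDpur : Type (u + 1) := LocalizedMonoidal (Q R) (pureQuasiIso R) (Iso.refl _)

instance : MonoidalCategory (Dpur R) := inferInstanceAs (MonoidalCategory (LocDpur R))

instance : SymmetricCategory (Dpur R) := inferInstanceAs (SymmetricCategory (LocDpur R))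

instance : (Q R).Monoidal :=
  inferInstanceAs
    (Localization.Monoidal.toMonoidalCategory (Q R) (pureQuasiIso R) (Iso.refl _)).Monoidal

lemma Q_μ_koszulBraiding (A B : Cpx R) :
    Functor.LaxMonoidal.μ (Q R) A B ≫ (Q R).map (koszulBraiding A B) =
      (β_ ((Q R).obj A) ((Q R).obj B)).hom ≫ Functor.LaxMonoidal.μ (Q R) B A :=
  Functor.LaxBraided.braided
    (F := Localization.Monoidal.toMonoidalCategory (Q R) (pureQuasiIso R) (Iso.refl _)) A B

lemma Q_map_surjective (X : Cpx R) {I : Cpx R} (hI : IsKPureInjective I) :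
    Function.Surjective ((Q R).map : (X ⟶ I) → _) :=
  (ObjectProperty.rightOrthogonal.map_bijective_of_isTriangulated
    ((isKPureInjective_iff I).1 hI) (Qh R) ((qK R).obj X)).2.comp (qK R).map_surjective

lemma Q_map_eq_iff {X I : Cpx R} (hI : IsKPureInjective I) (f g : X ⟶ I) :
    (Q R).map f = (Q R).map g ↔ (qK R).map f = (qK R).map g :=
  (ObjectProperty.rightOrthogonal.map_bijective_of_isTriangulated
    ((isKPureInjective_iff I).1 hI) (Qh R) ((qK R).obj X)).1.eq_iff

lemma IsKPureInjective.homCpx {I : Cpx R} (hI : IsKPureInjective I) (A : Cpx R) :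
    IsKPureInjective (homCpx A I) :=
  (isKPureInjective_iff _).2 (rightOrthogonal_homCpx A ((isKPureInjective_iff I).1 hI))

end

/-! ### Internal Homs in braided monoidal categories -/

section

open MonoidalClosed

variable {D : Type w} [Category.{v} D] [MonoidalCategory D]

/-- A morphism `E ⊗ B ⟶ C` is an evaluation if it exhibits `E` as an internal Hom from `B` to
`C`. -/
def IsEvaluation {B C E : D} (ev : E ⊗ B ⟶ C) : Prop :=
  ∀ A : D, Function.Bijective (fun g : A ⟶ E => g ▷ B ≫ ev)

/-- The action of the internal Hom on morphisms. -/
abbrev ihomMap [MonoidalClosed D] {B B' C C' : D} (b : B' ⟶ B) (c : C ⟶ C') :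
    (internalHom.obj (op B)).obj C ⟶ (internalHom.obj (op B')).obj C' :=
  (internalHom.map b.op).app C ≫ (internalHom.obj (op B')).map c

lemma ihomMap_id_id [MonoidalClosed D] (B C : D) : ihomMap (𝟙 B) (𝟙 C) = 𝟙 _ := by
  change (pre (𝟙 B)).app C ≫ (ihom B).map (𝟙 C) = 𝟙 ((ihom B).obj C)
  rw [pre_id, CategoryTheory.Functor.map_id, NatTrans.id_app, Category.comp_id]

variable [BraidedCategory D]

lemma whiskerRight_eq_braiding_conj (A : D) {B C : D} (f : B ⟶ C) :
    f ▷ A = (β_ B A).hom ≫ A ◁ f ≫ (β_ C A).inv := by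
  simp

lemma monoidalPreadditive_of_tensorLeft_additive [Preadditive D]
    [∀ A : D, (tensorLeft A).Additive] : MonoidalPreadditive D where
  whiskerLeft_zero {A _ _} := (tensorLeft A).map_zero _ _
  whiskerLeft_add {A _ _} _ _ := (tensorLeft A).map_add
  zero_whiskerRight {A _ _} := by
    rw [whiskerRight_eq_braiding_conj, show A ◁ 0 = 0 from (tensorLeft A).map_zero _ _, zero_comp,
      comp_zero]
  add_whiskerRight {A _ _} f g := by
    simp only [whiskerRight_eq_braiding_conj, Preadditive.add_comp, Preadditive.comp_add,
      show A ◁ (f + g) = A ◁ f + A ◁ g from (tensorLeft A).map_add]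

lemma monoidalLinear_of_tensorLeft_linear (S : Type*) [CommRing S] [Preadditive D] [Linear S D]
    [MonoidalPreadditive D] [∀ A : D, (tensorLeft A).Linear S] : MonoidalLinear S D where
  whiskerLeft_smul A _ _ r f := (tensorLeft A).map_smul r f
  smul_whiskerRight r _ _ f A := by
    simp only [whiskerRight_eq_braiding_conj, Linear.smul_comp, Linear.comp_smul,
      show A ◁ (r • f) = r • A ◁ f from (tensorLeft A).map_smul r f]

/-- The bijection `(B ⊗ A ⟶ C) ≃ (A ⟶ E)` attached to an evaluation `E ⊗ B ⟶ C`. -/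
def IsEvaluation.homEquiv {B C E : D} {ev : E ⊗ B ⟶ C} (h : IsEvaluation ev) (A : D) :
    (B ⊗ A ⟶ C) ≃ (A ⟶ E) :=
  ((Equiv.ofBijective _ (h A)).trans
    (Iso.homCongr (β_ A B) (Iso.refl C))).symm

lemma IsEvaluation.homEquiv_symm_apply {B C E : D} {ev : E ⊗ B ⟶ C} (h : IsEvaluation ev) {A : D}
    (g : A ⟶ E) : (h.homEquiv A).symm g = (β_ A B).inv ≫ g ▷ B ≫ ev := by
  simp [homEquiv, Iso.homCongr]

lemma IsEvaluation.homEquiv_naturality {B C E : D} {ev : E ⊗ B ⟶ C} (h : IsEvaluation ev)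
    {A A' : D} (a : A' ⟶ A) (f : B ⊗ A ⟶ C) :
    h.homEquiv A' (B ◁ a ≫ f) = a ≫ h.homEquiv A f := by
  obtain ⟨g, rfl⟩ := (h.homEquiv A).symm.surjective f
  rw [Equiv.apply_symm_apply, ← Equiv.eq_symm_apply, homEquiv_symm_apply, homEquiv_symm_apply,
    BraidedCategory.braiding_inv_naturality_right_assoc, comp_whiskerRight, Category.assoc]

lemma IsEvaluation.homEquiv_whiskerRight_comp {B C E : D} {ev : E ⊗ B ⟶ C} (h : IsEvaluation ev)
    {A : D} (f : B ⊗ A ⟶ C) : h.homEquiv A f ▷ B ≫ ev = (β_ A B).hom ≫ f := by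
  rw [← Iso.inv_comp_eq, ← h.homEquiv_symm_apply, Equiv.symm_apply_apply]

/-- The closed structure on `B` given by evaluations from `B` to all objects. -/
@[reducible]
def closedOfEvaluation {B : D} {E : D → D} {ev : ∀ C, E C ⊗ B ⟶ C}
    (h : ∀ C, IsEvaluation (ev C)) : Closed B where
  rightAdj := Adjunction.rightAdjointOfEquiv (F := tensorLeft B) (fun A C => (h C).homEquiv A)
    (fun _ _ _ a f => (h _).homEquiv_naturality a f)
  adj := Adjunction.adjunctionOfEquivRight _ _

/-- The comparison between the internal Hom of a closed object and the source of an evaluation. -/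
def IsEvaluation.iso {B C E : D} [Closed B] {ev : E ⊗ B ⟶ C} (h : IsEvaluation ev) :
    (ihom B).obj C ≅ E where
  hom := h.homEquiv _ ((ihom.ev B).app C)
  inv := curry ((β_ E B).inv ≫ ev)
  hom_inv_id := by
    refine uncurry_injective ?_
    rw [uncurry_natural_left, uncurry_curry,
      BraidedCategory.braiding_inv_naturality_right_assoc, h.homEquiv_whiskerRight_comp,
      Iso.inv_hom_id_assoc, uncurry_id_eq_ev]
  inv_hom_id := by
    refine (h _).1 ?_
    dsimp only
    rw [comp_whiskerRight, Category.assoc, h.homEquiv_whiskerRight_comp,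
      BraidedCategory.braiding_naturality_left_assoc, whiskerLeft_curry_ihom_ev_app,
      Iso.hom_inv_id_assoc, id_whiskerRight, Category.id_comp]

lemma IsEvaluation.iso_hom_whiskerRight_comp {B C E : D} [Closed B] {ev : E ⊗ B ⟶ C}
    (h : IsEvaluation ev) :
    h.iso.hom ▷ B ≫ ev = (β_ ((ihom B).obj C) B).hom ≫ (ihom.ev B).app C :=
  h.homEquiv_whiskerRight_comp _

lemma IsEvaluation.iso_naturality {B C E B' C' E' : D} [Closed B] [Closed B'] {ev : E ⊗ B ⟶ C}
    (h : IsEvaluation ev) {ev' : E' ⊗ B' ⟶ C'} (h' : IsEvaluation ev')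
    (b : B' ⟶ B) (c : C ⟶ C') (e : E ⟶ E') (he : e ▷ B' ≫ ev' = E ◁ b ≫ ev ≫ c) :
    ((pre b).app C ≫ (ihom B').map c) ≫ h'.iso.hom = h.iso.hom ≫ e := by
  refine (h' _).1 ?_
  dsimp only
  simp only [comp_whiskerRight, Category.assoc]
  rw [he, h'.iso_hom_whiskerRight_comp, ← whisker_exchange_assoc,
    reassoc_of% h.iso_hom_whiskerRight_comp, BraidedCategory.braiding_naturality_left_assoc,
    BraidedCategory.braiding_naturality_left_assoc,
    BraidedCategory.braiding_naturality_right_assoc, ihom.ev_naturality,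
    id_tensor_pre_app_comp_ev_assoc]

variable [MonoidalClosed D]

/-- The adjunction `Hom (A ⊗ B, C) ≃ Hom (A, Hom (B, C))`. -/
def tensorIhomEquiv (A B C : D) : (A ⊗ B ⟶ C) ≃ (A ⟶ (internalHom.obj (op B)).obj C) :=
  (Iso.homCongr (β_ A B) (Iso.refl C)).trans ((ihom.adjunction B).homEquiv A C)

lemma tensorIhomEquiv_apply {A B C : D} (f : A ⊗ B ⟶ C) :
    tensorIhomEquiv A B C f = curry ((β_ A B).inv ≫ f) := by
  change curry ((β_ A B).inv ≫ f ≫ 𝟙 C) = _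
  rw [Category.comp_id]

lemma tensorIhomEquiv_symm_apply {A B C : D} (f : A ⟶ (ihom B).obj C) :
    (tensorIhomEquiv A B C).symm f = (β_ A B).hom ≫ B ◁ f ≫ (ihom.ev B).app C := by
  refine (Equiv.symm_apply_eq _).2 ((tensorIhomEquiv_apply _).trans ?_).symm
  rw [Iso.inv_hom_id_assoc, ← uncurry_eq, curry_uncurry]

lemma tensorIhomEquiv_naturality {A A' B B' C C' : D} (a : A' ⟶ A) (b : B' ⟶ B) (c : C ⟶ C')
    (f : A ⊗ B ⟶ C) :
    tensorIhomEquiv A' B' C' ((a ⊗ₘ b) ≫ f ≫ c) = a ≫ tensorIhomEquiv A B C f ≫ ihomMap b c := by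
  rw [tensorIhomEquiv_apply, tensorIhomEquiv_apply]
  change _ = a ≫ curry _ ≫ (pre b).app C ≫ (ihom B').map c
  rw [curry_pre_app_assoc, ← curry_natural_right, ← curry_natural_left,
    ← BraidedCategory.braiding_inv_naturality_assoc, MonoidalCategory.tensorHom_def']
  simp only [Category.assoc]

/-- The bijection `Hom (X, Hom (A ⊗ B, C)) ≃ Hom (X, Hom (A, Hom (B, C)))`. -/
def homIhomTensorEquiv (X A B C : D) :
    (X ⟶ (internalHom.obj (op (A ⊗ B))).obj C) ≃
      (X ⟶ (internalHom.obj (op A)).obj ((internalHom.obj (op B)).obj C)) :=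
  (tensorIhomEquiv X (A ⊗ B) C).symm.trans <|
    (Iso.homCongr (α_ X A B).symm (Iso.refl C)).trans <|
      (tensorIhomEquiv (X ⊗ A) B C).trans (tensorIhomEquiv X A _)

lemma homIhomTensorEquiv_tensorIhomEquiv {X A B C : D} (f : X ⊗ (A ⊗ B) ⟶ C) :
    homIhomTensorEquiv X A B C (tensorIhomEquiv X (A ⊗ B) C f) =
      tensorIhomEquiv X A _ (tensorIhomEquiv (X ⊗ A) B C ((α_ X A B).hom ≫ f)) := by
  simp [homIhomTensorEquiv, Iso.homCongr]

lemma homIhomTensorEquiv_naturality {X X' A A' B B' C C' : D} (x : X' ⟶ X) (a : A' ⟶ A)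
    (b : B' ⟶ B) (c : C ⟶ C') (f : X ⟶ (internalHom.obj (op (A ⊗ B))).obj C) :
    homIhomTensorEquiv X' A' B' C' (x ≫ f ≫ ihomMap (a ⊗ₘ b) c) =
      x ≫ homIhomTensorEquiv X A B C f ≫ ihomMap a (ihomMap b c) := by
  obtain ⟨f, rfl⟩ := (tensorIhomEquiv X (A ⊗ B) C).surjective f
  rw [← tensorIhomEquiv_naturality, homIhomTensorEquiv_tensorIhomEquiv,
    homIhomTensorEquiv_tensorIhomEquiv, ← tensorIhomEquiv_naturality,
    ← tensorIhomEquiv_naturality, Category.assoc, associator_naturality_assoc]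

lemma comp_homIhomTensorEquiv {X X' A B C : D} (x : X' ⟶ X)
    (f : X ⟶ (internalHom.obj (op (A ⊗ B))).obj C) :
    homIhomTensorEquiv X' A B C (x ≫ f) = x ≫ homIhomTensorEquiv X A B C f := by
  have h := homIhomTensorEquiv_naturality x (𝟙 A) (𝟙 B) (𝟙 C) f
  rwa [MonoidalCategory.id_tensorHom_id, ihomMap_id_id, ihomMap_id_id, ihomMap_id_id,
    Category.comp_id, Category.comp_id] at h

/-- The internal form of the tensor-Hom adjunction. -/
def ihomTensorIso (A B C : D) : (internalHom.obj (op (A ⊗ B))).obj C ≅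
    (internalHom.obj (op A)).obj ((internalHom.obj (op B)).obj C) where
  hom := homIhomTensorEquiv _ A B C (𝟙 _)
  inv := (homIhomTensorEquiv _ A B C).symm (𝟙 _)
  hom_inv_id := by
    apply (homIhomTensorEquiv _ A B C).injective
    rw [comp_homIhomTensorEquiv, Equiv.apply_symm_apply, Category.comp_id]
  inv_hom_id := by
    rw [← comp_homIhomTensorEquiv, Category.comp_id, Equiv.apply_symm_apply]

lemma comp_ihomTensorIso_hom {X A B C : D} (f : X ⟶ (internalHom.obj (op (A ⊗ B))).obj C) :
    f ≫ (ihomTensorIso A B C).hom = homIhomTensorEquiv X A B C f := by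
  rw [ihomTensorIso, ← comp_homIhomTensorEquiv, Category.comp_id]

lemma ihomTensorIso_hom_naturality {A A' B B' C C' : D} (a : A' ⟶ A) (b : B' ⟶ B) (c : C ⟶ C') :
    ihomMap (a ⊗ₘ b) c ≫ (ihomTensorIso A' B' C').hom =
      (ihomTensorIso A B C).hom ≫ ihomMap a (ihomMap b c) := by
  have h := homIhomTensorEquiv_naturality (𝟙 _) a b c (𝟙 _)
  rwa [Category.id_comp, Category.id_comp, Category.id_comp, ← comp_ihomTensorIso_hom] at h

variable [Preadditive D] [MonoidalPreadditive D]

lemma tensorIhomEquiv_symm_add {A B C : D} (f g : A ⟶ (ihom B).obj C) :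
    (tensorIhomEquiv A B C).symm (f + g : A ⟶ (ihom B).obj C) =
      (tensorIhomEquiv A B C).symm f + (tensorIhomEquiv A B C).symm g := by
  rw [tensorIhomEquiv_symm_apply, tensorIhomEquiv_symm_apply, tensorIhomEquiv_symm_apply,
    MonoidalPreadditive.whiskerLeft_add, Preadditive.add_comp, Preadditive.comp_add]

variable (S : Type*) [CommRing S] [Linear S D] [MonoidalLinear S D]

lemma tensorIhomEquiv_symm_smul {A B C : D} (r : S) (f : A ⟶ (ihom B).obj C) :
    (tensorIhomEquiv A B C).symm (r • f : A ⟶ (ihom B).obj C) =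
      r • (tensorIhomEquiv A B C).symm f := by
  rw [tensorIhomEquiv_symm_apply, tensorIhomEquiv_symm_apply,
    MonoidalLinear.whiskerLeft_smul, Linear.smul_comp, Linear.comp_smul]

/-- The adjunction `Hom (A ⊗ B, C) ≃ Hom (A, Hom (B, C))` of a linear closed braided monoidal
category. -/
def tensorIhomLinearEquiv (A B C : D) :
    (A ⊗ B ⟶ C) ≃ₗ[S] (A ⟶ (internalHom.obj (op B)).obj C) :=
  LinearEquiv.symm
    { (tensorIhomEquiv A B C).symm with
      map_add' := tensorIhomEquiv_symm_add
      map_smul' := tensorIhomEquiv_symm_smul S }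

end

/-! ### The internal Hom of the pure derived category -/

section

variable {R : Type u} [CommRing R]

/-- The evaluation morphism of complexes, the counit of the tensor-Hom adjunction. -/
def cpxEval (B C : Cpx R) : homCpx B C ⊗ B ⟶ C := (tensorHomEquiv (homCpx B C) B C).symm (𝟙 _)

lemma tensorHomEquiv_cpxEval {A B C : Cpx R} (g : A ⟶ homCpx B C) :
    tensorHomEquiv A B C (g ▷ B ≫ cpxEval B C) = g := by
  rw [tensorHomEquiv_whiskerRight, cpxEval, Equiv.apply_symm_apply, Category.comp_id]

lemma homCpxMap_whiskerRight_cpxEval {B B' C C' : Cpx R} (b : B' ⟶ B) (c : C ⟶ C') :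
    homCpxMap b c ▷ B' ≫ cpxEval B' C' = homCpx B C ◁ b ≫ cpxEval B C ≫ c := by
  apply (tensorHomEquiv _ _ _).injective
  rw [tensorHomEquiv_cpxEval, ← MonoidalCategory.id_tensorHom, tensorHomEquiv_naturality, cpxEval,
    Equiv.apply_symm_apply, Category.id_comp, Category.id_comp]

/-- The evaluation morphism in the pure derived category. -/
def derivedEval (B C : Cpx R) : (Q R).obj (homCpx B C) ⊗ (Q R).obj B ⟶ (Q R).obj C :=
  Functor.LaxMonoidal.μ (Q R) _ _ ≫ (Q R).map (cpxEval B C)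

lemma map_whiskerRight_derivedEval {A B C : Cpx R} (g : A ⟶ homCpx B C) :
    (Q R).map g ▷ (Q R).obj B ≫ derivedEval B C =
      Functor.LaxMonoidal.μ (Q R) A B ≫ (Q R).map (g ▷ B ≫ cpxEval B C) := by
  rw [derivedEval, Functor.LaxMonoidal.μ_natural_left_assoc, ← Functor.map_comp]

lemma isEvaluation_derivedEval (B : Cpx R) {I : Cpx R} (hI : IsKPureInjective I) :
    IsEvaluation (derivedEval B I) := fun A => by
  obtain ⟨A, rfl⟩ := Q_obj_surjective A
  constructor
  · intro f g hfg
    obtain ⟨f, rfl⟩ := Q_map_surjective A (hI.homCpx B) f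
    obtain ⟨g, rfl⟩ := Q_map_surjective A (hI.homCpx B) g
    dsimp only at hfg
    rw [map_whiskerRight_derivedEval, map_whiskerRight_derivedEval, cancel_epi,
      Q_map_eq_iff hI, ← quotient_map_tensorHomEquiv_eq_iff, tensorHomEquiv_cpxEval,
      tensorHomEquiv_cpxEval] at hfg
    exact (Q_map_eq_iff (hI.homCpx B) _ _).2 hfg
  · intro h
    obtain ⟨h', hh'⟩ := Q_map_surjective (A ⊗ B) hI (Functor.OplaxMonoidal.δ (Q R) A B ≫ h)
    refine ⟨(Q R).map (tensorHomEquiv A B I h'), ?_⟩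
    dsimp only
    have h_eval : tensorHomEquiv A B I h' ▷ B ≫ cpxEval B I = h' :=
      (tensorHomEquiv A B I).injective (tensorHomEquiv_cpxEval _)
    rw [map_whiskerRight_derivedEval, h_eval, hh', Functor.Monoidal.μ_δ_assoc]

lemma derivedEval_naturality {B B' C C' : Cpx R} (b : B' ⟶ B) (c : C ⟶ C') :
    (Q R).map (homCpxMap b c) ▷ (Q R).obj B' ≫ derivedEval B' C' =
      (Q R).obj (homCpx B C) ◁ (Q R).map b ≫ derivedEval B C ≫ (Q R).map c := by
  rw [map_whiskerRight_derivedEval, homCpxMap_whiskerRight_cpxEval, derivedEval,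
    Functor.map_comp, Functor.map_comp, Category.assoc,
    Functor.LaxMonoidal.μ_natural_right_assoc]

variable {M N : Cpx R} (p : PureProjectiveResolution M) (i : PureInjectiveResolution N)

instance : IsIso ((Q R).map p.π) := isIso_Q_map p.isPureQuasiIso

instance : IsIso ((Q R).map i.ι) := isIso_Q_map i.isPureQuasiIso

/-- The evaluation morphism `Hom (P_M, I_N) ⊗ M ⟶ N` attached to resolutions of `M` and `N`. -/
def resolutionEval :
    (Q R).obj (homCpx p.cpx i.cpx) ⊗ (Q R).obj M ⟶ (Q R).obj N :=
  _ ◁ inv ((Q R).map p.π) ≫ derivedEval p.cpx i.cpx ≫ inv ((Q R).map i.ι)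

lemma resolutionEval_comp_map_ι :
    resolutionEval p i ≫ (Q R).map i.ι =
      _ ◁ inv ((Q R).map p.π) ≫ derivedEval p.cpx i.cpx := by
  simp [resolutionEval]

lemma isEvaluation_resolutionEval : IsEvaluation (resolutionEval p i) := fun A => by
  have h := isEvaluation_derivedEval p.cpx i.isKPureInjective A
  have h_factor (g : A ⟶ (Q R).obj (homCpx p.cpx i.cpx)) :
      g ▷ (Q R).obj M ≫ resolutionEval p i = A ◁ inv ((Q R).map p.π) ≫
        (g ▷ (Q R).obj p.cpx ≫ derivedEval p.cpx i.cpx) ≫ inv ((Q R).map i.ι) := by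
    rw [resolutionEval, ← whisker_exchange_assoc, Category.assoc]
  constructor
  · intro f g hfg
    dsimp only at hfg
    rw [h_factor, h_factor, cancel_epi, cancel_mono] at hfg
    exact h.1 hfg
  · intro f
    obtain ⟨g, hg⟩ := h.2 (A ◁ (Q R).map p.π ≫ f ≫ (Q R).map i.ι)
    refine ⟨g, (h_factor g).trans ?_⟩
    dsimp only at hg
    rw [hg]
    simp

lemma resolutionEval_naturality {M' N' : Cpx R} {p : PureProjectiveResolution M}
    {i : PureInjectiveResolution N} {p' : PureProjectiveResolution M'}
    {i' : PureInjectiveResolution N'}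
    (f : (Q R).obj M' ⟶ (Q R).obj M) (g : (Q R).obj N ⟶ (Q R).obj N')
    (f' : p'.cpx ⟶ p.cpx) (g' : i.cpx ⟶ i'.cpx)
    (hf : (Q R).map f' ≫ (Q R).map p.π = (Q R).map p'.π ≫ f)
    (hg : (Q R).map i.ι ≫ (Q R).map g' = g ≫ (Q R).map i'.ι) :
    (Q R).map (homCpxMap f' g') ▷ (Q R).obj M' ≫ resolutionEval p' i' =
      _ ◁ f ≫ resolutionEval p i ≫ g := by
  have hf' : inv ((Q R).map p'.π) ≫ (Q R).map f' = f ≫ inv ((Q R).map p.π) := by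
    rw [IsIso.inv_comp_eq, ← reassoc_of% hf, IsIso.hom_inv_id, Category.comp_id]
  rw [← cancel_mono ((Q R).map i'.ι)]
  simp only [Category.assoc]
  rw [← hg, resolutionEval_comp_map_ι, reassoc_of% resolutionEval_comp_map_ι,
    ← whisker_exchange_assoc, derivedEval_naturality, ← MonoidalCategory.whiskerLeft_comp_assoc,
    hf', MonoidalCategory.whiskerLeft_comp_assoc]

lemma exists_isEvaluation (B C : Dpur R) :
    ∃ (E : Dpur R) (ev : E ⊗ B ⟶ C), IsEvaluation ev := by
  obtain ⟨M, rfl⟩ := Q_obj_surjective B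
  obtain ⟨N, rfl⟩ := Q_obj_surjective C
  obtain ⟨p⟩ := nonempty_pureProjectiveResolution M
  obtain ⟨i⟩ := nonempty_pureInjectiveResolution N
  exact ⟨_, _, isEvaluation_resolutionEval p i⟩

instance : MonoidalClosed (Dpur R) where
  closed B := closedOfEvaluation (B := B)
    (fun C => (exists_isEvaluation B C).choose_spec.choose_spec)

lemma whiskerLeft_add_cpx (A : Cpx R) {B C : Cpx R} (f g : B ⟶ C) :
    A ◁ (f + g) = A ◁ f + A ◁ g := by
  ext n : 1
  refine tensor_hom_ext fun i j h => ?_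
  simp [tensorι_whiskerLeft]

lemma whiskerLeft_smul_cpx (A : Cpx R) {B C : Cpx R} (r : R) (f : B ⟶ C) :
    A ◁ (r • f) = r • (A ◁ f) := by
  ext n : 1
  refine tensor_hom_ext fun i j h => ?_
  simp [tensorι_whiskerLeft]

instance : (Qh R).Linear R := Localization.functor_linear R (Qh R) (Kpac R).trW

instance : (Q R).Additive := inferInstanceAs (qK R ⋙ Qh R).Additive

instance : (Q R).Linear R := inferInstanceAs ((qK R ⋙ Qh R).Linear R)

lemma whiskerLeft_Q_map (A : Cpx R) {B C : Cpx R} (f : B ⟶ C) :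
    (Q R).obj A ◁ (Q R).map f = Functor.LaxMonoidal.μ (Q R) A B ≫ (Q R).map (A ◁ f) ≫
      Functor.OplaxMonoidal.δ (Q R) A C := by
  rw [← Functor.LaxMonoidal.μ_natural_right_assoc, Functor.Monoidal.μ_δ, Category.comp_id]

instance (A : Dpur R) : (tensorLeft A).Additive := by
  obtain ⟨A, rfl⟩ := Q_obj_surjective A
  rw [Localization.functor_additive_iff (Qh R) (Kpac R).trW]
  refine ⟨fun {X Y f g} => ?_⟩
  obtain ⟨X, rfl⟩ := HomotopyCategory.quotient_obj_surjective X
  obtain ⟨Y, rfl⟩ := HomotopyCategory.quotient_obj_surjective Y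
  obtain ⟨f, rfl⟩ := (qK R).map_surjective f
  obtain ⟨g, rfl⟩ := (qK R).map_surjective g
  rw [← Functor.map_add]
  change (Q R).obj A ◁ (Q R).map (f + g) = (Q R).obj A ◁ (Q R).map f + (Q R).obj A ◁ (Q R).map g
  rw [whiskerLeft_Q_map, whiskerLeft_Q_map, whiskerLeft_Q_map, whiskerLeft_add_cpx,
    Functor.map_add, Preadditive.add_comp, Preadditive.comp_add]

instance (A : Dpur R) : (tensorLeft A).Linear R := by
  obtain ⟨A, rfl⟩ := Q_obj_surjective A
  have : Localization.Lifting (Qh R) (Kpac R).trW (Qh R ⋙ tensorLeft ((Q R).obj A))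
      (tensorLeft ((Q R).obj A)) := ⟨Iso.refl _⟩
  rw [← Localization.functor_linear_iff (Qh R) (Kpac R).trW R
    (Qh R ⋙ tensorLeft ((Q R).obj A))]
  refine ⟨fun {X Y} f r => ?_⟩
  obtain ⟨X, rfl⟩ := HomotopyCategory.quotient_obj_surjective X
  obtain ⟨Y, rfl⟩ := HomotopyCategory.quotient_obj_surjective Y
  obtain ⟨f, rfl⟩ := (qK R).map_surjective f
  rw [← Functor.map_smul]
  change (Q R).obj A ◁ (Q R).map (r • f) = r • ((Q R).obj A ◁ (Q R).map f)
  rw [whiskerLeft_Q_map, whiskerLeft_Q_map, whiskerLeft_smul_cpx,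
    Functor.map_smul, Linear.smul_comp, Linear.comp_smul]

instance : MonoidalPreadditive (Dpur R) := monoidalPreadditive_of_tensorLeft_additive

instance : MonoidalLinear R (Dpur R) := monoidalLinear_of_tensorLeft_linear R

/-- The internal Hom of the pure derived category is the pure derived Hom functor. -/
def pureDerivedHom (P : ∀ M : Cpx R, PureProjectiveResolution M)
    (I : ∀ N : Cpx R, PureInjectiveResolution N) : PureDerivedHom P I where
  functor := MonoidalClosed.internalHom
  iso M N := (isEvaluation_resolutionEval (P M) (I N)).iso
  iso_naturality f g f' g' hf hg :=
    (isEvaluation_resolutionEval _ _).iso_naturality (isEvaluation_resolutionEval _ _) f g _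
      (resolutionEval_naturality f g f' g' hf hg)

end

end PureDerived

end

open PureDerived in
theorem mainTheorem3 (R : Type u) [CommRing R] :
    (∀ M : Cpx R, Nonempty (PureProjectiveResolution M)) ∧
    (∀ N : Cpx R, Nonempty (PureInjectiveResolution N)) ∧
    ∃ (_ : MonoidalCategory (Dpur R)) (_ : SymmetricCategory (Dpur R)) (_ : (Q R).Monoidal),
      (∀ A B : Cpx R, Functor.LaxMonoidal.μ (Q R) A B ≫ (Q R).map (koszulBraiding A B) =
        (β_ ((Q R).obj A) ((Q R).obj B)).hom ≫ Functor.LaxMonoidal.μ (Q R) B A) ∧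
      ∀ (P : ∀ M : Cpx R, PureProjectiveResolution M)
        (I : ∀ N : Cpx R, PureInjectiveResolution N),
        ∃ (H : PureDerivedHom P I)
          (φ : ∀ A B C : Dpur R, H.obj (A ⊗ B) C ≅ H.obj A (H.obj B C))
          (ψ : ∀ A B C : Dpur R, (A ⊗ B ⟶ C) ≃ₗ[R] (A ⟶ H.obj B C))
          (_ : MonoidalClosed (Dpur R))
          (e : MonoidalClosed.internalHom ≅ H.functor),
          (∀ {A A' B B' C C' : Dpur R} (a : A' ⟶ A) (b : B' ⟶ B) (c : C ⟶ C'),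
            H.map (a ⊗ₘ b) c ≫ (φ A' B' C').hom = (φ A B C).hom ≫ H.map a (H.map b c)) ∧
          (∀ {A A' B B' C C' : Dpur R} (a : A' ⟶ A) (b : B' ⟶ B) (c : C ⟶ C') (f : A ⊗ B ⟶ C),
            ψ A' B' C' ((a ⊗ₘ b) ≫ f ≫ c) = a ≫ ψ A B C f ≫ H.map b c) ∧
          (∀ {X A B C : Dpur R} (f : X ⊗ (A ⊗ B) ⟶ C),
            ψ X (A ⊗ B) C f ≫ (φ A B C).hom =
              ψ X A (H.obj B C) (ψ (X ⊗ A) B C ((α_ X A B).hom ≫ f))) ∧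
          (∀ {A B C : Dpur R} (f : A ⊗ B ⟶ C),
            ψ A B C f =
              MonoidalClosed.curry ((β_ B A).hom ≫ f) ≫ (e.hom.app (op B)).app C) := by
  refine ⟨nonempty_pureProjectiveResolution, nonempty_pureInjectiveResolution, inferInstance,
    inferInstance, inferInstance, Q_μ_koszulBraiding, fun P I => ⟨pureDerivedHom P I,
      ihomTensorIso, tensorIhomLinearEquiv R, inferInstance, Iso.refl _, ?_, ?_, ?_, ?_⟩⟩
  · exact ihomTensorIso_hom_naturality
  · exact tensorIhomEquiv_naturality
  · intro X A B C f
    exact (comp_ihomTensorIso_hom _).trans (homIhomTensorEquiv_tensorIhomEquiv f)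
  · intro A B C f
    rw [SymmetricCategory.braiding_swap_eq_inv_braiding]
    exact (tensorIhomEquiv_apply f).trans (Category.comp_id _).symm
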